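/- **Setting.** Let $q\ge 3$, $\lambda=2\cos(\pi/q)$, and let $F_q$ be the nearest-$\lambda$-multiple map on $[-\lambda/2,\lambda/2]$: $F_q(0)=0$ and $F_q(x)=-\frac1x-\lfloor -\frac1{x\lambda}+\frac12\rfloor\lambda$ for $x\ne0$. Put $\kappa=\frac{q-2}{2}$ for even $q$ and $\kappa=q-2$ for odd $q$, and write the orbit $\{F_q^j(-\lambda/2):0\le j\le\kappa\}$ in increasing order as $-\frac\lambda2=\phi_0<\phi_1<\dots<\phi_\kappa=0$. For $1\le j\le\kappa$ let $\mathcal I_j=[\phi_{j-1},\phi_j)$ and $\mathcal I_{-j}=-\mathcal I_j$; let $\mathcal J=\{\pm1,\dots,\pm\kappa\}$, and for $i,j\in\mathcal J$ let $\mathcal N_{ij}=\{n\in\mathbb Z: ST^n\mathcal I_i\subset\mathcal I_j\}$, where $ST^nz=-1/(z+n\lambda)$. Let $(D_i)_{i\in\mathcal J}$ be open disks with centres on the real line such that $0\in D_i$, $\overline{\mathcal I_i}\subset D_i$, and for every $n\in\mathcal N_{ij}$ the map $ST^n$ has no pole on $\overline{D_i}$ and $ST^n\overline{D_i}\subset D_j$.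 Let $\mathcal B_i$ be the Banach space of functions continuous on $\overline{D_i}$ and holomorphic in $D_i$, with the supremum norm, and $\mathcal B=\bigoplus_{i\in\mathcal J}\mathcal B_i$ with the maximum norm. Put $\pi_\beta(ST^n)g(z)=\big((z+n\lambda)^{-2}\big)^{\beta}g\big(-1/(z+n\lambda)\big)$ (principal branch). For $\operatorname{Re}\beta>\frac12$ let $\mathcal L_{\beta,ij}:\mathcal B_j\to\mathcal B_i$, $\mathcal L_{\beta,ij}f=\sum_{n\in\mathcal N_{ij}}\pi_\beta(ST^n)f$, and let $\mathcal L_\beta:\mathcal B\to\mathcal B$ be the transfer operator $(\mathcal L_\beta\vec f)_i=\sum_j\mathcal L_{\beta,ij}f_j$. Put $\beta_k=\frac{1-k}{2}$, $k=0,1,2,\dots$ Holomorphy and meromorphy of operator-valued functions are with respect to the operator norm. An operator is nuclear of order $0$ if it equals $\sum_n\mu_n\,\psi_n\otimes y_n$ with functionals $\|\psi_n\|\le1$, vectors $\|y_n\|\le1$, and $\sum_n|\mu_n|^p<\infty$ for all $p>0$. **Theorem.** For $\operatorname{Re}\beta>\frac12$ the series for $\mathcal L_{\beta,ij}f(z)$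 converge for all $f\in\mathcal B_j$, $z\in\overline{D_i}$, and define bounded operators. Each component $\mathcal L_{\beta,ij}$, and hence $\mathcal L_\beta$, extends meromorphically to all $\beta\in\mathbb C$; the extensions are holomorphic away from the points $\beta_k$, $k\ge0$, and have at most simple poles there. Moreover, for every $N\ge1$ there are operator-valued functions $\mathcal A^{(N)}_{\beta,ij}$ and $\mathcal L^{(N)}_{\beta,ij}$ from $\mathcal B_j$ to $\mathcal B_i$, forming operators $\mathcal A^{(N)}_\beta$ and $\mathcal L^{(N)}_\beta$ on $\mathcal B$, with the following properties. Write $a_k$ for the Taylor coefficients of $f\in\mathcal B_j$ at $0$ and $R_N(z)=f(z)-\sum_{k=0}^Na_kz^k$. 1. If $j=\pm\kappa$, let $\sigma=\pm1$ be the sign of $j$ and $m$ the least $m\in\mathbb N$ with $\sigma m\in\mathcal N_{ij}$. Then for $\beta\notin\{\beta_0,\dots,\beta_N\}$ $$\mathcal A^{(N)}_{\beta,ij}f(z)=\sum_{k=0}^N(-\sigma)^ka_k\,\lambda^{-2\beta-k}\,\zeta\!\left(2\beta+k,\tfrac{\sigma z}{\lambda}+m\right),$$ where $\zeta(s,w)$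 is the Hurwitz zeta function; this operator has finite rank and is meromorphic in $\beta\in\mathbb C$, with at most simple poles at $\beta_0,\dots,\beta_N$ and no others. For $\operatorname{Re}\beta>\frac{1-N}{2}$, $\mathcal L^{(N)}_{\beta,ij}f=\sum_{n\in\mathcal N_{ij}}\pi_\beta(ST^n)R_N$ (convergent) is holomorphic in $\beta$ and nuclear of order $0$, and $\mathcal L_{\beta,ij}=\mathcal A^{(N)}_{\beta,ij}+\mathcal L^{(N)}_{\beta,ij}$ for $\beta\notin\{\beta_0,\dots,\beta_N\}$. 2. If $|j|<\kappa$, then $\mathcal A^{(N)}_{\beta,ij}f=\sum_{n\in\mathcal N_{ij}}\sum_{k=0}^Na_k\,\pi_\beta(ST^n)z^k$ is of finite rank and entire in $\beta$, $\mathcal L^{(N)}_{\beta,ij}f=\sum_{n\in\mathcal N_{ij}}\pi_\beta(ST^n)R_N$ is entire in $\beta$ and nuclear of order $0$, and $\mathcal L_{\beta,ij}=\mathcal A^{(N)}_{\beta,ij}+\mathcal L^{(N)}_{\beta,ij}$ for all $\beta\in\mathbb C$. 3. $\mathcal A^{(N)}_\beta$ has finite rank for $\beta\notin\{\beta_0,\dots,\beta_N\}$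 and is meromorphic on $\mathbb C$, with at most simple poles at $\beta_0,\dots,\beta_N$ and no others; $\mathcal L^{(N)}_\beta$ is holomorphic and nuclear of order $0$ for $\operatorname{Re}\beta>\frac{1-N}{2}$; and there $\mathcal L_\beta=\mathcal A^{(N)}_\beta+\mathcal L^{(N)}_\beta$ for $\beta\notin\{\beta_0,\dots,\beta_N\}$. -/

import Mathlib

open Set

noncomputable section

namespace HeckeTransfer

/-! ### The Hecke triangle group data and the interval map -/

/-- `λ_q = 2 cos (π / q)`. -/
def lam (q : ℕ) : ℝ := 2 * Real.cos (Real.pi / q)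

/-- The nearest `λ`-multiple function `⌊x / λ + 1 / 2⌋`. -/
def nearestMult (q : ℕ) (x : ℝ) : ℤ := ⌊x / lam q + 1 / 2⌋

/-- The generating map of the nearest `λ`-multiple continued fractions:
`F_q 0 = 0` and `F_q x = -1/x - ⟨-1/x⟩ λ` for `x ≠ 0`. -/
def F (q : ℕ) (x : ℝ) : ℝ :=
  if x = 0 then 0 else -1 / x - nearestMult q (-1 / x) * lam q

/-- `κ = (q - 2) / 2` for even `q`, and `κ = 2 h + 1 = q - 2` with `h = (q - 3) / 2`
for odd `q`. -/
def kappa (q : ℕ) : ℕ := if Even q then (q - 2) / 2 else q - 2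

/-- The orbit `{F_q^j (-λ/2) : 0 ≤ j ≤ κ}`. -/
def orbit (q : ℕ) : Finset ℝ :=
  (Finset.range (kappa q + 1)).image fun j => (F q)^[j] (-(lam q) / 2)

/-- The points `φ_0 < φ_1 < ⋯ < φ_κ` of the orbit in increasing order. -/
def markovPoint (q : ℕ) (j : ℕ) : ℝ := ((orbit q).sort (· ≤ ·)).getD j 0

/-- The index set `{1, …, κ, -κ, …, -1}`. -/
def J (q : ℕ) : Finset ℤ := (Finset.Icc (-(kappa q : ℤ)) (kappa q)).erase 0

/-- The intervals of the Markov partition: `I_j = [φ_{j-1}, φ_j)` and `I_{-j} = -I_j`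
for `1 ≤ j ≤ κ`. -/
def markovInterval (q : ℕ) (j : ℤ) : Set ℝ :=
  if 0 < j then Ico (markovPoint q (j.natAbs - 1)) (markovPoint q j.natAbs)
  else {x | -x ∈ Ico (markovPoint q (j.natAbs - 1)) (markovPoint q j.natAbs)}

/-- `N_{ij}`: the integers `n` such that `S T^n : y ↦ -1 / (y + n λ)` maps `I_i` into `I_j`. -/
def branchSet (q : ℕ) (i j : ℤ) : Set ℤ :=
  {n | ∀ y ∈ markovInterval q i, -1 / (y + n * lam q) ∈ markovInterval q j}

/-! ### The Banach spaces -/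

/-- Extension by zero of a function on a closed disk to the whole plane. -/
def extend {c : ℂ} {r : ℝ} (f : C(Metric.closedBall c r, ℂ)) (z : ℂ) : ℂ :=
  open scoped Classical in if h : z ∈ Metric.closedBall c r then f ⟨z, h⟩ else 0

theorem extend_of_mem {c : ℂ} {r : ℝ} (f : C(Metric.closedBall c r, ℂ)) {z : ℂ}
    (h : z ∈ Metric.closedBall c r) : extend f z = f ⟨z, h⟩ := by
  simp only [extend, dif_pos h]

/-- The space `B(D)` of functions continuous on the closure of the disk `D` with centre `c` and
radius `r` and holomorphic in `D`, with the supremum norm. -/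
def diskAlgebra (c : ℂ) (r : ℝ) : Submodule ℂ C(Metric.closedBall c r, ℂ) where
  carrier := {f | DifferentiableOn ℂ (extend f) (Metric.ball c r)}
  add_mem' := by
    intro f g hf hg
    refine (DifferentiableOn.add hf hg).congr fun z hz => ?_
    have hz' := Metric.ball_subset_closedBall hz
    simp [extend_of_mem _ hz']
  zero_mem' := by
    refine (differentiableOn_const (0 : ℂ)).congr fun z hz => ?_
    have hz' := Metric.ball_subset_closedBall hz
    simp [extend_of_mem _ hz']
  smul_mem' := by
    intro a f hf
    refine (DifferentiableOn.const_smul hf a).congr fun z hz => ?_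
    have hz' := Metric.ball_subset_closedBall hz
    simp [extend_of_mem _ hz']

/-- `B(D)` as a type, with the supremum norm. -/
def DiskAlgebra (c : ℂ) (r : ℝ) : Type := ↥(diskAlgebra c r)

instance (c : ℂ) (r : ℝ) : NormedAddCommGroup (DiskAlgebra c r) :=
  inferInstanceAs (NormedAddCommGroup ↥(diskAlgebra c r))

instance (c : ℂ) (r : ℝ) : NormedSpace ℂ (DiskAlgebra c r) :=
  inferInstanceAs (NormedSpace ℂ ↥(diskAlgebra c r))

theorem isClosed_diskAlgebra (c : ℂ) (r : ℝ) : IsClosed 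
    (diskAlgebra c r : Set C(Metric.closedBall c r, ℂ)) := by
  refine IsSeqClosed.isClosed fun u f hu hf => ?_
  have h1 : TendstoUniformlyOn (fun n => extend (u n)) (extend f)
      Filter.atTop (Metric.ball c r) := by
    rw [ContinuousMap.tendsto_iff_tendstoUniformly] at hf
    rw [Metric.tendstoUniformlyOn_iff]
    rw [Metric.tendstoUniformly_iff] at hf
    intro e he
    filter_upwards [hf e he] with n hn z hz
    have hz' := Metric.ball_subset_closedBall hz
    rw [extend_of_mem _ hz', extend_of_mem _ hz']
    exact hn _
  exact h1.tendstoLocallyUniformlyOn.differentiableOn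
    (Filter.Eventually.of_forall hu) Metric.isOpen_ball
instance (c : ℂ) (r : ℝ) : CompleteSpace (DiskAlgebra c r) :=
  (isClosed_diskAlgebra c r).completeSpace_coe

/-- A family of open disks `D_i` (`i ∈ J`) with centres `c i` on the real line and radii `r i`,
such that `D_i` contains `0` and the closure of `I_i`, and such that for `n ∈ N_{ij}` the
transformation `S T^n` has no pole on the closure of `D_i` and maps it into `D_j`. -/
structure Admissible (q : ℕ) (c r : J q → ℝ) : Prop where
  zero_mem : ∀ i, (0 : ℂ) ∈ Metric.ball (c i : ℂ) (r i)
  interval_subset : ∀ i : J q, ∀ x ∈ closure (markovInterval q i),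
    (x : ℂ) ∈ Metric.ball (c i : ℂ) (r i)
  maps : ∀ i j : J q, ∀ n ∈ branchSet q i j, ∀ z ∈ Metric.closedBall (c i : ℂ) (r i),
    z + n * lam q ≠ 0 ∧ -1 / (z + n * lam q) ∈ Metric.ball (c j : ℂ) (r j)

/-- The component space `B_i = B(D_i)`. -/
abbrev Comp (q : ℕ) (c r : J q → ℝ) (i : J q) : Type := DiskAlgebra (c i : ℂ) (r i)

/-- The direct sum `B` of the `B_i`, with the maximum norm. -/
abbrev Total (q : ℕ) (c r : J q → ℝ) : Type := ∀ i : J q, Comp q c r i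

/-- The value of an element of `B(D)` at a point of the plane (zero off the closure of `D`). -/
def val {c : ℂ} {r : ℝ} (f : DiskAlgebra c r) (z : ℂ) : ℂ := extend f.1 z

/-- The Taylor coefficient `a_k` at `0` of `f`. -/
def coeff {c : ℂ} {r : ℝ} (f : DiskAlgebra c r) (k : ℕ) : ℂ :=
  iteratedDeriv k (val f) 0 / (k.factorial : ℂ)

/-- The Taylor remainder `R_N = f - ∑_{k ≤ N} a_k z^k`. -/
def remainder {c : ℂ} {r : ℝ} (N : ℕ) (f : DiskAlgebra c r) (z : ℂ) : ℂ :=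
  val f z - ∑ k ∈ Finset.range (N + 1), coeff f k * z ^ k

/-- The operator with matrix `(T i j)` on the direct sum: `(T f)_i = ∑_j T i j f_j`. -/
def assemble {q : ℕ} {c r : J q → ℝ} (T : ∀ i j, Comp q c r j →L[ℂ] Comp q c r i) :
    Total q c r →L[ℂ] Total q c r :=
  ContinuousLinearMap.pi fun i => ∑ j, (T i j).comp (ContinuousLinearMap.proj j)

/-! ### The transfer operator -/

/-- `π_β(S T^n) g (z) = ((z + n λ)^{-2})^β g (-1 / (z + n λ))`, principal branch. -/
def piST (q : ℕ) (β : ℂ) (n : ℤ) (g : ℂ → ℂ) (z : ℂ) : ℂ :=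
  ((z + n * lam q) ^ (-2 : ℤ)) ^ β * g (-1 / (z + n * lam q))

/-- `T` is the component `L_{β,ij}` of the transfer operator:
`T f (z) = ∑_{n ∈ N_{ij}} π_β(S T^n) f (z)`, with a convergent sum. -/
def IsTransferComponent {q : ℕ} {c r : J q → ℝ} (i j : J q) (β : ℂ)
    (T : Comp q c r j →L[ℂ] Comp q c r i) : Prop :=
  ∀ (f : Comp q c r j), ∀ z ∈ Metric.closedBall (c i : ℂ) (r i),
    HasSum (fun n : branchSet q i j => piST q β n (val f) z) (val (T f) z)

/-- `T` is the remainder component `L^{(N)}_{β,ij}`: `T f (z) = ∑_{n ∈ N_{ij}} π_β(S T^n) R_N (z)`,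
where `R_N` is the Taylor remainder of `f`. -/
def IsRemainderComponent {q : ℕ} {c r : J q → ℝ} (N : ℕ) (i j : J q) (β : ℂ)
    (T : Comp q c r j →L[ℂ] Comp q c r i) : Prop :=
  ∀ (f : Comp q c r j), ∀ z ∈ Metric.closedBall (c i : ℂ) (r i),
    HasSum (fun n : branchSet q i j => piST q β n (remainder N f) z) (val (T f) z)

open scoped Classical in
/-- The Hurwitz zeta function `ζ(s, w)` (for `Re w > 0`, `s ≠ 1`): the analytic continuation to
`s ∈ ℂ ∖ {1}` of `∑_{n ≥ 0} (n + w)^{-s}`. -/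
def hurwitz (s w : ℂ) : ℂ :=
  if h : ∃ g : ℂ → ℂ, DifferentiableOn ℂ g {1}ᶜ ∧
      ∀ t : ℂ, 1 < t.re → HasSum (fun n : ℕ => ((n : ℂ) + w) ^ (-t)) (g t)
  then h.choose s else 0

/-- For `j = ± κ`: the least `m ∈ ℕ` with `± m ∈ N_{ij}`. -/
def firstIndex (q : ℕ) (i j : ℤ) : ℕ := sInf {m : ℕ | j.sign * (m : ℤ) ∈ branchSet q i j}

open scoped Classical in
/-- `T` is the component `A^{(N)}_{β,ij}`. For `j = ± κ` this is
`f ↦ ∑_{k ≤ N} (∓1)^k a_k λ^{-2β-k} ζ(2β + k, ± z/λ + m)` with `m = firstIndex q i j`; for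
`|j| < κ` it is `f ↦ ∑_{n ∈ N_{ij}} ∑_{k ≤ N} a_k π_β(S T^n) z^k` (a finite sum). -/
def IsPrincipalComponent {q : ℕ} {c r : J q → ℝ} (N : ℕ) (i j : J q) (β : ℂ)
    (T : Comp q c r j →L[ℂ] Comp q c r i) : Prop :=
  ∀ (f : Comp q c r j), ∀ z ∈ Metric.closedBall (c i : ℂ) (r i),
    val (T f) z =
      if (j : ℤ).natAbs = kappa q then
        ∑ k ∈ Finset.range (N + 1),
          (-((j : ℤ).sign : ℂ)) ^ k * coeff f k * (lam q : ℂ) ^ (-2 * β - k) *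
            hurwitz (2 * β + k) (((j : ℤ).sign : ℂ) * z / lam q + firstIndex q i j)
      else
        ∑' n : branchSet q i j, ∑ k ∈ Finset.range (N + 1),
          coeff f k * piST q β n (fun w => w ^ k) z

/-! ### Poles, half-planes, nuclearity -/

/-- `β_k = (1 - k) / 2`. -/
def betaPt (k : ℕ) : ℂ := (1 - (k : ℂ)) / 2

/-- `T` is meromorphic on `ℂ` (in operator norm, when `T` is operator valued), holomorphic off
`P`, and has at most a simple pole at each point of `P`. -/
def MeromorphicSimplePoles {E : Type*} [NormedAddCommGroup E] [NormedSpace ℂ E]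
    (P : Set ℂ) (T : ℂ → E) : Prop :=
  MeromorphicOn T univ ∧ (∀ β ∉ P, AnalyticAt ℂ T β) ∧ ∀ β ∈ P, -1 ≤ meromorphicOrderAt T β

/-- The set `{β_k : 0 ≤ k ≤ N}`. -/
def polesUpTo (N : ℕ) : Set ℂ := {β | ∃ k ≤ N, β = betaPt k}

/-- The half-plane `Re β > (1 - N) / 2`. -/
def halfPlane (N : ℕ) : Set ℂ := {β | (1 - (N : ℝ)) / 2 < β.re}

open scoped Classical in
/-- Possible poles of `A^{(N)}_{β,ij}`: `β_0, …, β_N` if `j = ± κ`, none if `|j| < κ`. -/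
def componentPoles (q N : ℕ) (j : ℤ) : Set ℂ :=
  if j.natAbs = kappa q then polesUpTo N else ∅

open scoped Classical in
/-- Domain of `L^{(N)}_{β,ij}`: `Re β > (1 - N) / 2` if `j = ± κ`, and `ℂ` if `|j| < κ`. -/
def componentDomain (q N : ℕ) (j : ℤ) : Set ℂ :=
  if j.natAbs = kappa q then halfPlane N else univ

/-- Nuclear operators of order zero: `T = ∑ μ_n ψ_n ⊗ y_n` with `‖ψ_n‖ ≤ 1`, `‖y_n‖ ≤ 1` and
`∑ |μ_n|^p < ∞` for every `p > 0`. -/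
def NuclearOfOrderZero {E G : Type*} [NormedAddCommGroup E] [NormedSpace ℂ E]
    [NormedAddCommGroup G] [NormedSpace ℂ G] (T : E →L[ℂ] G) : Prop :=
  ∃ (μ : ℕ → ℂ) (ψ : ℕ → E →L[ℂ] ℂ) (y : ℕ → G),
    (∀ n, ‖ψ n‖ ≤ 1) ∧ (∀ n, ‖y n‖ ≤ 1) ∧
    (∀ p : ℝ, 0 < p → Summable fun n => ‖μ n‖ ^ p) ∧
    ∀ x, HasSum (fun n => (μ n * ψ n x) • y n) (T x)

/-- `T` has finite rank. -/
def FiniteRank {E G : Type*} [NormedAddCommGroup E] [NormedSpace ℂ E]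
    [NormedAddCommGroup G] [NormedSpace ℂ G] (T : E →L[ℂ] G) : Prop :=
  FiniteDimensional ℂ (LinearMap.range (T : E →ₗ[ℂ] G))

end HeckeTransfer

end

noncomputable section

namespace HeckeTransfer

open Filter Topology Metric

/-! ### Weakly holomorphic functions -/

/-! The terms of the series for `L_{β,ij} f` are of size `|n|^{-2 Re β}`, so it converges for `Re β
> 1/2`. Since `ST^n z → 0` as `|n| → ∞`, only the Taylor jet of `f` at `0` obstructs continuation:
write `f` as its Taylor polynomial of degree `N` plus `w^{N+1} g`, where `g` is the `(N+1)`-fold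
divided difference of `f` at `0` and depends boundedly on `f`. The factor `w^{N+1}` contributes
`|n|^{-N-1}`, so the remainder series converges already for `Re β > -N/2`.

The remainder operator is nuclear because the image disk can be shrunk: all images `ST^n D̄_i` lie
in one concentric disk of radius `ρ < r_j` (compactness for finitely many `n`, the rest are close to
`0 ∈ D_j`). It therefore factors through restriction to that smaller disk, whose Taylor expansion is
a nuclear representation with geometric weights (`BranchFamily.exists_shrink`,
`nuclearOfOrderZero_restrictCLM`).

The polynomial part needs the sums of the monomials `w^k` over the branches. Only the intervals
`I_{±κ}` have `0` as an end point. If `|j| < κ` the set `N_{ij}` is finite and everything is entire.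
If `|j| = κ` it is a ray `{σ n : n ≥ m}`, and the sum is a power of `λ` times `ζ(2β + k, σz/λ + m)`.
As `(s - 1) ζ(s, w)` is entire in `s`, and `2β + k - 1 = 2 (β - β_k)`, each monomial contributes at
most a simple pole, at `β_k` (`exists_monomialSum_of_ray`). That the orbit of `-λ/2` consists of `κ
+ 1` distinct points with largest point `0` comes from the explicit form `-sin t / sin (t + π/q)` of
its points (`iterate_F_start`).

Holomorphy in operator norm is deduced from holomorphy of every value `(T_β f)(z)` together with
local bounds, since point evaluations are norming (`analyticAt_of_weakly_differentiableOn`). The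
splittings at different levels agree wherever both are defined, so they glue to one continuation on
`ℂ` (`exists_splitting`). -/

/-- A bounded holomorphic function on a disk is Lipschitz on the concentric disk of half the
radius. -/
theorem norm_sub_le_of_bounded_on_ball {h : ℂ → ℂ} {a : ℂ} {ρ M : ℝ} (hρ : 0 < ρ)
    (hd : DifferentiableOn ℂ h (ball a ρ)) (hM : ∀ z ∈ ball a ρ, ‖h z‖ ≤ M)
    {x y : ℂ} (hx : x ∈ ball a (ρ / 2)) (hy : y ∈ ball a (ρ / 2)) :
    ‖h y - h x‖ ≤ M / (ρ / 4) * ‖y - x‖ := by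
  have hsub : ∀ z ∈ ball a (ρ / 2), closedBall z (ρ / 4) ⊆ ball a ρ := by
    intro z hz w hw
    rw [mem_ball] at *
    rw [mem_closedBall] at hw
    linarith [dist_triangle w z a]
  refine (convex_ball a (ρ / 2)).norm_image_sub_le_of_norm_deriv_le (𝕜 := ℂ)
    (fun z hz => ?_) (fun z hz => ?_) hx hy
  · exact hd.differentiableAt (isOpen_ball.mem_nhds (hsub z hz (mem_closedBall_self (by linarith))))
  · refine Complex.norm_deriv_le_of_forall_mem_sphere_norm_le (by linarith) ?_ ?_
    · exact ((hd.mono (hsub z hz)).mono closure_ball_subset_closedBall).diffContOnCl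
    · exact fun w hw => hM w (hsub z hz (sphere_subset_closedBall hw))

/-- A locally bounded function with values in a Banach space is holomorphic if it becomes
holomorphic under each functional of a norming family. -/
theorem analyticAt_of_weakly_differentiableOn {E : Type*} [NormedAddCommGroup E] [NormedSpace ℂ E]
    [CompleteSpace E] {κ : Type*} (l : κ → E →L[ℂ] ℂ)
    (hl : ∀ (x : E) (M : ℝ), 0 ≤ M → (∀ k, ‖l k x‖ ≤ M) → ‖x‖ ≤ M)
    (hl1 : ∀ k, ‖l k‖ ≤ 1) {Φ : ℂ → E} {a : ℂ} {ρ M : ℝ} (hρ : 0 < ρ)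
    (hM : ∀ z ∈ ball a ρ, ‖Φ z‖ ≤ M)
    (hd : ∀ k, DifferentiableOn ℂ (fun z => l k (Φ z)) (ball a ρ)) : AnalyticAt ℂ Φ a := by
  have hM0 : 0 ≤ M := (norm_nonneg _).trans (hM a (mem_ball_self hρ))
  have hlM : ∀ k, ∀ z ∈ ball a ρ, ‖l k (Φ z)‖ ≤ M := fun k z hz =>
    ((l k).le_opNorm _).trans <| by
      calc ‖l k‖ * ‖Φ z‖ ≤ 1 * M := mul_le_mul (hl1 k) (hM z hz) (norm_nonneg _) zero_le_one
        _ = M := one_mul M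
  -- The Cauchy estimate under each `l k` has a constant independent of `k`, so the norming property
  -- turns it into a Lipschitz bound in norm. This makes `Φ` continuous and its circle integrals
  -- meaningful.
  have hlip : ∀ x ∈ ball a (ρ / 2), ∀ y ∈ ball a (ρ / 2),
      ‖Φ y - Φ x‖ ≤ M / (ρ / 4) * ‖y - x‖ := by
    intro x hx y hy
    refine hl _ _ (by positivity) fun k => ?_
    rw [map_sub]
    exact norm_sub_le_of_bounded_on_ball hρ (hd k) (hlM k) hx hy
  have hcont : ContinuousOn Φ (ball a (ρ / 2)) := by
    intro x hx
    refine ContinuousAt.continuousWithinAt ?_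
    rw [ContinuousAt, tendsto_iff_norm_sub_tendsto_zero]
    have h0 : Tendsto (fun y => M / (ρ / 4) * ‖y - x‖) (𝓝 x) (𝓝 0) := by
      have : Continuous fun y : ℂ => M / (ρ / 4) * ‖y - x‖ := by fun_prop
      simpa using this.tendsto x
    refine squeeze_zero' (Eventually.of_forall fun _ => norm_nonneg _) ?_ h0
    filter_upwards [isOpen_ball.mem_nhds hx] with y hy using hlip x hx y hy
  set R : NNReal := ⟨ρ / 4, by positivity⟩ with hR
  have hRpos : 0 < R := by rw [← NNReal.coe_pos]; change 0 < ρ / 4; linarith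
  have hsub : closedBall a (R : ℝ) ⊆ ball a (ρ / 2) := by
    intro z hz
    rw [mem_closedBall] at hz
    rw [mem_ball]
    change dist z a ≤ ρ / 4 at hz
    linarith
  -- `Φ` is compared with its own Cauchy integral, which has a power series. Cauchy's formula holds
  -- after each `l k`, and a norming family separates points.
  have hci : CircleIntegrable Φ a R :=
    (hcont.mono (sphere_subset_closedBall.trans hsub)).circleIntegrable R.2
  have hps := hasFPowerSeriesOn_cauchy_integral hci hRpos
  refine hps.hasFPowerSeriesAt.analyticAt.congr ?_
  filter_upwards [ball_mem_nhds a (NNReal.coe_pos.2 hRpos)] with w hw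
  refine sub_eq_zero.1 (norm_le_zero_iff.1 (hl _ 0 le_rfl fun k => ?_))
  rw [map_sub, norm_le_zero_iff, sub_eq_zero]
  have hdk : DifferentiableOn ℂ (fun z => l k (Φ z)) (closedBall a R) :=
    (hd k).mono (hsub.trans (ball_subset_ball (by linarith)))
  have hC := hdk.circleIntegral_sub_inv_smul hw
  rw [map_smul]
  have hint : CircleIntegrable (fun z => (z - w)⁻¹ • Φ z) a R := by
    refine ContinuousOn.circleIntegrable R.2 (ContinuousOn.smul (ContinuousOn.inv₀ (by fun_prop) ?_)
      (hcont.mono (sphere_subset_closedBall.trans hsub)))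
    intro z hz h0
    rw [sub_eq_zero] at h0
    subst h0
    rw [mem_sphere] at hz
    rw [mem_ball] at hw
    exact absurd hz hw.ne
  have : l k (∮ z in C(a, R), (z - w)⁻¹ • Φ z) = ∮ z in C(a, R), (z - w)⁻¹ • l k (Φ z) := by
    rw [circleIntegral, circleIntegral, ← ContinuousLinearMap.intervalIntegral_comp_comm]
    · simp
    · exact hint.out
  rw [this, hC, smul_smul, inv_mul_cancel₀ Complex.two_pi_I_ne_zero, one_smul]

/-! ### Simple poles -/

/-- `T` has at most a simple pole at `b`. -/
def SimplePoleAt {E : Type*} [NormedAddCommGroup E] [NormedSpace ℂ E] (T : ℂ → E) (b : ℂ) : Prop :=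
  ∃ g : ℂ → E, AnalyticAt ℂ g b ∧ T =ᶠ[𝓝[≠] b] fun z => (z - b)⁻¹ • g z

section SimplePoleAt

variable {E G : Type*} [NormedAddCommGroup E] [NormedSpace ℂ E] [NormedAddCommGroup G]
  [NormedSpace ℂ G] {T T' : ℂ → E} {b : ℂ}

theorem simplePoleAt_of_analyticAt (h : AnalyticAt ℂ T b) : SimplePoleAt T b := by
  refine ⟨fun z => (z - b) • T z, by fun_prop, ?_⟩
  filter_upwards [self_mem_nhdsWithin] with z hz
  rw [smul_smul, inv_mul_cancel₀ (sub_ne_zero.2 hz), one_smul]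

theorem SimplePoleAt.add (h : SimplePoleAt T b) (h' : SimplePoleAt T' b) :
    SimplePoleAt (fun z => T z + T' z) b := by
  obtain ⟨g, hg, e⟩ := h
  obtain ⟨g', hg', e'⟩ := h'
  refine ⟨fun z => g z + g' z, hg.add hg', ?_⟩
  filter_upwards [e, e'] with z h1 h2
  rw [h1, h2, smul_add]

theorem SimplePoleAt.sum {ι : Type*} (s : Finset ι) {T : ι → ℂ → E}
    (h : ∀ i ∈ s, SimplePoleAt (T i) b) : SimplePoleAt (fun z => ∑ i ∈ s, T i z) b := by
  classical
  induction s using Finset.induction_on with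
  | empty => simpa using simplePoleAt_of_analyticAt (T := fun _ => (0 : E)) analyticAt_const
  | insert i s hi ih =>
    simp only [Finset.sum_insert hi]
    exact (h i (by simp)).add (ih fun j hj => h j (by simp [hj]))

theorem SimplePoleAt.clm (L : E →L[ℂ] G) (h : SimplePoleAt T b) :
    SimplePoleAt (fun z => L (T z)) b := by
  obtain ⟨g, hg, e⟩ := h
  refine ⟨fun z => L (g z), (L.analyticAt _).comp hg, ?_⟩
  filter_upwards [e] with z h1
  rw [h1, map_smul]

theorem SimplePoleAt.congr (h : SimplePoleAt T b) (e : T =ᶠ[𝓝[≠] b] T') : SimplePoleAt T' b := by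
  obtain ⟨g, hg, e'⟩ := h
  exact ⟨g, hg, e.symm.trans e'⟩

theorem SimplePoleAt.meromorphicAt (h : SimplePoleAt T b) : MeromorphicAt T b := by
  obtain ⟨g, hg, e⟩ := h
  exact (MeromorphicAt.smul (by fun_prop) hg.meromorphicAt).congr e.symm

/-- Orders add under products: `(z - b)⁻¹` has order exactly `-1` and the analytic factor has order
at least `0`. -/
theorem SimplePoleAt.neg_one_le_order (h : SimplePoleAt T b) : -1 ≤ meromorphicOrderAt T b := by
  obtain ⟨g, hg, e⟩ := h
  rw [meromorphicOrderAt_congr e]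
  have h1 : MeromorphicAt (fun z : ℂ => (z - b)⁻¹) b := by fun_prop
  have := meromorphicOrderAt_smul h1 hg.meromorphicAt
  change -1 ≤ meromorphicOrderAt ((fun z : ℂ => (z - b)⁻¹) • g) b
  rw [this]
  have h2 : meromorphicOrderAt (fun z : ℂ => (z - b)⁻¹) b = -1 := by
    have := meromorphicOrderAt_inv (f := fun z : ℂ => z - b) (x := b)
    change meromorphicOrderAt (fun z : ℂ => z - b)⁻¹ b = -1
    rw [this]
    have h3 : meromorphicOrderAt (fun z : ℂ => z - b) b = 1 := meromorphicOrderAt_id_sub_const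
    rw [h3]
  rw [h2]
  have := hg.meromorphicOrderAt_nonneg
  calc (-1 : WithTop ℤ) = -1 + 0 := (add_zero _).symm
    _ ≤ _ := by gcongr

theorem MeromorphicSimplePoles.of_forall {P : Set ℂ} (ha : ∀ b ∉ P, AnalyticAt ℂ T b)
    (hs : ∀ b ∈ P, SimplePoleAt T b) : MeromorphicSimplePoles P T :=
  ⟨fun b _ => by
    by_cases hb : b ∈ P
    · exact (hs b hb).meromorphicAt
    · exact (ha b hb).meromorphicAt, ha, fun b hb => (hs b hb).neg_one_le_order⟩

end SimplePoleAt

end HeckeTransfer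

namespace HeckeTransfer

open Filter Topology Metric

/-! ### The disk algebra -/

section DiskAlgebra

variable {c : ℂ} {r : ℝ}

theorem val_of_mem (f : DiskAlgebra c r) {z : ℂ} (hz : z ∈ closedBall c r) :
    val f z = f.1 ⟨z, hz⟩ := extend_of_mem _ hz

theorem val_of_notMem (f : DiskAlgebra c r) {z : ℂ} (hz : z ∉ closedBall c r) : val f z = 0 := by
  simp only [val, extend, dif_neg hz]

@[simp]
theorem val_add (f g : DiskAlgebra c r) (z : ℂ) : val (f + g) z = val f z + val g z := by
  by_cases hz : z ∈ closedBall c r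
  · simp only [val_of_mem _ hz]; rfl
  · simp only [val_of_notMem _ hz, add_zero]

@[simp]
theorem val_sub (f g : DiskAlgebra c r) (z : ℂ) : val (f - g) z = val f z - val g z := by
  by_cases hz : z ∈ closedBall c r
  · simp only [val_of_mem _ hz]; rfl
  · simp only [val_of_notMem _ hz, sub_zero]

@[simp]
theorem val_smul (a : ℂ) (f : DiskAlgebra c r) (z : ℂ) : val (a • f) z = a * val f z := by
  by_cases hz : z ∈ closedBall c r
  · simp only [val_of_mem _ hz]; rfl
  · simp only [val_of_notMem _ hz, mul_zero]

theorem continuousOn_val (f : DiskAlgebra c r) : ContinuousOn (val f) (closedBall c r) := by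
  rw [continuousOn_iff_continuous_domRestrict]
  refine f.1.continuous.congr fun z => ?_
  rw [domRestrict_apply, val_of_mem f z.2]

theorem differentiableOn_val (f : DiskAlgebra c r) : DifferentiableOn ℂ (val f) (ball c r) := f.2

theorem norm_val_le (f : DiskAlgebra c r) (z : ℂ) : ‖val f z‖ ≤ ‖f‖ := by
  by_cases hz : z ∈ closedBall c r
  · rw [val_of_mem f hz]
    exact ContinuousMap.norm_coe_le_norm f.1 _
  · rw [val_of_notMem f hz, norm_zero]
    exact norm_nonneg _

theorem norm_le_of_forall_val (f : DiskAlgebra c r) {M : ℝ} (hM : 0 ≤ M)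
    (h : ∀ z ∈ closedBall c r, ‖val f z‖ ≤ M) : ‖f‖ ≤ M := by
  refine (ContinuousMap.norm_le f.1 hM).2 fun z => ?_
  have := h z z.2
  rwa [val_of_mem f z.2] at this

theorem ext_val {f g : DiskAlgebra c r} (h : ∀ z ∈ closedBall c r, val f z = val g z) : f = g := by
  refine sub_eq_zero.1 (norm_le_zero_iff.1 (norm_le_of_forall_val _ le_rfl fun z hz => ?_))
  rw [val_sub, h z hz, sub_self, norm_zero]

/-- Elements of the disk algebra agree if they agree off an interior point. -/
theorem ext_val_of_ne {f g : DiskAlgebra c r} {p : ℂ} (hp : p ∈ ball c r)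
    (h : ∀ z ∈ closedBall c r, z ≠ p → val f z = val g z) : f = g := by
  refine ext_val fun z hz => ?_
  by_cases hzp : z = p
  · subst hzp
    have hn : closedBall c r ∈ 𝓝 z :=
      mem_of_superset (isOpen_ball.mem_nhds hp) ball_subset_closedBall
    have hf : Tendsto (val f) (𝓝[≠] z) (𝓝 (val f z)) :=
      ((continuousOn_val f).continuousAt hn).tendsto.mono_left nhdsWithin_le_nhds
    have hg : Tendsto (val g) (𝓝[≠] z) (𝓝 (val g z)) :=
      ((continuousOn_val g).continuousAt hn).tendsto.mono_left nhdsWithin_le_nhds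
    refine tendsto_nhds_unique (hf.congr' ?_) hg
    filter_upwards [nhdsWithin_le_nhds hn, self_mem_nhdsWithin] with w hw hw'
    exact h w hw hw'
  · exact h z hz hzp

/-- The element of the disk algebra given by a function on the plane. -/
def ofFun (g : ℂ → ℂ) (hc : ContinuousOn g (closedBall c r))
    (hd : DifferentiableOn ℂ g (ball c r)) : DiskAlgebra c r :=
  ⟨⟨fun z => g z, continuousOn_iff_continuous_domRestrict.1 hc⟩,
    hd.congr fun z hz => by rw [extend_of_mem _ (ball_subset_closedBall hz)]; rfl⟩

theorem val_ofFun {g : ℂ → ℂ} (hc : ContinuousOn g (closedBall c r))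
    (hd : DifferentiableOn ℂ g (ball c r)) {z : ℂ} (hz : z ∈ closedBall c r) :
    val (ofFun g hc hd) z = g z := extend_of_mem _ hz

/-- Evaluation at a point as a bounded functional on the disk algebra. -/
def evalCLM (c : ℂ) (r : ℝ) (z : ℂ) : DiskAlgebra c r →L[ℂ] ℂ :=
  LinearMap.mkContinuous
    { toFun := fun f => val f z
      map_add' := fun f g => val_add f g z
      map_smul' := fun a f => val_smul a f z } 1 fun f => by
        rw [one_mul]; exact norm_val_le f z

@[simp]
theorem evalCLM_apply (z : ℂ) (f : DiskAlgebra c r) : evalCLM c r z f = val f z := rfl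

theorem norm_evalCLM_le (z : ℂ) : ‖evalCLM c r z‖ ≤ 1 :=
  LinearMap.mkContinuous_norm_le _ zero_le_one _

theorem val_sum {ι : Type*} (s : Finset ι) (f : ι → DiskAlgebra c r) (z : ℂ) :
    val (∑ i ∈ s, f i) z = ∑ i ∈ s, val (f i) z := map_sum (evalCLM c r z) f s

/-- A linear map between disk algebras is bounded if its values depend continuously on the
argument, off one interior point. -/
theorem continuous_of_forall_val {c' : ℂ} {r' : ℝ} {p : ℂ} (hp : p ∈ ball c r)
    (T : DiskAlgebra c' r' →ₗ[ℂ] DiskAlgebra c r)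
    (h : ∀ z ∈ closedBall c r, z ≠ p → Continuous fun f => val (T f) z) : Continuous T := by
  refine T.continuous_of_seq_closed_graph fun u x y hu hTu => ext_val_of_ne hp fun z hz hzp => ?_
  exact tendsto_nhds_unique (((evalCLM c r z).continuous.tendsto y).comp hTu)
    (((h z hz hzp).tendsto x).comp hu)

/-! ### Divided differences and Taylor coefficients as bounded operators -/

/-- The divided difference `(f - f p) / (z - p)` as an operator on the disk algebra. -/
def divDiff (p : ℂ) (hp : p ∈ ball c r) : DiskAlgebra c r →L[ℂ] DiskAlgebra c r :=
  have hn : ball c r ∈ 𝓝 p := isOpen_ball.mem_nhds hp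
  have hn' : closedBall c r ∈ 𝓝 p := mem_of_superset hn ball_subset_closedBall
  let g : DiskAlgebra c r → DiskAlgebra c r := fun f => ofFun (dslope (val f) p)
    ((continuousOn_dslope hn').2
      ⟨continuousOn_val f, (differentiableOn_val f).differentiableAt hn⟩)
    ((Complex.differentiableOn_dslope hn).2 (differentiableOn_val f))
  have hg : ∀ f, ∀ z ∈ closedBall c r, z ≠ p → val (g f) z = (z - p)⁻¹ * (val f z - val f p) :=
    fun f z hz hzp => by
      rw [val_ofFun _ _ hz, dslope_of_ne _ hzp, slope_def_field, div_eq_inv_mul]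
  let T : DiskAlgebra c r →ₗ[ℂ] DiskAlgebra c r :=
    { toFun := g
      map_add' := fun f₁ f₂ => ext_val_of_ne hp fun z hz hzp => by
        simp only [val_add, hg _ z hz hzp]; ring
      map_smul' := fun a f => ext_val_of_ne hp fun z hz hzp => by
        simp only [val_smul, hg _ z hz hzp, RingHom.id_apply]; ring }
  -- The closed graph theorem replaces a norm estimate of the divided difference near `p`.
  ⟨T, continuous_of_forall_val hp T fun z hz hzp => by
    refine ((((evalCLM c r z).continuous.sub (evalCLM c r p).continuous).const_mul
      (z - p)⁻¹)).congr fun f => (hg f z hz hzp).symm⟩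

variable {p : ℂ}

theorem val_divDiff (hp : p ∈ ball c r) (f : DiskAlgebra c r) {z : ℂ} (hz : z ∈ closedBall c r) :
    val (divDiff p hp f) z = dslope (val f) p z := extend_of_mem _ hz

/-- The Taylor coefficient of order `k` at `p` as a bounded functional. -/
def taylorCLM (p : ℂ) (hp : p ∈ ball c r) (k : ℕ) : DiskAlgebra c r →L[ℂ] ℂ :=
  (evalCLM c r p).comp (divDiff p hp ^ k)

theorem divDiff_pow_succ (hp : p ∈ ball c r) (k : ℕ) (f : DiskAlgebra c r) :
    (divDiff p hp ^ (k + 1)) f = divDiff p hp ((divDiff p hp ^ k) f) := by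
  rw [pow_succ']; rfl

/-- A divided difference shifts the power series at `p` by one place, so after `k` of them the value
at `p` is the `k`-th coefficient. Boundedness of Taylor coefficients thus comes for free. -/
theorem taylorCLM_apply (hp : p ∈ ball c r) (k : ℕ) (f : DiskAlgebra c r) :
    taylorCLM p hp k f = iteratedDeriv k (val f) p / (k.factorial : ℂ) := by
  have hn : ball c r ∈ 𝓝 p := isOpen_ball.mem_nhds hp
  have han := ((differentiableOn_val f).analyticAt hn).hasFPowerSeriesAt
  set P := FormalMultilinearSeries.ofScalars ℂ
    fun n => iteratedDeriv n (val f) p / (n.factorial : ℂ)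
  have key : HasFPowerSeriesAt (val ((divDiff p hp ^ k) f)) (FormalMultilinearSeries.fslope^[k] P)
      p := by
    induction k with
    | zero => simpa using han
    | succ k ih =>
      rw [Function.iterate_succ_apply']
      refine (HasFPowerSeriesAt.has_fpower_series_dslope_fslope ih).congr ?_
      filter_upwards [hn] with z hz
      rw [divDiff_pow_succ, val_divDiff hp _ (ball_subset_closedBall hz)]
  have h0 := key.coeff_zero (fun _ => 1)
  change val ((divDiff p hp ^ k) f) p = _
  rw [← h0]
  change (FormalMultilinearSeries.fslope^[k] P).coeff 0 = _
  rw [FormalMultilinearSeries.coeff_iterate_fslope, zero_add]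
  simp [P, FormalMultilinearSeries.coeff_ofScalars]

/-- Exact Taylor formula: the remainder is `(z - p)^n` times a function of the same space, valid up
to the boundary of the disk. -/
theorem val_eq_taylor_add (hp : p ∈ ball c r) (n : ℕ) (f : DiskAlgebra c r) {z : ℂ}
    (hz : z ∈ closedBall c r) :
    val f z = ∑ k ∈ Finset.range n, taylorCLM p hp k f * (z - p) ^ k +
      (z - p) ^ n * val ((divDiff p hp ^ n) f) z := by
  induction n with
  | zero => simp
  | succ n ih =>
    rw [ih, Finset.sum_range_succ, divDiff_pow_succ, val_divDiff hp _ hz, add_assoc]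
    congr 1
    have := sub_smul_dslope (val ((divDiff p hp ^ n) f)) p z
    rw [smul_eq_mul] at this
    rw [pow_succ, mul_assoc, this]
    change _ = val ((divDiff p hp ^ n) f) p * (z - p) ^ n + _
    ring

theorem norm_taylorCLM_center_le (hp : c ∈ ball c r) (k : ℕ) (f : DiskAlgebra c r) :
    ‖taylorCLM c hp k f‖ ≤ ‖f‖ / r ^ k := by
  have hr : 0 < r := pos_of_mem_ball hp
  rw [taylorCLM_apply, norm_div, Complex.norm_natCast]
  have h : DiffContOnCl ℂ (val f) (ball c r) :=
    ⟨differentiableOn_val f, by rw [closure_ball c hr.ne']; exact continuousOn_val f⟩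
  rw [div_le_iff₀ (by positivity)]
  refine (Complex.norm_iteratedDeriv_le_of_forall_mem_sphere_norm_le k hr h
    fun z _ => norm_val_le f z).trans (le_of_eq ?_)
  ring

/-- Restriction to a concentric smaller disk. -/
def restrictCLM (c : ℂ) {r r' : ℝ} (h : r' ≤ r) : DiskAlgebra c r →L[ℂ] DiskAlgebra c r' :=
  have hg : ∀ f : DiskAlgebra c r, ∀ z ∈ closedBall c r',
      val (ofFun (val f) ((continuousOn_val f).mono (closedBall_subset_closedBall h))
        ((differentiableOn_val f).mono (ball_subset_ball h)) : DiskAlgebra c r') z = val f z :=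
    fun f z hz => val_ofFun _ _ hz
  LinearMap.mkContinuous
    { toFun := fun f => ofFun (val f) ((continuousOn_val f).mono (closedBall_subset_closedBall h))
        ((differentiableOn_val f).mono (ball_subset_ball h))
      map_add' := fun f₁ f₂ => ext_val fun z hz => by simp only [val_add, hg _ z hz]
      map_smul' := fun a f => ext_val fun z hz => by
        simp only [val_smul, hg _ z hz, RingHom.id_apply] } 1 fun f => by
    rw [one_mul]
    refine norm_le_of_forall_val _ (norm_nonneg _) fun z hz => ?_
    exact (le_of_eq (congrArg norm (hg f z hz))).trans (norm_val_le f z)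

theorem val_restrictCLM {r r' : ℝ} (h : r' ≤ r) (f : DiskAlgebra c r) {z : ℂ}
    (hz : z ∈ closedBall c r') : val (restrictCLM c h f) z = val f z := extend_of_mem _ hz

end DiskAlgebra

/-! ### Nuclear operators and operators of finite rank -/

section Nuclear

variable {E G H : Type*} [NormedAddCommGroup E] [NormedSpace ℂ E] [NormedAddCommGroup G]
  [NormedSpace ℂ G] [NormedAddCommGroup H] [NormedSpace ℂ H]

theorem NuclearOfOrderZero.clm_comp {T : E →L[ℂ] G} (hT : NuclearOfOrderZero T) (B : G →L[ℂ] H) :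
    NuclearOfOrderZero (B.comp T) := by
  obtain ⟨μ, ψ, y, hψ, hy, hμ, hs⟩ := hT
  -- The added `1` keeps the normalising constant nonzero when `B = 0`.
  set M : ℝ := ‖B‖ + 1
  have hM : 0 < M := by positivity
  have hMc : (M : ℂ) ≠ 0 := by exact_mod_cast hM.ne'
  refine ⟨fun n => M * μ n, ψ, fun n => (M : ℂ)⁻¹ • B (y n), hψ, fun n => ?_, fun p hp => ?_,
    fun x => ?_⟩
  · rw [norm_smul, norm_inv, Complex.norm_real, Real.norm_of_nonneg hM.le, inv_mul_le_iff₀ hM,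
      mul_one]
    have := (B.le_opNorm (y n)).trans (mul_le_of_le_one_right (norm_nonneg _) (hy n))
    exact this.trans (by simp [M])
  · simp only [norm_mul, Real.mul_rpow (norm_nonneg _) (norm_nonneg _)]
    exact (hμ p hp).mul_left _
  · refine (B.hasSum (hs x)).congr_fun ?_
    intro n
    simp only [map_smul, smul_smul]
    congr 1
    field_simp

theorem NuclearOfOrderZero.comp_clm {T : E →L[ℂ] G} (hT : NuclearOfOrderZero T) (B : H →L[ℂ] E) :
    NuclearOfOrderZero (T.comp B) := by
  obtain ⟨μ, ψ, y, hψ, hy, hμ, hs⟩ := hT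
  set M : ℝ := ‖B‖ + 1
  have hM : 0 < M := by positivity
  have hMc : (M : ℂ) ≠ 0 := by exact_mod_cast hM.ne'
  refine ⟨fun n => M * μ n, fun n => (M : ℂ)⁻¹ • (ψ n).comp B, y, fun n => ?_, hy, fun p hp => ?_,
    fun x => ?_⟩
  · rw [norm_smul, norm_inv, Complex.norm_real, Real.norm_of_nonneg hM.le, inv_mul_le_iff₀ hM,
      mul_one]
    have := ((ψ n).opNorm_comp_le B).trans (mul_le_of_le_one_left (norm_nonneg _) (hψ n))
    exact this.trans (by simp [M])
  · simp only [norm_mul, Real.mul_rpow (norm_nonneg _) (norm_nonneg _)]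
    exact (hμ p hp).mul_left _
  · refine (hs (B x)).congr_fun ?_
    intro n
    simp only [smul_apply, ContinuousLinearMap.comp_apply, smul_eq_mul]
    congr 1
    field_simp

theorem nuclearOfOrderZero_zero : NuclearOfOrderZero (0 : E →L[ℂ] G) :=
  ⟨fun _ => 0, fun _ => 0, fun _ => 0, by simp, by simp, fun p hp => by
    simp [Real.zero_rpow hp.ne'], fun x => by simp⟩

theorem NuclearOfOrderZero.add {T T' : E →L[ℂ] G} (hT : NuclearOfOrderZero T)
    (hT' : NuclearOfOrderZero T') : NuclearOfOrderZero (T + T') := by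
  obtain ⟨μ, ψ, y, hψ, hy, hμ, hs⟩ := hT
  obtain ⟨μ', ψ', y', hψ', hy', hμ', hs'⟩ := hT'
  -- The two representations are interleaved along this bijection.
  set e : ℕ ≃ ℕ ⊕ ℕ := Equiv.natSumNatEquivNat.symm
  refine ⟨fun n => Sum.elim μ μ' (e n), fun n => Sum.elim ψ ψ' (e n),
    fun n => Sum.elim y y' (e n), fun n => ?_, fun n => ?_, fun p hp => ?_, fun x => ?_⟩
  · change ‖Sum.elim ψ ψ' (e n)‖ ≤ 1
    rcases e n with k | k
    · exact hψ k
    · exact hψ' k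
  · change ‖Sum.elim y y' (e n)‖ ≤ 1
    rcases e n with k | k
    · exact hy k
    · exact hy' k
  · exact (e.summable_iff (f := fun s => ‖Sum.elim μ μ' s‖ ^ p)).2
      (Summable.sum _ (hμ p hp) (hμ' p hp))
  · exact (e.hasSum_iff
      (f := fun s => (Sum.elim μ μ' s * Sum.elim ψ ψ' s x) • Sum.elim y y' s)).2
      (HasSum.sum (hs x) (hs' x))

theorem NuclearOfOrderZero.sum {ι : Type*} (s : Finset ι) {T : ι → E →L[ℂ] G}
    (h : ∀ i ∈ s, NuclearOfOrderZero (T i)) : NuclearOfOrderZero (∑ i ∈ s, T i) := by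
  classical
  induction s using Finset.induction_on with
  | empty => simpa using nuclearOfOrderZero_zero
  | insert i s hi ih =>
    rw [Finset.sum_insert hi]
    exact (h i (by simp)).add (ih fun j hj => h j (by simp [hj]))

/-- Restriction to a strictly smaller concentric disk is nuclear of order zero. -/
theorem nuclearOfOrderZero_restrictCLM {c : ℂ} {r r' : ℝ} (h0 : 0 < r') (h : r' < r) :
    NuclearOfOrderZero (restrictCLM c h.le) := by
  have hr : 0 < r := h0.trans h
  have hc : c ∈ ball c r := mem_ball_self hr
  have h0c : (r' : ℂ) ≠ 0 := by exact_mod_cast h0.ne'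
  have hrc : (r : ℂ) ≠ 0 := by exact_mod_cast hr.ne'
  set m : ℕ → DiskAlgebra c r' := fun k =>
    ofFun (fun z => ((r' : ℂ)⁻¹ * (z - c)) ^ k) (by fun_prop) (by fun_prop)
  have hm : ∀ k, ‖m k‖ ≤ 1 := fun k => by
    refine norm_le_of_forall_val _ zero_le_one fun z hz => ?_
    rw [val_ofFun _ _ hz, norm_pow]
    refine pow_le_one₀ (norm_nonneg _) ?_
    rw [norm_mul, norm_inv, Complex.norm_real, Real.norm_of_nonneg h0.le, inv_mul_le_iff₀ h0,
      mul_one]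
    exact mem_closedBall_iff_norm.1 hz
  have hψ : ∀ k, ‖((r : ℂ) ^ k) • taylorCLM c hc k‖ ≤ 1 := fun k => by
    refine ContinuousLinearMap.opNorm_le_bound _ zero_le_one fun f => ?_
    rw [smul_apply, norm_smul, norm_pow, Complex.norm_real,
      Real.norm_of_nonneg hr.le, one_mul]
    have := norm_taylorCLM_center_le hc k f
    rw [le_div_iff₀ (by positivity)] at this
    linarith
  have hq0 : 0 ≤ r' / r := by positivity
  have hq1 : r' / r < 1 := (div_lt_one hr).2 h
  have hnorm : ∀ k, ‖((r' / r : ℝ) : ℂ) ^ k‖ = (r' / r) ^ k := fun k => by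
    rw [norm_pow, Complex.norm_real, Real.norm_of_nonneg hq0]
  -- The Taylor term `a_k (z - c)^k` is written as `(r'/r)^k · (r^k a_k) · ((z - c)/r')^k`. The last
  -- two factors are normalised, by Cauchy's estimate and on the smaller disk respectively, and
  -- geometric weights are `p`-summable for every `p > 0`.
  refine ⟨fun k => ((r' / r : ℝ) : ℂ) ^ k, fun k => ((r : ℂ) ^ k) • taylorCLM c hc k, m, hψ, hm,
    fun p hp => ?_, fun f => ?_⟩
  · have : ∀ k : ℕ, ‖((r' / r : ℝ) : ℂ) ^ k‖ ^ p = ((r' / r) ^ p) ^ k := fun k => by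
      rw [hnorm, ← Real.rpow_natCast, ← Real.rpow_natCast, ← Real.rpow_mul hq0,
        ← Real.rpow_mul hq0, mul_comm]
    simp only [this]
    exact summable_geometric_of_lt_one (Real.rpow_nonneg hq0 p) (Real.rpow_lt_one hq0 hq1 hp)
  · have hsum : Summable fun k => (((r' / r : ℝ) : ℂ) ^ k *
        (((r : ℂ) ^ k) • taylorCLM c hc k) f) • m k := by
      refine Summable.of_norm_bounded
        ((summable_geometric_of_lt_one hq0 hq1).mul_right ‖f‖) fun k => ?_
      rw [norm_smul, norm_mul, hnorm]
      have h1 := (((r : ℂ) ^ k) • taylorCLM c hc k).le_of_opNorm_le (hψ k) f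
      rw [one_mul] at h1
      calc (r' / r) ^ k * ‖(((r : ℂ) ^ k) • taylorCLM c hc k) f‖ * ‖m k‖
          ≤ (r' / r) ^ k * ‖f‖ * 1 := by gcongr; exact hm k
        _ = _ := mul_one _
    convert hsum.hasSum
    refine ext_val fun z hz => ?_
    rw [val_restrictCLM _ _ hz, ← evalCLM_apply (r := r'), (evalCLM c r' z).map_tsum hsum]
    have hz' : z ∈ ball c r := closedBall_subset_ball h hz
    refine (HasSum.tsum_eq ?_).symm
    refine (Complex.hasSum_taylorSeries_on_ball (differentiableOn_val f) hz').congr_fun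
      (fun k => ?_)
    rw [map_smul, evalCLM_apply, val_ofFun _ _ hz, smul_apply, taylorCLM_apply]
    have hk : (k.factorial : ℂ) ≠ 0 := by exact_mod_cast k.factorial_ne_zero
    simp only [smul_eq_mul, mul_pow, inv_pow, Complex.ofReal_div, div_pow]
    field_simp

/-! ### Operators of finite rank -/

theorem FiniteRank.add {T T' : E →L[ℂ] G} (hT : FiniteRank T) (hT' : FiniteRank T') :
    FiniteRank (T + T') := by
  unfold FiniteRank at *
  refine Submodule.finiteDimensional_of_le
    (S₂ := LinearMap.range (T : E →ₗ[ℂ] G) ⊔ LinearMap.range (T' : E →ₗ[ℂ] G)) ?_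
  rintro _ ⟨x, rfl⟩
  exact Submodule.add_mem_sup ⟨x, rfl⟩ ⟨x, rfl⟩

theorem finiteRank_zero : FiniteRank (0 : E →L[ℂ] G) := by
  unfold FiniteRank
  rw [ContinuousLinearMap.toLinearMap_zero, LinearMap.range_zero]
  infer_instance

theorem FiniteRank.sum {ι : Type*} (s : Finset ι) {T : ι → E →L[ℂ] G}
    (h : ∀ i ∈ s, FiniteRank (T i)) : FiniteRank (∑ i ∈ s, T i) := by
  classical
  induction s using Finset.induction_on with
  | empty => simpa using finiteRank_zero
  | insert i s hi ih =>
    rw [Finset.sum_insert hi]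
    exact (h i (by simp)).add (ih fun j hj => h j (by simp [hj]))

theorem finiteRank_smulRight (l : E →L[ℂ] ℂ) (x : G) : FiniteRank (l.smulRight x) := by
  unfold FiniteRank
  refine Submodule.finiteDimensional_of_le (S₂ := Submodule.span ℂ {x}) ?_
  rintro _ ⟨y, rfl⟩
  exact Submodule.smul_mem _ _ (Submodule.mem_span_singleton_self x)

theorem FiniteRank.clm_comp {T : E →L[ℂ] G} (hT : FiniteRank T) (B : G →L[ℂ] H) :
    FiniteRank (B.comp T) := by
  unfold FiniteRank at *
  have : LinearMap.range ((B.comp T : E →L[ℂ] H) : E →ₗ[ℂ] H) =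
      (LinearMap.range (T : E →ₗ[ℂ] G)).map (B : G →ₗ[ℂ] H) := by
    rw [← LinearMap.range_comp]; rfl
  rw [this]
  infer_instance

theorem FiniteRank.comp_clm {T : E →L[ℂ] G} (hT : FiniteRank T) (B : H →L[ℂ] E) :
    FiniteRank (T.comp B) := by
  unfold FiniteRank at *
  refine Submodule.finiteDimensional_of_le (S₂ := LinearMap.range (T : E →ₗ[ℂ] G)) ?_
  rintro _ ⟨x, rfl⟩
  exact ⟨B x, rfl⟩

end Nuclear

end HeckeTransfer

namespace HeckeTransfer

open Filter Topology Metric MeasureTheory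
open scoped Interval

/-! ### Integrals depending on a parameter -/

theorem exists_bound_nhds_of_continuousOn {X : Type*} [TopologicalSpace X] [LocallyCompactSpace X]
    {U : Set X} (hU : IsOpen U) {F : X → ℝ → ℂ}
    (hF : ContinuousOn (Function.uncurry F) (U ×ˢ Icc (0 : ℝ) 1)) {a : X} (ha : a ∈ U) :
    ∃ K ∈ 𝓝 a, K ⊆ U ∧ ∃ M : ℝ, ∀ x ∈ K, ∀ t ∈ Icc (0 : ℝ) 1, ‖F x t‖ ≤ M := by
  obtain ⟨K, hK, hKU, hKc⟩ := local_compact_nhds (hU.mem_nhds ha)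
  obtain ⟨M, hM⟩ := (hKc.prod (isCompact_Icc (a := (0 : ℝ)) (b := 1))).exists_bound_of_continuousOn
    (hF.mono (prod_mono hKU Subset.rfl))
  exact ⟨K, hK, hKU, M, fun x hx t ht => hM (x, t) ⟨hx, ht⟩⟩

theorem uIoc_zero_one_subset : Ι (0 : ℝ) 1 ⊆ Icc 0 1 := by
  rw [uIoc_of_le zero_le_one]
  exact Ioc_subset_Icc_self

theorem aestronglyMeasurable_of_continuousOn_Icc {g : ℝ → ℂ} (hg : ContinuousOn g (Icc 0 1)) :
    AEStronglyMeasurable g (volume.restrict (Ι (0 : ℝ) 1)) :=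
  (hg.mono uIoc_zero_one_subset).aestronglyMeasurable measurableSet_uIoc

theorem continuousOn_slice {X : Type*} [TopologicalSpace X] {U : Set X} {F : X → ℝ → ℂ}
    (hF : ContinuousOn (Function.uncurry F) (U ×ˢ Icc (0 : ℝ) 1)) {x : X} (hx : x ∈ U) :
    ContinuousOn (F x) (Icc 0 1) :=
  hF.comp (f := fun t => (x, t)) (by fun_prop) fun _ ht => ⟨hx, ht⟩

theorem continuousOn_integral_param {X : Type*} [TopologicalSpace X] [LocallyCompactSpace X]
    [FirstCountableTopology X] {U : Set X} (hU : IsOpen U) {F : X → ℝ → ℂ}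
    (hF : ContinuousOn (Function.uncurry F) (U ×ˢ Icc (0 : ℝ) 1)) :
    ContinuousOn (fun x => ∫ t in (0 : ℝ)..1, F x t) U := by
  intro a ha
  obtain ⟨K, hK, hKU, M, hM⟩ := exists_bound_nhds_of_continuousOn hU hF ha
  refine ContinuousAt.continuousWithinAt ?_
  refine intervalIntegral.continuousAt_of_dominated_interval (bound := fun _ => M) ?_ ?_ ?_ ?_
  · filter_upwards [hK] with x hx
    exact aestronglyMeasurable_of_continuousOn_Icc (continuousOn_slice hF (hKU hx))
  · filter_upwards [hK] with x hx
    exact Eventually.of_forall fun t ht => hM x hx t (uIoc_zero_one_subset ht)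
  · exact intervalIntegrable_const
  · refine Eventually.of_forall fun t ht => ?_
    have h : ContinuousOn (fun x => F x t) U :=
      hF.comp (f := fun x => (x, t)) (by fun_prop) fun _ hx => ⟨hx, uIoc_zero_one_subset ht⟩
    exact h.continuousAt (hU.mem_nhds ha)

/-- Differentiation under the integral. Joint continuity gives a local bound, and the Cauchy
estimate turns it into the uniform Lipschitz bound required for domination, so nothing is assumed
about the derivative in `z`. -/
theorem differentiableOn_integral_param {U : Set ℂ} (hU : IsOpen U) {F : ℂ → ℝ → ℂ}
    (hF : ContinuousOn (Function.uncurry F) (U ×ˢ Icc (0 : ℝ) 1))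
    (hd : ∀ t ∈ Icc (0 : ℝ) 1, DifferentiableOn ℂ (fun z => F z t) U) :
    DifferentiableOn ℂ (fun z => ∫ t in (0 : ℝ)..1, F z t) U := by
  intro a ha
  obtain ⟨K, hK, hKU, M, hM⟩ := exists_bound_nhds_of_continuousOn hU hF ha
  obtain ⟨ρ, hρ, hρK⟩ := Metric.mem_nhds_iff.1 hK
  have hder : ∀ t ∈ Icc (0 : ℝ) 1,
      HasDerivAt (fun z => F z t) (deriv (fun z => F z t) a) a := fun t ht =>
    ((hd t ht).differentiableAt (hU.mem_nhds ha)).hasDerivAt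
  have hhalf : ball a (ρ / 2) ∈ 𝓝 a := ball_mem_nhds a (by linarith)
  refine (intervalIntegral.hasDerivAt_integral_of_dominated_loc_of_lip
    (bound := fun _ => M / (ρ / 4)) (F' := fun t => deriv (fun z => F z t) a) hhalf
    ?_ ?_ ?_ ?_ ?_ ?_).2.differentiableAt.differentiableWithinAt
  · filter_upwards [hK] with x hx
    exact aestronglyMeasurable_of_continuousOn_Icc (continuousOn_slice hF (hKU hx))
  · refine ContinuousOn.intervalIntegrable ?_
    rw [uIcc_of_le zero_le_one]
    exact continuousOn_slice hF ha
  -- Measurability in `t` of the derivative: it is the limit of difference quotients along a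
  -- sequence of points tending to `a`.
  · set h : ℕ → ℂ := fun n => a + ((ρ / 2 * (1 / ((n : ℝ) + 1)) : ℝ) : ℂ)
    have hpos : ∀ n : ℕ, 0 < ρ / 2 * (1 / ((n : ℝ) + 1)) := fun n => by positivity
    have hlim : Tendsto h atTop (𝓝[≠] a) := by
      refine tendsto_nhdsWithin_iff.2 ⟨?_, Eventually.of_forall fun n => ?_⟩
      · have h1 := (tendsto_one_div_add_atTop_nhds_zero_nat (𝕜 := ℝ)).const_mul (ρ / 2)
        have h2 := (Complex.continuous_ofReal.tendsto _).comp h1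
        simpa [h, Function.comp_def] using h2.const_add a
      · simp only [h, mem_compl_iff, mem_singleton_iff, add_eq_left]
        exact_mod_cast (hpos n).ne'
    have hmem : ∀ n, h n ∈ ball a ρ := fun n => by
      rw [mem_ball_iff_norm]
      simp only [h, add_sub_cancel_left, Complex.norm_real, Real.norm_of_nonneg (hpos n).le]
      have : (1 : ℝ) / ((n : ℝ) + 1) ≤ 1 := by
        rw [div_le_one (by positivity)]
        linarith [(Nat.cast_nonneg n : (0 : ℝ) ≤ n)]
      nlinarith
    refine aestronglyMeasurable_of_tendsto_ae atTop
      (f := fun n t => slope (fun z => F z t) a (h n)) (fun n => ?_) ?_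
    · simp only [slope_def_field]
      refine aestronglyMeasurable_of_continuousOn_Icc (ContinuousOn.div_const ?_ _)
      exact (continuousOn_slice hF (hKU (hρK (hmem n)))).sub (continuousOn_slice hF ha)
    · refine (ae_restrict_iff' measurableSet_uIoc).2 (Eventually.of_forall fun t ht => ?_)
      exact (hasDerivAt_iff_tendsto_slope.1 (hder t (uIoc_zero_one_subset ht))).comp hlim
  · refine Eventually.of_forall fun t ht => ?_
    have ht' := uIoc_zero_one_subset ht
    have hM0 : 0 ≤ M := (norm_nonneg _).trans (hM a (mem_of_mem_nhds hK) t ht')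
    refine LipschitzOnWith.of_dist_le_mul fun x hx y hy => ?_
    rw [dist_eq_norm, dist_eq_norm, Real.coe_nnabs, abs_of_nonneg (by positivity)]
    exact norm_sub_le_of_bounded_on_ball hρ ((hd t ht').mono (hρK.trans hKU))
      (fun z hz => hM z (hρK hz) t ht') hy hx
  · exact intervalIntegrable_const
  · exact Eventually.of_forall fun t ht => hder t (uIoc_zero_one_subset ht)

/-! ### Bounds for complex powers -/

theorem norm_cpow_le_mul_exp {x : ℂ} (hx : x ≠ 0) (s : ℂ) :
    ‖x ^ s‖ ≤ ‖x‖ ^ s.re * Real.exp (Real.pi * |s.im|) := by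
  rw [Complex.norm_cpow_of_ne_zero hx, div_eq_mul_inv, ← Real.exp_neg]
  gcongr
  have h1 := Complex.abs_arg_le_pi x
  calc -(x.arg * s.im) ≤ |x.arg * s.im| := neg_le_abs _
    _ = |x.arg| * |s.im| := abs_mul _ _
    _ ≤ _ := by gcongr

/-- The two end exponents dominate all exponents between them, whether `x` is large or small. This
provides majorants that are uniform in the parameter. -/
theorem rpow_neg_le_add {x a a₁ a₂ : ℝ} (hx : 0 < x) (h₁ : a₁ ≤ a) (h₂ : a ≤ a₂) :
    x ^ (-a) ≤ x ^ (-a₁) + x ^ (-a₂) := by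
  rcases le_total 1 x with h | h
  · exact (Real.rpow_le_rpow_of_exponent_le h (neg_le_neg h₁)).trans
      (le_add_of_nonneg_right (Real.rpow_nonneg hx.le _))
  · exact (Real.rpow_le_rpow_of_exponent_ge hx h (neg_le_neg h₂)).trans
      (le_add_of_nonneg_left (Real.rpow_nonneg hx.le _))

theorem summable_nat_add_rpow_neg {a : ℝ} (ha : 0 < a) {τ : ℝ} (hτ : 1 < τ) :
    Summable fun n : ℕ => ((n : ℝ) + a) ^ (-τ) := by
  refine ((Real.summable_one_div_nat_add_rpow a τ).2 hτ).congr fun n => ?_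
  have : 0 < (n : ℝ) + a := by positivity
  rw [abs_of_pos this, Real.rpow_neg this.le, one_div]

/-! ### The Hurwitz zeta function -/

theorem natCast_add_re_pos {w : ℂ} (hw : 0 < w.re) (n : ℕ) : 0 < ((n : ℂ) + w).re := by
  simp only [Complex.add_re, Complex.natCast_re]
  positivity

theorem ne_zero_of_re_pos {x : ℂ} (hx : 0 < x.re) : x ≠ 0 := by
  rintro rfl
  simp at hx

theorem norm_hurwitz_term_le {s w : ℂ} {η a₁ a₂ B : ℝ} (hη : 0 < η) (hw : η ≤ w.re)
    (h₁ : a₁ ≤ s.re) (h₂ : s.re ≤ a₂) (h₀ : 0 ≤ a₁) (hB : |s.im| ≤ B) (n : ℕ) :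
    ‖((n : ℂ) + w) ^ (-s)‖ ≤
      (((n : ℝ) + η) ^ (-a₁) + ((n : ℝ) + η) ^ (-a₂)) * Real.exp (Real.pi * B) := by
  have hx := natCast_add_re_pos (hη.trans_le hw) n
  refine (norm_cpow_le_mul_exp (ne_zero_of_re_pos hx) _).trans ?_
  rw [Complex.neg_re, Complex.neg_im, abs_neg]
  have hpos : 0 < (n : ℝ) + η := by positivity
  have hle : (n : ℝ) + η ≤ ‖(n : ℂ) + w‖ := by
    refine le_trans ?_ (Complex.re_le_norm _)
    simp only [Complex.add_re, Complex.natCast_re]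
    linarith
  gcongr
  exact (Real.rpow_le_rpow_of_nonpos hpos hle (by linarith)).trans (rpow_neg_le_add hpos h₁ h₂)

theorem summable_hurwitz_bound {η a₁ a₂ : ℝ} (hη : 0 < η) (h₁ : 1 < a₁) (h₂ : 1 < a₂) (B : ℝ) :
    Summable fun n : ℕ =>
      (((n : ℝ) + η) ^ (-a₁) + ((n : ℝ) + η) ^ (-a₂)) * Real.exp (Real.pi * B) :=
  ((summable_nat_add_rpow_neg hη h₁).add (summable_nat_add_rpow_neg hη h₂)).mul_right _

theorem summable_hurwitz {s w : ℂ} (hs : 1 < s.re) (hw : 0 < w.re) :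
    Summable fun n : ℕ => ((n : ℂ) + w) ^ (-s) :=
  Summable.of_norm_bounded (summable_hurwitz_bound hw hs hs |s.im|)
    (norm_hurwitz_term_le hw le_rfl le_rfl le_rfl (by linarith) le_rfl)

/-- Approximations of `(s - 1) ζ(s, w)`, the `M`-th one valid for `Re s > 1 - M`. -/
def hurwitzApprox : ℕ → ℂ → ℂ → ℂ
  | 0, s, w => (s - 1) * ∑' n : ℕ, ((n : ℂ) + w) ^ (-s)
  | M + 1, s, w => w ^ (1 - s) +
      (s - 1) * ∫ t in (0 : ℝ)..1, (1 - t : ℂ) * hurwitzApprox M (s + 1) (w + t)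

/-- The set of parameters `(s, w)` with `Re s > 1 - M` and `Re w > 0`. -/
def hurwitzDomain (M : ℕ) : Set (ℂ × ℂ) := {p | 1 - (M : ℝ) < p.1.re ∧ 0 < p.2.re}

theorem isOpen_re_gt (a : ℝ) : IsOpen {s : ℂ | a < s.re} :=
  isOpen_lt continuous_const Complex.continuous_re

theorem isOpen_hurwitzDomain (M : ℕ) : IsOpen (hurwitzDomain M) :=
  ((isOpen_re_gt _).preimage continuous_fst).inter ((isOpen_re_gt _).preimage continuous_snd)

theorem hurwitzDomain_shift {M : ℕ} {s w : ℂ} (h : (s, w) ∈ hurwitzDomain (M + 1)) {t : ℝ}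
    (ht : 0 ≤ t) : (s + 1, w + t) ∈ hurwitzDomain M := by
  obtain ⟨h1, h2⟩ := h
  simp only [Nat.cast_add, Nat.cast_one] at h1 h2
  constructor
  · simp only [Complex.add_re, Complex.one_re]; linarith
  · simp only [Complex.add_re, Complex.ofReal_re]; linarith

/-- A single summable majorant near a point of absolute convergence: halve the distance of `Re s` to
`1` and of `Re w` to `0`, and bound `Im s`. -/
theorem exists_local_hurwitz_bound {s₀ w₀ : ℂ} (h : (s₀, w₀) ∈ hurwitzDomain 0) :
    ∃ V W : Set ℂ, IsOpen V ∧ IsOpen W ∧ s₀ ∈ V ∧ w₀ ∈ W ∧ V ×ˢ W ⊆ hurwitzDomain 0 ∧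
      ∃ u : ℕ → ℝ, Summable u ∧ ∀ n : ℕ, ∀ s ∈ V, ∀ w ∈ W, ‖((n : ℂ) + w) ^ (-s)‖ ≤ u n := by
  obtain ⟨h1, h2⟩ := h
  simp only [CharP.cast_eq_zero, sub_zero] at h1 h2
  set a₁ := (1 + s₀.re) / 2 with ha₁
  have hB := summable_hurwitz_bound (η := w₀.re / 2) (a₁ := a₁) (a₂ := s₀.re + 1) (by linarith)
    (by linarith) (by linarith) (|s₀.im| + 1)
  refine ⟨{s | a₁ < s.re} ∩ ({s | s.re < s₀.re + 1} ∩ {s | |s.im| < |s₀.im| + 1}),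
    {w | w₀.re / 2 < w.re}, ?_, isOpen_re_gt _, ?_, ?_, ?_, _, hB, ?_⟩
  · exact (isOpen_re_gt _).inter ((isOpen_lt (by fun_prop) continuous_const).inter
      (isOpen_lt (by fun_prop) continuous_const))
  · refine ⟨?_, ?_, ?_⟩
    · change a₁ < s₀.re; linarith
    · change s₀.re < s₀.re + 1; linarith
    · change |s₀.im| < |s₀.im| + 1; linarith
  · change w₀.re / 2 < w₀.re; linarith
  · rintro ⟨s, w⟩ ⟨⟨h3, -, -⟩, h4⟩
    simp only [mem_ofPred_eq] at h3 h4
    exact ⟨by simp only [CharP.cast_eq_zero, sub_zero]; linarith, by change 0 < w.re; linarith⟩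
  · rintro n s ⟨h3, h4, h5⟩ w h6
    simp only [mem_ofPred_eq] at h3 h4 h5 h6
    exact norm_hurwitz_term_le (by linarith) h6.le h3.le h4.le (by linarith) h5.le n

theorem continuousOn_hurwitzApprox (M : ℕ) :
    ContinuousOn (fun p : ℂ × ℂ => hurwitzApprox M p.1 p.2) (hurwitzDomain M) := by
  induction M with
  | zero =>
    rintro ⟨s₀, w₀⟩ h
    obtain ⟨V, W, hV, hW, hsV, hwW, hsub, u, hu, hle⟩ := exists_local_hurwitz_bound h
    refine ContinuousAt.continuousWithinAt ?_
    refine ContinuousOn.continuousAt ?_ ((hV.prod hW).mem_nhds ⟨hsV, hwW⟩)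
    simp only [hurwitzApprox]
    refine ContinuousOn.mul (by fun_prop) ?_
    refine continuousOn_tsum (fun n => ?_) hu fun n p hp => hle n p.1 hp.1 p.2 hp.2
    refine ContinuousOn.cpow (by fun_prop) (by fun_prop) fun p hp => ?_
    exact Or.inl (natCast_add_re_pos (hsub hp).2 n)
  | succ M ih =>
    simp only [hurwitzApprox]
    refine ContinuousOn.add ?_ (ContinuousOn.mul (by fun_prop) ?_)
    · exact ContinuousOn.cpow (by fun_prop) (by fun_prop) fun p hp => Or.inl hp.2
    · refine continuousOn_integral_param (isOpen_hurwitzDomain _)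
        (ContinuousOn.mul (by fun_prop) ?_)
      refine ih.comp (f := fun x : (ℂ × ℂ) × ℝ => (x.1.1 + 1, x.1.2 + (x.2 : ℂ)))
        (by fun_prop) fun x hx => hurwitzDomain_shift hx.1 hx.2.1

theorem differentiableOn_hurwitzApprox_fst (M : ℕ) {w : ℂ} (hw : 0 < w.re) :
    DifferentiableOn ℂ (fun s => hurwitzApprox M s w) {s | 1 - (M : ℝ) < s.re} := by
  induction M generalizing w with
  | zero =>
    intro s₀ h
    obtain ⟨V, W, hV, hW, hsV, hwW, hsub, u, hu, hle⟩ :=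
      exists_local_hurwitz_bound (s₀ := s₀) (w₀ := w) ⟨h, hw⟩
    refine DifferentiableAt.differentiableWithinAt ?_
    refine DifferentiableOn.differentiableAt ?_ (hV.mem_nhds hsV)
    simp only [hurwitzApprox]
    refine DifferentiableOn.mul (by fun_prop) ?_
    refine Complex.differentiableOn_tsum_of_summable_norm hu (fun n => ?_) hV
      fun n s hs => hle n s hs w hwW
    intro s hs
    exact (DifferentiableAt.const_cpow (by fun_prop)
      (Or.inl (ne_zero_of_re_pos (natCast_add_re_pos hw n)))).differentiableWithinAt
  | succ M ih =>
    simp only [hurwitzApprox]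
    refine DifferentiableOn.add ?_ (DifferentiableOn.mul (by fun_prop) ?_)
    · intro s hs
      exact (DifferentiableAt.const_cpow (by fun_prop)
        (Or.inl (ne_zero_of_re_pos hw))).differentiableWithinAt
    · refine differentiableOn_integral_param (isOpen_re_gt _) (ContinuousOn.mul (by fun_prop) ?_)
        fun t ht => DifferentiableOn.mul (by fun_prop) ?_
      · refine (continuousOn_hurwitzApprox M).comp
          (f := fun x : ℂ × ℝ => (x.1 + 1, w + (x.2 : ℂ))) (by fun_prop)
          fun x hx => hurwitzDomain_shift ⟨hx.1, hw⟩ hx.2.1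
      · have hw' : 0 < (w + (t : ℂ)).re := by
          simp only [Complex.add_re, Complex.ofReal_re]; linarith [ht.1]
        exact (ih hw').comp (f := fun s => s + 1) (by fun_prop)
          fun s hs => (hurwitzDomain_shift (s := s) (w := w) ⟨hs, hw⟩ le_rfl).1

theorem differentiableOn_hurwitzApprox_snd (M : ℕ) {s : ℂ} (hs : 1 - (M : ℝ) < s.re) :
    DifferentiableOn ℂ (fun w => hurwitzApprox M s w) {w | 0 < w.re} := by
  induction M generalizing s with
  | zero =>
    intro w₀ h
    obtain ⟨V, W, hV, hW, hsV, hwW, hsub, u, hu, hle⟩ :=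
      exists_local_hurwitz_bound (s₀ := s) (w₀ := w₀) ⟨hs, h⟩
    refine DifferentiableAt.differentiableWithinAt ?_
    refine DifferentiableOn.differentiableAt ?_ (hW.mem_nhds hwW)
    simp only [hurwitzApprox]
    refine DifferentiableOn.const_mul ?_ _
    refine Complex.differentiableOn_tsum_of_summable_norm hu (fun n => ?_) hW
      fun n w hw => hle n s hsV w hw
    intro w hw
    exact (DifferentiableAt.cpow_const (by fun_prop)
      (Or.inl (natCast_add_re_pos (hsub (a := (s, w)) ⟨hsV, hw⟩).2 n))).differentiableWithinAt
  | succ M ih =>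
    simp only [hurwitzApprox]
    refine DifferentiableOn.add ?_ (DifferentiableOn.const_mul ?_ _)
    · intro w hw
      exact (DifferentiableAt.cpow_const (by fun_prop)
        (Or.inl (show 0 < w.re from hw))).differentiableWithinAt
    · refine differentiableOn_integral_param (isOpen_re_gt _) (ContinuousOn.mul (by fun_prop) ?_)
        fun t ht => DifferentiableOn.const_mul ?_ _
      · refine (continuousOn_hurwitzApprox M).comp
          (f := fun x : ℂ × ℝ => (s + 1, x.1 + (x.2 : ℂ))) (by fun_prop)
          fun x hx => hurwitzDomain_shift ⟨hs, hx.1⟩ hx.2.1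
      · have hs' : 1 - (M : ℝ) < (s + 1).re := by
          simp only [Complex.add_re, Complex.one_re]; push_cast at hs; linarith
        refine (ih hs').comp (f := fun w => w + (t : ℂ)) (by fun_prop) fun w hw => ?_
        exact (hurwitzDomain_shift (s := s) (w := w) ⟨hs, hw⟩ ht.1).2

/-- One integration by parts, carried out with an explicit antiderivative. After summation over `x =
n + w` the bracket telescopes, which is the source of the recursion in `hurwitzApprox`. -/
theorem integral_hurwitz_term {s x : ℂ} (hs : 1 < s.re) (hx : 0 < x.re) :
    (s - 1) * ∫ t in (0 : ℝ)..1, (1 - t : ℂ) * (s * (x + t) ^ (-(s + 1))) =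
      (s - 1) * x ^ (-s) + ((x + 1) ^ (1 - s) - x ^ (1 - s)) := by
  have hs1 : (1 : ℂ) - s ≠ 0 := by
    intro h
    have := congrArg Complex.re h
    simp at this
    linarith
  have hslit : ∀ t ∈ uIcc (0 : ℝ) 1, x + (t : ℂ) ∈ Complex.slitPlane := by
    intro t ht
    rw [uIcc_of_le zero_le_one] at ht
    left
    simp only [Complex.add_re, Complex.ofReal_re]
    linarith [ht.1]
  have hder : ∀ t ∈ uIcc (0 : ℝ) 1, HasDerivAt
      (fun t : ℝ => -((1 - t : ℂ) * (x + t) ^ (-s)) - (x + t) ^ (1 - s) / (1 - s))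
      ((1 - t : ℂ) * (s * (x + t) ^ (-(s + 1)))) t := by
    intro t ht
    have h0 : HasDerivAt (fun z : ℂ => -((1 - z) * (x + z) ^ (-s)) - (x + z) ^ (1 - s) / (1 - s))
        ((1 - t : ℂ) * (s * (x + t) ^ (-(s + 1)))) (t : ℂ) := by
      have hl : HasDerivAt (fun z : ℂ => x + z) 1 (t : ℂ) := (hasDerivAt_id _).const_add x
      have h1 := hl.cpow_const (c := -s) (hslit t ht)
      have h2 := hl.cpow_const (c := 1 - s) (hslit t ht)
      have h3 : HasDerivAt (fun z : ℂ => 1 - z) (-1) (t : ℂ) := (hasDerivAt_id _).const_sub 1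
      refine (((h3.mul h1).neg).sub (h2.div_const (1 - s))).congr_deriv ?_
      have e1 : -s - 1 = -(s + 1) := by ring
      have e2 : (1 : ℂ) - s - 1 = -s := by ring
      rw [e1, e2]
      field_simp
      ring
    exact h0.comp_ofReal
  rw [intervalIntegral.integral_eq_sub_of_hasDerivAt hder]
  · simp only [Complex.ofReal_one, Complex.ofReal_zero, add_zero]
    have : (s - 1) = -(1 - s) := by ring
    rw [this]
    field_simp
    ring
  · refine ContinuousOn.intervalIntegrable ?_
    refine ContinuousOn.mul (by fun_prop) (ContinuousOn.mul (by fun_prop) ?_)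
    exact ContinuousOn.cpow_const (by fun_prop) hslit

theorem tendsto_hurwitz_term {s w : ℂ} (hs : 1 < s.re) (hw : 0 < w.re) :
    Tendsto (fun n : ℕ => ((n : ℂ) + w) ^ (1 - s)) atTop (𝓝 0) := by
  have h1 : Tendsto (fun n : ℕ => (n : ℝ) + w.re) atTop atTop :=
    tendsto_atTop_add_const_right _ _ tendsto_natCast_atTop_atTop
  have h2 := (tendsto_rpow_neg_atTop (y := s.re - 1) (by linarith)).comp h1
  have h3 := (h2.add h2).mul_const (Real.exp (Real.pi * |(s - 1).im|))
  simp only [add_zero, zero_mul] at h3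
  refine squeeze_zero_norm (fun n => ?_) h3
  have := norm_hurwitz_term_le (s := s - 1) (η := w.re) (a₁ := s.re - 1) (a₂ := s.re - 1) hw le_rfl
    (by simp) (by simp) (by linarith) le_rfl n
  rwa [neg_sub] at this

/-- For `Re s > 1`, summing `integral_hurwitz_term` over `x = n + w` gives `(s - 1) ζ(s, w)` plus a
telescoping sum equal to `-w^{1-s}`. The recursion adds `w^{1-s}` back. The right side involves `ζ`
only at `s + 1`, so each application gains one unit to the left. -/
theorem hurwitzApprox_one_eq_zero {s w : ℂ} (h : (s, w) ∈ hurwitzDomain 0) :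
    hurwitzApprox 1 s w = hurwitzApprox 0 s w := by
  obtain ⟨hs, hw⟩ := h
  simp only [CharP.cast_eq_zero, sub_zero] at hs hw
  have hs' : 1 < (s + 1).re := by simp; linarith
  have hsum := summable_hurwitz hs hw
  have hint : HasSum
      (fun n : ℕ => ∫ t in (0 : ℝ)..1, (1 - t : ℂ) * (s * ((n : ℂ) + w + t) ^ (-(s + 1))))
      (∫ t in (0 : ℝ)..1, (1 - t : ℂ) * hurwitzApprox 0 (s + 1) (w + t)) := by
    have hub := (summable_hurwitz_bound hw hs' hs' |(s + 1).im|).mul_left ‖s‖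
    refine intervalIntegral.hasSum_integral_of_dominated_convergence
      (bound := fun n _ => ‖s‖ * ((((n : ℝ) + w.re) ^ (-(s + 1).re) +
        ((n : ℝ) + w.re) ^ (-(s + 1).re)) * Real.exp (Real.pi * |(s + 1).im|))) ?_ ?_ ?_ ?_ ?_
    · intro n
      refine aestronglyMeasurable_of_continuousOn_Icc ?_
      refine ContinuousOn.mul (by fun_prop) (ContinuousOn.mul (by fun_prop) ?_)
      refine ContinuousOn.cpow_const (by fun_prop) fun t ht => Or.inl ?_
      simp only [Complex.add_re, Complex.natCast_re, Complex.ofReal_re]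
      have := ht.1
      positivity
    · refine fun n => Eventually.of_forall fun t ht => ?_
      have ht := uIoc_zero_one_subset ht
      rw [norm_mul, norm_mul]
      have h1 : ‖(1 - t : ℂ)‖ ≤ 1 := by
        rw [← Complex.ofReal_one, ← Complex.ofReal_sub, Complex.norm_real, Real.norm_eq_abs, abs_le]
        constructor <;> linarith [ht.1, ht.2]
      have h2 := norm_hurwitz_term_le (s := s + 1) (w := w + t) (η := w.re) hw
        (by simp only [Complex.add_re, Complex.ofReal_re]; linarith [ht.1]) le_rfl le_rfl
        (by linarith) le_rfl n
      rw [← add_assoc] at h2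
      calc _ ≤ 1 * (‖s‖ * _) := by gcongr
        _ = _ := one_mul _
    · exact Eventually.of_forall fun t _ => hub
    · exact intervalIntegrable_const
    · refine Eventually.of_forall fun t ht => ?_
      have ht := uIoc_zero_one_subset ht
      have hw' : 0 < (w + (t : ℂ)).re := by
        simp only [Complex.add_re, Complex.ofReal_re]; linarith [ht.1]
      refine HasSum.mul_left _ ?_
      simp only [hurwitzApprox, add_sub_cancel_right, add_assoc]
      exact ((summable_hurwitz hs' hw').hasSum).mul_left s
  have hint' := hint.mul_left (s - 1)
  simp only [integral_hurwitz_term hs (natCast_add_re_pos hw _)] at hint'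
  have htel := hint'.sub (hsum.hasSum.mul_left (s - 1))
  simp only [add_sub_cancel_left] at htel
  have hlim := htel.tendsto_sum_nat
  have hsub : ∀ n : ℕ, ∑ i ∈ Finset.range n,
      (((i : ℂ) + w + 1) ^ (1 - s) - ((i : ℂ) + w) ^ (1 - s)) =
        ((n : ℂ) + w) ^ (1 - s) - w ^ (1 - s) := by
    intro n
    have := Finset.sum_range_sub (fun i : ℕ => ((i : ℂ) + w) ^ (1 - s)) n
    simp only [Nat.cast_zero, zero_add] at this
    rw [← this]
    refine Finset.sum_congr rfl fun i _ => ?_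
    push_cast
    ring_nf
  simp only [hsub] at hlim
  have huniq := tendsto_nhds_unique hlim ((tendsto_hurwitz_term hs hw).sub_const _)
  have e1 : hurwitzApprox 1 s w = w ^ (1 - s) +
      (s - 1) * ∫ t in (0 : ℝ)..1, (1 - t : ℂ) * hurwitzApprox 0 (s + 1) (w + t) := rfl
  have e0 : hurwitzApprox 0 s w = (s - 1) * ∑' n : ℕ, ((n : ℂ) + w) ^ (-s) := rfl
  rw [e1, e0]
  linear_combination huniq

/-- The recursion preserves agreement: both sides integrate the previous approximations at `(s + 1,
w + t)`, a point in the smaller domain. -/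
theorem hurwitzApprox_succ {M : ℕ} {s w : ℂ} (h : (s, w) ∈ hurwitzDomain M) :
    hurwitzApprox (M + 1) s w = hurwitzApprox M s w := by
  induction M generalizing s w with
  | zero => exact hurwitzApprox_one_eq_zero h
  | succ M ih =>
    rw [hurwitzApprox, hurwitzApprox]
    congr 2
    refine intervalIntegral.integral_congr fun t ht => ?_
    rw [uIcc_of_le zero_le_one] at ht
    simp only [ih (hurwitzDomain_shift h ht.1)]

theorem hurwitzApprox_of_le {M M' : ℕ} (hM : M ≤ M') {s w : ℂ} (h : (s, w) ∈ hurwitzDomain M) :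
    hurwitzApprox M' s w = hurwitzApprox M s w := by
  induction M', hM using Nat.le_induction with
  | base => rfl
  | succ k hk ih =>
    rw [hurwitzApprox_succ ⟨lt_of_le_of_lt ?_ h.1, h.2⟩, ih]
    have : (M : ℝ) ≤ k := by exact_mod_cast hk
    linarith

/-- The entire continuation of `s ↦ (s - 1) ζ(s, w)`, for `Re w > 0`. -/
def hurwitzEntire (s w : ℂ) : ℂ := hurwitzApprox (⌈1 - s.re⌉₊ + 1) s w

theorem hurwitzEntire_eq {M : ℕ} {s w : ℂ} (h : (s, w) ∈ hurwitzDomain M) :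
    hurwitzEntire s w = hurwitzApprox M s w := by
  have h' : (s, w) ∈ hurwitzDomain (⌈1 - s.re⌉₊ + 1) := by
    refine ⟨?_, h.2⟩
    have := Nat.le_ceil (1 - s.re)
    push_cast
    change 1 - ((⌈1 - s.re⌉₊ : ℝ) + 1) < s.re
    linarith
  rcases le_total M (⌈1 - s.re⌉₊ + 1) with hM | hM
  · exact hurwitzApprox_of_le hM h
  · exact (hurwitzApprox_of_le hM h').symm

theorem exists_one_sub_natCast_lt (x : ℝ) : ∃ M : ℕ, 1 - (M : ℝ) < x := by
  obtain ⟨M, hM⟩ := exists_nat_gt (1 - x)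
  exact ⟨M, by linarith⟩

theorem continuousOn_hurwitzEntire :
    ContinuousOn (fun p : ℂ × ℂ => hurwitzEntire p.1 p.2) {p | 0 < p.2.re} := by
  rintro ⟨s, w⟩ hw
  obtain ⟨M, hM⟩ := exists_one_sub_natCast_lt s.re
  have hn : hurwitzDomain M ∈ 𝓝 (s, w) := (isOpen_hurwitzDomain M).mem_nhds ⟨hM, hw⟩
  refine ContinuousAt.continuousWithinAt ?_
  refine ((continuousOn_hurwitzApprox M).continuousAt hn).congr ?_
  filter_upwards [hn] with p hp using (hurwitzEntire_eq hp).symm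

theorem differentiable_hurwitzEntire {w : ℂ} (hw : 0 < w.re) :
    Differentiable ℂ fun s => hurwitzEntire s w := by
  intro s
  obtain ⟨M, hM⟩ := exists_one_sub_natCast_lt s.re
  have hn : {s : ℂ | 1 - (M : ℝ) < s.re} ∈ 𝓝 s := (isOpen_re_gt _).mem_nhds hM
  refine ((differentiableOn_hurwitzApprox_fst M hw).differentiableAt hn).congr_of_eventuallyEq ?_
  filter_upwards [hn] with z hz using hurwitzEntire_eq ⟨hz, hw⟩

theorem differentiableOn_hurwitzEntire_snd (s : ℂ) :
    DifferentiableOn ℂ (fun w => hurwitzEntire s w) {w | 0 < w.re} := by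
  obtain ⟨M, hM⟩ := exists_one_sub_natCast_lt s.re
  exact (differentiableOn_hurwitzApprox_snd M hM).congr fun w hw => hurwitzEntire_eq ⟨hM, hw⟩

theorem hasSum_hurwitz {s w : ℂ} (hs : 1 < s.re) (hw : 0 < w.re) :
    HasSum (fun n : ℕ => ((n : ℂ) + w) ^ (-s)) ((s - 1)⁻¹ * hurwitzEntire s w) := by
  have hs1 : s - 1 ≠ 0 := by
    intro h
    have := congrArg Complex.re h
    simp at this
    linarith
  have h : (s, w) ∈ hurwitzDomain 0 := ⟨by simpa using hs, hw⟩
  rw [hurwitzEntire_eq h, hurwitzApprox, inv_mul_cancel_left₀ hs1]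
  exact (summable_hurwitz hs hw).hasSum

/-- `hurwitz` is an arbitrarily chosen continuation. Since `ℂ ∖ {1}` is connected, the identity
theorem makes it agree with the one constructed here. -/
theorem hurwitz_eq {s w : ℂ} (hs : s ≠ 1) (hw : 0 < w.re) :
    hurwitz s w = (s - 1)⁻¹ * hurwitzEntire s w := by
  have hd : DifferentiableOn ℂ (fun t => (t - 1)⁻¹ * hurwitzEntire t w) {1}ᶜ := by
    refine DifferentiableOn.mul (DifferentiableOn.inv (by fun_prop) fun t ht => sub_ne_zero.2 ht)
      (differentiable_hurwitzEntire hw).differentiableOn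
  have hex : ∃ g : ℂ → ℂ, DifferentiableOn ℂ g {1}ᶜ ∧
      ∀ t : ℂ, 1 < t.re → HasSum (fun n : ℕ => ((n : ℂ) + w) ^ (-t)) (g t) :=
    ⟨_, hd, fun t ht => hasSum_hurwitz ht hw⟩
  rw [hurwitz, dif_pos hex]
  obtain ⟨h1, h2⟩ := hex.choose_spec
  have hopen : IsOpen ({1}ᶜ : Set ℂ) := isOpen_compl_singleton
  have hpre : IsPreconnected ({1}ᶜ : Set ℂ) :=
    (isConnected_compl_singleton_of_one_lt_rank (by simp) (1 : ℂ)).isPreconnected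
  refine (h1.analyticOnNhd hopen).eqOn_of_preconnected_of_eventuallyEq (hd.analyticOnNhd hopen)
    hpre (z₀ := 2) (by simp) ?_ hs
  filter_upwards [(isOpen_re_gt 1).mem_nhds (show (1 : ℝ) < (2 : ℂ).re by simp)] with t ht
  exact (h2 t ht).unique (hasSum_hurwitz ht hw)

end HeckeTransfer

namespace HeckeTransfer

open Filter Topology Metric

/-! ### Holomorphic families in the disk algebra and of operators -/

theorem analyticAt_diskAlgebra {c : ℂ} {r : ℝ} {Φ : ℂ → DiskAlgebra c r} {a : ℂ} {ρ M : ℝ}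
    (hρ : 0 < ρ) (hM : ∀ b ∈ ball a ρ, ‖Φ b‖ ≤ M)
    (hd : ∀ z ∈ closedBall c r, DifferentiableOn ℂ (fun b => val (Φ b) z) (ball a ρ)) :
    AnalyticAt ℂ Φ a :=
  analyticAt_of_weakly_differentiableOn (κ := closedBall c r) (fun z => evalCLM c r z)
    (fun f _ h0 h => norm_le_of_forall_val f h0 fun z hz => h ⟨z, hz⟩)
    (fun _ => norm_evalCLM_le _) hρ hM fun z => hd z z.2

/-- The functionals `T ↦ ‖f‖⁻¹ (T f)(z)` form a norming family for operators into the disk algebra.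
For `f = 0` the functional is zero and harmless. -/
theorem analyticAt_operator {E : Type*} [NormedAddCommGroup E] [NormedSpace ℂ E] {c : ℂ} {r : ℝ}
    {Φ : ℂ → E →L[ℂ] DiskAlgebra c r} {a : ℂ} {ρ M : ℝ} (hρ : 0 < ρ)
    (hM : ∀ b ∈ ball a ρ, ‖Φ b‖ ≤ M)
    (hd : ∀ f, ∀ z ∈ closedBall c r, DifferentiableOn ℂ (fun b => val (Φ b f) z) (ball a ρ)) :
    AnalyticAt ℂ Φ a := by
  refine analyticAt_of_weakly_differentiableOn (κ := E × closedBall c r)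
    (fun k => (‖k.1‖⁻¹ : ℂ) • (evalCLM c r k.2).comp (ContinuousLinearMap.apply ℂ _ k.1))
    (fun T M h0 h => T.opNorm_le_bound h0 fun f => ?_) (fun k => ?_) hρ hM fun k => ?_
  · refine norm_le_of_forall_val _ (by positivity) fun z hz => ?_
    rcases eq_or_ne f 0 with rfl | hf
    · rw [map_zero, ← evalCLM_apply, map_zero, norm_zero, norm_zero, mul_zero]
    · have := h (f, ⟨z, hz⟩)
      simp only [smul_apply, ContinuousLinearMap.comp_apply, ContinuousLinearMap.apply_apply,
        evalCLM_apply, norm_smul, norm_inv, Complex.norm_real, norm_norm] at this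
      rw [inv_mul_le_iff₀ (norm_pos_iff.2 hf)] at this
      linarith
  · refine ContinuousLinearMap.opNorm_le_bound _ zero_le_one fun T => ?_
    simp only [smul_apply, ContinuousLinearMap.comp_apply, ContinuousLinearMap.apply_apply,
      evalCLM_apply, norm_smul, norm_inv, Complex.norm_real, norm_norm, one_mul]
    have h1 : ‖val (T k.1) k.2‖ ≤ ‖T‖ * ‖k.1‖ := (norm_val_le _ _).trans (T.le_opNorm _)
    rcases eq_or_ne k.1 0 with h0 | h0
    · rw [h0]; simp
    · rw [inv_mul_le_iff₀ (norm_pos_iff.2 h0)]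
      linarith
  · exact DifferentiableOn.const_smul (hd k.1 k.2 k.2.2) (‖k.1‖⁻¹ : ℂ)

/-! ### Sums over inverse branches -/

/-- The square of a number with nonzero real part never lies on the closed negative axis. Hence the
principal power in `piST` is holomorphic. -/
theorem zpow_neg_two_mem_slitPlane {x : ℂ} (hx : x.re ≠ 0) :
    x ^ (-2 : ℤ) ∈ Complex.slitPlane := by
  have hx0 : x ≠ 0 := by
    rintro rfl
    simp at hx
  have hy : (x⁻¹).re ≠ 0 := by
    rw [Complex.inv_re]
    exact div_ne_zero hx (Complex.normSq_pos.2 hx0).ne'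
  have e : x ^ (-2 : ℤ) = x⁻¹ * x⁻¹ := by
    rw [zpow_neg, zpow_ofNat, pow_two, mul_inv]
  rw [e, Complex.mem_slitPlane_iff, Complex.mul_re, Complex.mul_im]
  by_cases h : (x⁻¹).im = 0
  · left
    rw [h]
    have := mul_self_pos.2 hy
    linarith
  · right
    have := mul_ne_zero hy h
    intro h'
    apply this
    linarith

/-- The transformations `S T^n`, `n ∈ A`, map the closed disk with centre `c` and radius `r` into
the open disk with centre `c'` and radius `r'`, and `z + n λ` is never imaginary. -/
structure BranchFamily (q : ℕ) (A : Set ℤ) (c : ℂ) (r : ℝ) (c' : ℂ) (r' : ℝ) : Prop where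
  re_ne_zero : ∀ n ∈ A, ∀ z ∈ closedBall c r, (z + n * lam q).re ≠ 0
  maps : ∀ n ∈ A, ∀ z ∈ closedBall c r, -1 / (z + n * lam q) ∈ ball c' r'

/-- The sum over `n ∈ A` of `|z + n λ|^{-τ}` converges uniformly on the closed disk. -/
def SummableExponent (q : ℕ) (A : Set ℤ) (c : ℂ) (r : ℝ) (τ : ℝ) : Prop :=
  ∃ u : A → ℝ, Summable u ∧ ∀ n : A, ∀ z ∈ closedBall c r, ‖z + (n : ℤ) * lam q‖ ^ (-τ) ≤ u n

section BranchSum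

variable {q : ℕ} {A : Set ℤ} {c : ℂ} {r : ℝ} {c' : ℂ} {r' : ℝ}

theorem BranchFamily.ne_zero (h : BranchFamily q A c r c' r') {n : ℤ} (hn : n ∈ A) {z : ℂ}
    (hz : z ∈ closedBall c r) : z + n * lam q ≠ 0 := by
  intro h0
  have := h.re_ne_zero n hn z hz
  rw [h0] at this
  simp at this

theorem continuousOn_piST (h : BranchFamily q A c r c' r') {n : ℤ} (hn : n ∈ A) (β : ℂ)
    {g : ℂ → ℂ} (hg : ContinuousOn g (closedBall c' r')) :
    ContinuousOn (piST q β n g) (closedBall c r) := by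
  have hx : ContinuousOn (fun z : ℂ => z + n * lam q) (closedBall c r) := by fun_prop
  refine ContinuousOn.mul (ContinuousOn.cpow_const (hx.zpow₀ _ fun z hz => Or.inl
    (h.ne_zero hn hz)) fun z hz => zpow_neg_two_mem_slitPlane (h.re_ne_zero n hn z hz)) ?_
  exact hg.comp (continuousOn_const.div hx fun z hz => h.ne_zero hn hz)
    fun z hz => ball_subset_closedBall (h.maps n hn z hz)

theorem differentiableOn_piST (h : BranchFamily q A c r c' r') {n : ℤ} (hn : n ∈ A) (β : ℂ)
    {g : ℂ → ℂ} (hg : DifferentiableOn ℂ g (ball c' r')) :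
    DifferentiableOn ℂ (piST q β n g) (ball c r) := by
  have hx : DifferentiableOn ℂ (fun z : ℂ => z + n * lam q) (ball c r) := by fun_prop
  have hb : ball c r ⊆ closedBall c r := ball_subset_closedBall
  refine DifferentiableOn.mul ?_ ?_
  · have h1 : DifferentiableOn ℂ (fun z : ℂ => (z + n * lam q) ^ (-2 : ℤ)) (ball c r) := by
      intro z hz
      exact (hx z hz).zpow (Or.inl (h.ne_zero hn (hb hz)))
    exact fun z hz => (h1 z hz).cpow_const
      (zpow_neg_two_mem_slitPlane (h.re_ne_zero n hn z (hb hz)))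
  · refine hg.comp (f := fun z : ℂ => -1 / (z + n * lam q)) ?_ fun z hz => h.maps n hn z (hb hz)
    exact (differentiableOn_const _).div hx fun z hz => h.ne_zero hn (hb hz)

theorem differentiable_piST {n : ℤ} {z : ℂ} (hz : z + n * lam q ≠ 0) (g : ℂ → ℂ) :
    Differentiable ℂ fun β => piST q β n g z := by
  refine Differentiable.mul_const (fun β => ?_) _
  exact DifferentiableAt.const_cpow differentiableAt_id (Or.inl (zpow_ne_zero _ hz))

/-- The weight `w^N`, evaluated at `-1/(z + nλ)`, contributes `|z + nλ|^{-N}`: this is the gain of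
convergence for functions vanishing to order `N` at `0`. -/
theorem norm_piST_le {n : ℤ} {z : ℂ} (hz : z + n * lam q ≠ 0) (β : ℂ) (N : ℕ) (g : ℂ → ℂ) {M : ℝ}
    (hM : ‖g (-1 / (z + n * lam q))‖ ≤ M) :
    ‖piST q β n (fun w => w ^ N * g w) z‖ ≤
      ‖z + n * lam q‖ ^ (-(2 * β.re + N)) * Real.exp (Real.pi * |β.im|) * M := by
  set x := z + n * lam q
  have hx : 0 < ‖x‖ := norm_pos_iff.2 hz
  simp only [piST]
  rw [norm_mul, norm_mul, norm_pow, norm_div, norm_neg, norm_one]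
  have h1 := norm_cpow_le_mul_exp (zpow_ne_zero (-2) hz) β
  have h2 : ‖x ^ (-2 : ℤ)‖ ^ β.re * (1 / ‖x‖) ^ N = ‖x‖ ^ (-(2 * β.re + N)) := by
    rw [norm_zpow, ← Real.rpow_intCast, ← Real.rpow_mul hx.le, one_div, inv_pow,
      ← Real.rpow_natCast, ← Real.rpow_neg hx.le, ← Real.rpow_add hx]
    congr 1
    push_cast
    ring
  have hM0 : 0 ≤ M := (norm_nonneg _).trans hM
  calc ‖(x ^ (-2 : ℤ)) ^ β‖ * ((1 / ‖x‖) ^ N * ‖g (-1 / x)‖)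
      ≤ (‖x ^ (-2 : ℤ)‖ ^ β.re * Real.exp (Real.pi * |β.im|)) * ((1 / ‖x‖) ^ N * M) := by
        gcongr
    _ = (‖x ^ (-2 : ℤ)‖ ^ β.re * (1 / ‖x‖) ^ N) * Real.exp (Real.pi * |β.im|) * M := by ring
    _ = _ := by rw [h2]

/-- `T` is the operator `f ↦ ∑_{n ∈ A} π_β(S T^n) (w^N f)`. -/
def IsBranchSum (q : ℕ) (A : Set ℤ) (β : ℂ) (N : ℕ)
    (T : DiskAlgebra c' r' →L[ℂ] DiskAlgebra c r) : Prop :=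
  ∀ f, ∀ z ∈ closedBall c r,
    HasSum (fun n : A => piST q β n (fun w => w ^ N * val f w) z) (val (T f) z)

theorem exists_isBranchSum (h : BranchFamily q A c r c' r') (β : ℂ) (N : ℕ) {u : A → ℝ}
    (hu : Summable u) (hle : ∀ n : A, ∀ z ∈ closedBall c r,
      ‖z + (n : ℤ) * lam q‖ ^ (-(2 * β.re + N)) ≤ u n) (hr : 0 ≤ r) :
    ∃ T : DiskAlgebra c' r' →L[ℂ] DiskAlgebra c r, IsBranchSum q A β N T ∧
      ‖T‖ ≤ (∑' n, u n) * Real.exp (Real.pi * |β.im|) := by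
  set e := Real.exp (Real.pi * |β.im|)
  have he : 0 ≤ e := (Real.exp_pos _).le
  have hu0 : ∀ n, 0 ≤ u n := fun n =>
    (Real.rpow_nonneg (norm_nonneg _) _).trans (hle n c (mem_closedBall_self hr))
  have hsum0 : 0 ≤ ∑' n, u n := tsum_nonneg hu0
  have hb : ∀ (f : DiskAlgebra c' r') (n : A), ∀ z ∈ closedBall c r,
      ‖piST q β n (fun w => w ^ N * val f w) z‖ ≤ u n * e * ‖f‖ := fun f n z hz => by
    refine (norm_piST_le (h.ne_zero n.2 hz) β N (val f) (norm_val_le f _)).trans ?_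
    gcongr
    exact hle n z hz
  have hs : ∀ f : DiskAlgebra c' r', Summable fun n => u n * e * ‖f‖ := fun f =>
    (hu.mul_right e).mul_right _
  have hc : ∀ f : DiskAlgebra c' r', ContinuousOn
      (fun z => ∑' n : A, piST q β n (fun w => w ^ N * val f w) z) (closedBall c r) := fun f =>
    continuousOn_tsum (fun n => continuousOn_piST h n.2 β
      (ContinuousOn.mul (by fun_prop) (continuousOn_val f))) (hs f) (hb f)
  have hd : ∀ f : DiskAlgebra c' r', DifferentiableOn ℂ
      (fun z => ∑' n : A, piST q β n (fun w => w ^ N * val f w) z) (ball c r) := fun f =>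
    Complex.differentiableOn_tsum_of_summable_norm (hs f) (fun n => differentiableOn_piST h n.2 β
      (DifferentiableOn.mul (by fun_prop) (differentiableOn_val f))) isOpen_ball
      fun n z hz => hb f n z (ball_subset_closedBall hz)
  set T : DiskAlgebra c' r' → DiskAlgebra c r := fun f => ofFun _ (hc f) (hd f)
  have hT : ∀ f, ∀ z ∈ closedBall c r,
      HasSum (fun n : A => piST q β n (fun w => w ^ N * val f w) z) (val (T f) z) :=
    fun f z hz => by
      rw [val_ofFun _ _ hz]
      exact (Summable.of_norm_bounded (hs f) fun n => hb f n z hz).hasSum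
  have hbound : ∀ f, ‖T f‖ ≤ (∑' n, u n) * e * ‖f‖ := fun f => by
    refine norm_le_of_forall_val _ (by positivity) fun z hz => ?_
    rw [← tsum_mul_right, ← tsum_mul_right]
    exact (hT f z hz).norm_le_of_bounded (hs f).hasSum fun n => hb f n z hz
  refine ⟨LinearMap.mkContinuous
    { toFun := T
      map_add' := fun f g => ext_val fun z hz => ?_
      map_smul' := fun a f => ext_val fun z hz => ?_ } _ hbound, hT,
    LinearMap.mkContinuous_norm_le _ (by positivity) _⟩
  · rw [val_add]
    refine (hT (f + g) z hz).unique (((hT f z hz).add (hT g z hz)).congr_fun fun n => ?_)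
    simp only [piST, val_add]
    ring
  · rw [val_smul]
    refine (hT (a • f) z hz).unique (((hT f z hz).mul_left a).congr_fun fun n => ?_)
    simp only [piST, val_smul]
    ring

open scoped Classical in
/-- The operator `f ↦ ∑_{n ∈ A} π_β(S T^n) (w^N f)`. -/
def branchSum (q : ℕ) (A : Set ℤ) (c : ℂ) (r : ℝ) (c' : ℂ) (r' : ℝ) (N : ℕ) (β : ℂ) :
    DiskAlgebra c' r' →L[ℂ] DiskAlgebra c r :=
  if h : ∃ T : DiskAlgebra c' r' →L[ℂ] DiskAlgebra c r, IsBranchSum q A β N T then h.choose else 0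

theorem IsBranchSum.eq_branchSum {β : ℂ} {N : ℕ} {T : DiskAlgebra c' r' →L[ℂ] DiskAlgebra c r}
    (hT : IsBranchSum q A β N T) : T = branchSum q A c r c' r' N β := by
  have hex : ∃ T : DiskAlgebra c' r' →L[ℂ] DiskAlgebra c r, IsBranchSum q A β N T := ⟨T, hT⟩
  rw [branchSum, dif_pos hex]
  ext f
  exact ext_val fun z hz => (hT f z hz).unique (hex.choose_spec f z hz)

theorem isBranchSum_branchSum (h : BranchFamily q A c r c' r') (hr : 0 ≤ r) {β : ℂ} {N : ℕ}
    (hτ : SummableExponent q A c r (2 * β.re + N)) :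
    IsBranchSum q A β N (branchSum q A c r c' r' N β) := by
  obtain ⟨u, hu, hle⟩ := hτ
  obtain ⟨T, hT, -⟩ := exists_isBranchSum h β N hu hle hr
  rw [← hT.eq_branchSum]
  exact hT

/-- Weierstrass: each term is entire in `β`, and near a given `β` the terms share a summable
majorant, uniformly on the closed disk. -/
theorem analyticAt_branchSum (h : BranchFamily q A c r c' r') (hr : 0 ≤ r) {I : Set ℝ}
    (hI : IsOpen I) (hτ : ∀ τ ∈ I, SummableExponent q A c r τ) {N : ℕ} {β : ℂ}
    (hβ : 2 * β.re + N ∈ I) : AnalyticAt ℂ (branchSum q A c r c' r' N) β := by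
  -- For `|b - β| < ε/4` the exponent `2 Re b + N` moves by less than `ε/2`, so the majorants at the
  -- two ends of this window control all such `b`.
  obtain ⟨ε, hε, hεI⟩ := Metric.isOpen_iff.1 hI _ hβ
  obtain ⟨u₁, hu₁, hle₁⟩ := hτ (2 * β.re + N - ε / 2) (hεI (by
    rw [mem_ball, Real.dist_eq, abs_lt]; constructor <;> linarith))
  obtain ⟨u₂, hu₂, hle₂⟩ := hτ (2 * β.re + N + ε / 2) (hεI (by
    rw [mem_ball, Real.dist_eq, abs_lt]; constructor <;> linarith))
  have hu := hu₁.add hu₂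
  have hloc : ∀ b ∈ ball β (ε / 4), |b.re - β.re| < ε / 4 ∧ |b.im - β.im| < ε / 4 := by
    intro b hb
    rw [mem_ball_iff_norm] at hb
    exact ⟨(Complex.abs_re_le_norm (b - β)).trans_lt hb,
      (Complex.abs_im_le_norm (b - β)).trans_lt hb⟩
  have hle : ∀ b ∈ ball β (ε / 4), ∀ n : A, ∀ z ∈ closedBall c r,
      ‖z + (n : ℤ) * lam q‖ ^ (-(2 * b.re + N)) ≤ u₁ n + u₂ n := fun b hb n z hz => by
    have h1 := (abs_lt.1 (hloc b hb).1)
    exact (rpow_neg_le_add (norm_pos_iff.2 (h.ne_zero n.2 hz)) (a₁ := 2 * β.re + N - ε / 2)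
      (a₂ := 2 * β.re + N + ε / 2) (by linarith) (by linarith)).trans
      (add_le_add (hle₁ n z hz) (hle₂ n z hz))
  have hu0 : 0 ≤ ∑' n, (u₁ n + u₂ n) := tsum_nonneg fun n =>
    (Real.rpow_nonneg (norm_nonneg _) _).trans
      (hle β (mem_ball_self (by linarith)) n c (mem_closedBall_self hr))
  have hexp : ∀ b ∈ ball β (ε / 4), Real.exp (Real.pi * |b.im|) ≤
      Real.exp (Real.pi * (|β.im| + ε / 4)) := fun b hb => by
    have h2 := (hloc b hb).2
    have h3 : |b.im| ≤ |β.im| + ε / 4 := by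
      have := abs_sub_abs_le_abs_sub b.im β.im
      linarith
    have := Real.pi_pos
    gcongr
  have hbs : ∀ b ∈ ball β (ε / 4), IsBranchSum q A b N (branchSum q A c r c' r' N b) :=
    fun b hb => isBranchSum_branchSum h hr ⟨_, hu, hle b hb⟩
  refine analyticAt_operator (ρ := ε / 4)
    (M := (∑' n, (u₁ n + u₂ n)) * Real.exp (Real.pi * (|β.im| + ε / 4))) (by linarith)
    (fun b hb => ?_) fun f z hz => ?_
  · obtain ⟨T, hT, hTn⟩ := exists_isBranchSum h b N hu (hle b hb) hr
    rw [← hT.eq_branchSum]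
    exact hTn.trans (mul_le_mul_of_nonneg_left (hexp b hb) hu0)
  · refine DifferentiableOn.congr ?_ fun b hb => ((hbs b hb) f z hz).tsum_eq.symm
    refine Complex.differentiableOn_tsum_of_summable_norm
      ((hu.mul_right (Real.exp (Real.pi * (|β.im| + ε / 4)))).mul_right ‖f‖)
      (fun n => (differentiable_piST (h.ne_zero n.2 hz) _).differentiableOn) isOpen_ball
      fun n b hb => ?_
    refine (norm_piST_le (h.ne_zero n.2 hz) b N (val f) (norm_val_le f _)).trans ?_
    have := hle b hb n z hz
    have h0 : 0 ≤ u₁ n + u₂ n := (Real.rpow_nonneg (norm_nonneg _) _).trans this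
    have := hexp b hb
    gcongr

theorem summableExponent_of_finite (h : BranchFamily q A c r c' r') (hA : A.Finite) (τ : ℝ) :
    SummableExponent q A c r τ := by
  have : ∀ n : A, ∃ M, ∀ z ∈ closedBall c r, ‖z + (n : ℤ) * lam q‖ ^ (-τ) ≤ M := fun n => by
    have hcont : ContinuousOn (fun z : ℂ => ‖z + (n : ℤ) * lam q‖ ^ (-τ)) (closedBall c r) :=
      ContinuousOn.rpow_const (by fun_prop) fun z hz =>
        Or.inl (norm_ne_zero_iff.2 (h.ne_zero n.2 hz))
    obtain ⟨M, hM⟩ := (isCompact_closedBall c r).exists_bound_of_continuousOn hcont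
    exact ⟨M, fun z hz => (Real.le_norm_self _).trans (hM z hz)⟩
  choose u hu using this
  have := hA.to_subtype
  exact ⟨u, Summable.of_finite, hu⟩

/-- The image disk of a family of branches can be shrunk. -/
theorem BranchFamily.exists_shrink (h : BranchFamily q A c r c' r') (hq : 0 < lam q)
    (h0 : (0 : ℂ) ∈ ball c' r') : ∃ ρ, 0 < ρ ∧ ρ < r' ∧ BranchFamily q A c r c' ρ := by
  have hr' : 0 < r' := pos_of_mem_ball h0
  have hc' : ‖c'‖ < r' := by simpa [dist_eq_norm] using h0
  -- The disk of radius `δ` about `0` lies in the disk of radius `‖c'‖ + δ < r'` about `c'`.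
  set δ := (r' - ‖c'‖) / 2 with hδ
  have hδ0 : 0 < δ := by linarith
  -- Branches with `|n| > B` satisfy `|z + nλ| > δ⁻¹` and hence map the disk into the `δ`-disk about
  -- `0`. The finitely many others have compact image in the open disk.
  obtain ⟨B, hB⟩ := exists_nat_gt ((‖c‖ + r + δ⁻¹) / lam q)
  rw [div_lt_iff₀ hq] at hB
  set A' : Set ℤ := A ∩ Icc (-(B : ℤ)) B
  have hfin : A'.Finite := (finite_Icc _ _).subset inter_subset_right
  set s : Set ℂ := ⋃ n ∈ A', (fun z : ℂ => -1 / (z + n * lam q)) '' closedBall c r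
  have hs : IsCompact s := hfin.isCompact_biUnion fun n hn =>
    (isCompact_closedBall c r).image_of_continuousOn
      (ContinuousOn.div continuousOn_const (by fun_prop) fun z hz => h.ne_zero hn.1 hz)
  have hsub : s ⊆ ball c' r' := by
    refine iUnion₂_subset fun n hn => ?_
    rintro _ ⟨z, hz, rfl⟩
    exact h.maps n hn.1 z hz
  obtain ⟨ρ, hρ, hsρ⟩ := exists_lt_subset_ball hs.isClosed hsub
  refine ⟨max ρ (‖c'‖ + δ), ?_, ?_, ⟨h.re_ne_zero, fun n hn z hz => ?_⟩⟩
  · exact lt_max_of_lt_right (by positivity)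
  · exact max_lt hρ (by linarith)
  · by_cases hnB : n ∈ Icc (-(B : ℤ)) B
    · exact ball_subset_ball (le_max_left _ _)
        (hsρ (mem_iUnion₂.2 ⟨n, ⟨hn, hnB⟩, z, hz, rfl⟩))
    · have habs : (B : ℝ) ≤ |(n : ℝ)| := by
        rw [mem_Icc, ← abs_le, not_le] at hnB
        have : ((B : ℤ) : ℝ) < ((|n| : ℤ) : ℝ) := by exact_mod_cast hnB
        push_cast at this
        exact this.le
      have hz' : ‖z‖ ≤ ‖c‖ + r := by
        have := mem_closedBall_iff_norm.1 hz
        have := norm_sub_norm_le z c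
        linarith
      have hx : δ⁻¹ < ‖z + n * lam q‖ := by
        have h1 : ‖(n * lam q : ℂ)‖ = |(n : ℝ)| * lam q := by
          rw [norm_mul, Complex.norm_intCast, Complex.norm_real, Real.norm_of_nonneg hq.le]
        have h2 := norm_sub_norm_le (n * lam q : ℂ) (-z)
        rw [sub_neg_eq_add, norm_neg, h1, add_comm (n * lam q : ℂ) z] at h2
        have h3 : (B : ℝ) * lam q ≤ |(n : ℝ)| * lam q := by gcongr
        linarith
      rw [mem_ball_iff_norm]
      refine lt_of_lt_of_le ?_ (le_max_right _ _)
      refine (norm_sub_le _ _).trans_lt ?_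
      rw [norm_div, norm_neg, norm_one, one_div, add_comm]
      gcongr
      exact inv_lt_of_inv_lt₀ hδ0 hx

end BranchSum

end HeckeTransfer

namespace HeckeTransfer

open Filter Topology Metric

/-! ### Splitting off the Taylor polynomial -/

section Splitting

variable {q : ℕ} {A : Set ℤ} {c : ℂ} {r : ℝ} {c' : ℂ} {r' : ℝ}

theorem coeff_eq_taylorCLM (h0 : (0 : ℂ) ∈ ball c' r') (f : DiskAlgebra c' r') (k : ℕ) :
    coeff f k = taylorCLM 0 h0 k f := (taylorCLM_apply h0 k f).symm

theorem remainder_eq (h0 : (0 : ℂ) ∈ ball c' r') (N : ℕ) (f : DiskAlgebra c' r') {w : ℂ}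
    (hw : w ∈ closedBall c' r') :
    remainder N f w = w ^ (N + 1) * val ((divDiff 0 h0 ^ (N + 1)) f) w := by
  have := val_eq_taylor_add h0 (N + 1) f hw
  simp only [sub_zero] at this
  rw [remainder, this]
  simp only [coeff_eq_taylorCLM h0, add_sub_cancel_left]

theorem remainder_eq_add (N : ℕ) (f : DiskAlgebra c' r') (w : ℂ) :
    remainder N f w = coeff f (N + 1) * w ^ (N + 1) + remainder (N + 1) f w := by
  rw [remainder, remainder, Finset.sum_range_succ _ (N + 1)]
  ring

theorem piST_add (β : ℂ) (n : ℤ) (a : ℂ) (g₁ g₂ : ℂ → ℂ) (z : ℂ) :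
    piST q β n (fun w => a * g₁ w + g₂ w) z = a * piST q β n g₁ z + piST q β n g₂ z := by
  simp only [piST]
  ring

/-- The operator `f ↦ ∑_{k ≤ N} a_k E_k`, where `a_k` are the Taylor coefficients at `0`. -/
def principalOp (h0 : (0 : ℂ) ∈ ball c' r') (E : ℕ → ℂ → DiskAlgebra c r) (N : ℕ) (β : ℂ) :
    DiskAlgebra c' r' →L[ℂ] DiskAlgebra c r :=
  ∑ k ∈ Finset.range (N + 1), (taylorCLM 0 h0 k).smulRight (E k β)

theorem val_principalOp (h0 : (0 : ℂ) ∈ ball c' r') (E : ℕ → ℂ → DiskAlgebra c r) (N : ℕ) (β : ℂ)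
    (f : DiskAlgebra c' r') (z : ℂ) :
    val (principalOp h0 E N β f) z =
      ∑ k ∈ Finset.range (N + 1), coeff f k * val (E k β) z := by
  rw [principalOp, sum_apply, val_sum]
  simp only [ContinuousLinearMap.smulRight_apply, val_smul, coeff_eq_taylorCLM h0]

theorem finiteRank_principalOp (h0 : (0 : ℂ) ∈ ball c' r') (E : ℕ → ℂ → DiskAlgebra c r) (N : ℕ)
    (β : ℂ) : FiniteRank (principalOp h0 E N β) :=
  FiniteRank.sum _ fun _ _ => finiteRank_smulRight _ _

theorem analyticAt_principalOp (h0 : (0 : ℂ) ∈ ball c' r') {E : ℕ → ℂ → DiskAlgebra c r} {N : ℕ}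
    {b : ℂ} (hE : ∀ k ≤ N, AnalyticAt ℂ (E k) b) : AnalyticAt ℂ (principalOp h0 E N) b := by
  refine Finset.analyticAt_fun_sum _ fun k hk => ?_
  exact ((ContinuousLinearMap.smulRightL ℂ (DiskAlgebra c' r') (DiskAlgebra c r)
    (taylorCLM 0 h0 k)).analyticAt _).comp (hE k (by simp at hk; omega))

theorem simplePoleAt_principalOp (h0 : (0 : ℂ) ∈ ball c' r') {E : ℕ → ℂ → DiskAlgebra c r} {N : ℕ}
    {b : ℂ} (hE : ∀ k ≤ N, SimplePoleAt (E k) b) : SimplePoleAt (principalOp h0 E N) b := by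
  refine SimplePoleAt.sum _ fun k hk => ?_
  exact (hE k (by simp at hk; omega)).clm (ContinuousLinearMap.smulRightL ℂ (DiskAlgebra c' r')
    (DiskAlgebra c r) (taylorCLM 0 h0 k))

/-- The operator `f ↦ ∑_{n ∈ A} π_β(S T^n) R_N`, where `R_N` is the Taylor remainder of `f`. -/
def remainderOp (q : ℕ) (A : Set ℤ) (c : ℂ) (r : ℝ) (h0 : (0 : ℂ) ∈ ball c' r') {ρ : ℝ}
    (hρ : ρ ≤ r') (N : ℕ) (β : ℂ) : DiskAlgebra c' r' →L[ℂ] DiskAlgebra c r :=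
  (branchSum q A c r c' ρ (N + 1) β).comp ((restrictCLM c' hρ).comp (divDiff 0 h0 ^ (N + 1)))

theorem hasSum_remainderOp {ρ : ℝ} (h : BranchFamily q A c r c' ρ) (hr : 0 ≤ r)
    (h0 : (0 : ℂ) ∈ ball c' r') (hρ : ρ ≤ r') {N : ℕ} {β : ℂ}
    (hτ : SummableExponent q A c r (2 * β.re + (N + 1 : ℕ))) (f : DiskAlgebra c' r') {z : ℂ}
    (hz : z ∈ closedBall c r) :
    HasSum (fun n : A => piST q β n (remainder N f) z)
      (val (remainderOp q A c r h0 hρ N β f) z) := by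
  refine (isBranchSum_branchSum h hr hτ _ z hz).congr_fun fun n => ?_
  have hw := ball_subset_closedBall (h.maps n n.2 z hz)
  simp only [piST]
  rw [remainder_eq h0 N f (closedBall_subset_closedBall hρ hw)]
  congr 2
  exact (val_restrictCLM hρ _ hw).symm

/-- The operator factors through restriction to the disk of radius `ρ < r'`, and nuclear operators
form an ideal. -/
theorem nuclear_remainderOp (h0 : (0 : ℂ) ∈ ball c' r') {ρ : ℝ} (hρ0 : 0 < ρ) (hρ : ρ < r') (N : ℕ)
    (β : ℂ) : NuclearOfOrderZero (remainderOp q A c r h0 hρ.le N β) :=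
  ((nuclearOfOrderZero_restrictCLM hρ0 hρ).comp_clm _).clm_comp _

theorem analyticAt_remainderOp {ρ : ℝ} (h : BranchFamily q A c r c' ρ) (hr : 0 ≤ r)
    (h0 : (0 : ℂ) ∈ ball c' r') (hρ : ρ ≤ r') {I : Set ℝ} (hI : IsOpen I)
    (hτ : ∀ τ ∈ I, SummableExponent q A c r τ) {N : ℕ} {β : ℂ}
    (hβ : 2 * β.re + (N + 1 : ℕ) ∈ I) : AnalyticAt ℂ (remainderOp q A c r h0 hρ N) β :=
  (((ContinuousLinearMap.compL ℂ (DiskAlgebra c' r') (DiskAlgebra c' ρ) (DiskAlgebra c r)).flip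
    ((restrictCLM c' hρ).comp (divDiff 0 h0 ^ (N + 1)))).analyticAt _).comp
    (analyticAt_branchSum h hr hI hτ hβ)

/-- The continuation of a sum over inverse branches and its splittings, given the continuations
`E k` of the sums of the monomials. -/
theorem exists_splitting (h : BranchFamily q A c r c' r') (hq : 0 < lam q) (hr : 0 ≤ r)
    (h0 : (0 : ℂ) ∈ ball c' r') {I : Set ℝ} (hI : IsOpen I) (hup : IsUpperSet I)
    (hne : I.Nonempty) (hτ : ∀ τ ∈ I, SummableExponent q A c r τ) {E : ℕ → ℂ → DiskAlgebra c r}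
    (hE : ∀ (k : ℕ) (β : ℂ), 2 * β.re + k ∈ I → ∀ z ∈ closedBall c r,
      HasSum (fun n : A => piST q β n (fun w => w ^ k) z) (val (E k β) z))
    {P : ℕ → Set ℂ} (hEa : ∀ k, ∀ b ∉ P k, AnalyticAt ℂ (E k) b)
    (hEs : ∀ k b, SimplePoleAt (E k) b) :
    ∃ (L : ℂ → DiskAlgebra c' r' →L[ℂ] DiskAlgebra c r)
      (R : ℕ → ℂ → DiskAlgebra c' r' →L[ℂ] DiskAlgebra c r),
      (∀ β : ℂ, 2 * β.re ∈ I → ∀ f, ∀ z ∈ closedBall c r,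
        HasSum (fun n : A => piST q β n (val f) z) (val (L β f) z)) ∧
      (∀ b, (∀ k, b ∉ P k) → AnalyticAt ℂ L b) ∧ (∀ b, SimplePoleAt L b) ∧
      ∀ (N : ℕ) (β : ℂ), 2 * β.re + (N + 1 : ℕ) ∈ I →
        AnalyticAt ℂ (R N) β ∧
        (∀ f, ∀ z ∈ closedBall c r,
          HasSum (fun n : A => piST q β n (remainder N f) z) (val (R N β f) z)) ∧
        NuclearOfOrderZero (R N β) ∧ L β = principalOp h0 E N β + R N β := by
  obtain ⟨ρ, hρ0, hρ, hs⟩ := h.exists_shrink hq h0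
  set R : ℕ → ℂ → DiskAlgebra c' r' →L[ℂ] DiskAlgebra c r := remainderOp q A c r h0 hρ.le
  have hR : ∀ {N : ℕ} {β : ℂ}, 2 * β.re + (N + 1 : ℕ) ∈ I → ∀ f, ∀ z ∈ closedBall c r,
      HasSum (fun n : A => piST q β n (remainder N f) z) (val (R N β f) z) :=
    fun hβ f z hz => hasSum_remainderOp hs hr h0 hρ.le (hτ _ hβ) f hz
  -- Raising the level moves `a_{N+1} w^{N+1}` from the remainder to the polynomial. Where level `N`
  -- converges, the series of this monomial converges too. The terms with `k ≤ N` are the same on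
  -- both sides, so the equality holds even at poles of the `E k`.
  have hstep : ∀ {N : ℕ} {β : ℂ}, 2 * β.re + (N + 1 : ℕ) ∈ I →
      principalOp h0 E (N + 1) β + R (N + 1) β = principalOp h0 E N β + R N β := by
    intro N β hβ
    ext f
    refine ext_val fun z hz => ?_
    simp only [add_apply, val_add, val_principalOp]
    rw [Finset.sum_range_succ _ (N + 1), add_assoc]
    congr 1
    refine HasSum.unique ?_ (hR hβ f z hz)
    refine (((hE (N + 1) β hβ z hz).mul_left (coeff f (N + 1))).add
      (hR (hup ?_ hβ) f z hz)).congr_fun fun n => ?_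
    · push_cast
      linarith
    · rw [← piST_add]
      simp only [← remainder_eq_add]
  have hle : ∀ {N N' : ℕ} {β : ℂ}, N ≤ N' → 2 * β.re + (N + 1 : ℕ) ∈ I →
      principalOp h0 E N' β + R N' β = principalOp h0 E N β + R N β := by
    intro N N' β hN hβ
    induction N', hN using Nat.le_induction with
    | base => rfl
    | succ k hk ih =>
      rw [hstep (hup ?_ hβ), ih]
      have : (N : ℝ) ≤ k := by exact_mod_cast hk
      push_cast
      linarith
  have hex : ∀ β : ℂ, ∃ N : ℕ, 2 * β.re + (N + 1 : ℕ) ∈ I := by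
    intro β
    obtain ⟨τ, hτI⟩ := hne
    obtain ⟨N, hN⟩ := exists_nat_gt (τ - 2 * β.re)
    refine ⟨N, hup ?_ hτI⟩
    push_cast
    linarith
  choose ν hν using hex
  -- The level `ν β` varies with `β`. By `hle` the value does not depend on it, so near a point `b`
  -- the fixed level `ν b` may be used.
  set L : ℂ → DiskAlgebra c' r' →L[ℂ] DiskAlgebra c r :=
    fun β => principalOp h0 E (ν β) β + R (ν β) β
  have hL : ∀ {N : ℕ} {β : ℂ}, 2 * β.re + (N + 1 : ℕ) ∈ I →
      L β = principalOp h0 E N β + R N β := by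
    intro N β hβ
    rcases le_total N (ν β) with hN | hN
    · exact hle hN hβ
    · exact (hle hN (hν β)).symm
  have hev : ∀ b, L =ᶠ[𝓝 b] fun β => principalOp h0 E (ν b) β + R (ν b) β := by
    intro b
    have hopen : IsOpen {β : ℂ | 2 * β.re + (ν b + 1 : ℕ) ∈ I} :=
      hI.preimage (by fun_prop)
    filter_upwards [hopen.mem_nhds (hν b)] with β hβ using hL hβ
  have hRa : ∀ {N : ℕ} {β : ℂ}, 2 * β.re + (N + 1 : ℕ) ∈ I → AnalyticAt ℂ (R N) β :=
    fun hβ => analyticAt_remainderOp hs hr h0 hρ.le hI hτ hβ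
  refine ⟨L, R, fun β hβ f z hz => ?_, fun b hb => ?_, fun b => ?_, fun N β hβ =>
    ⟨hRa hβ, hR hβ, nuclear_remainderOp h0 hρ0 hρ N β, hL hβ⟩⟩
  · have hβ1 : 2 * β.re + (0 + 1 : ℕ) ∈ I := hup (by push_cast; linarith) hβ
    rw [hL hβ1, add_apply, val_add, val_principalOp]
    simp only [zero_add, Finset.sum_range_one]
    refine (((hE 0 β (by simpa using hβ) z hz).mul_left (coeff f 0)).add
      (hR hβ1 f z hz)).congr_fun fun n => ?_
    rw [← piST_add]
    simp [remainder]
  · exact ((analyticAt_principalOp h0 fun k _ => hEa k b (hb k)).add (hRa (hν b))).congr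
      (hev b).symm
  · exact ((simplePoleAt_principalOp h0 fun k _ => hEs k b).add
      (simplePoleAt_of_analyticAt (hRa (hν b)))).congr
      ((hev b).symm.filter_mono nhdsWithin_le_nhds)

end Splitting

end HeckeTransfer

namespace HeckeTransfer

open Filter Topology Metric

/-! ### Sums of monomials over inverse branches -/

/-- The sum of `w^k` is the weighted branch sum with weight `w^k` applied to the constant function
`1`, which inherits the holomorphy in `β`. -/
theorem exists_monomialSum_of_finite {q : ℕ} {A : Set ℤ} {c : ℂ} {r : ℝ} {c' : ℂ} {r' : ℝ}
    (h : BranchFamily q A c r c' r') (hr : 0 ≤ r) (hA : A.Finite) :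
    ∃ E : ℕ → ℂ → DiskAlgebra c r, (∀ k β, AnalyticAt ℂ (E k) β) ∧
      ∀ (k : ℕ) (β : ℂ), ∀ z ∈ closedBall c r,
        HasSum (fun n : A => piST q β n (fun w => w ^ k) z) (val (E k β) z) := by
  set one : DiskAlgebra c' r' := ofFun (fun _ => 1) (by fun_prop) (by fun_prop)
  refine ⟨fun k β => branchSum q A c r c' r' k β one, fun k β => ?_, fun k β z hz => ?_⟩
  · exact ((ContinuousLinearMap.apply ℂ (DiskAlgebra c r) one).analyticAt _).comp
      (analyticAt_branchSum h hr isOpen_univ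
        (fun τ _ => summableExponent_of_finite h hA τ) (mem_univ _))
  · refine (isBranchSum_branchSum h hr (summableExponent_of_finite h hA _) one z hz).congr_fun
      fun n => ?_
    have hw := ball_subset_closedBall (h.maps n n.2 z hz)
    simp only [piST]
    rw [val_ofFun _ _ hw, mul_one]

theorem mul_cpow_of_pos {l : ℝ} (hl : 0 < l) {u : ℂ} (hu : u ≠ 0) (s : ℂ) :
    ((l : ℂ) * u) ^ s = (l : ℂ) ^ s * u ^ s := by
  have hl0 : (l : ℂ) ≠ 0 := by exact_mod_cast hl.ne'
  rw [Complex.cpow_def_of_ne_zero (mul_ne_zero hl0 hu), Complex.cpow_def_of_ne_zero hl0,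
    Complex.cpow_def_of_ne_zero hu, Complex.log_ofReal_mul hl hu, add_mul, Complex.exp_add,
    Complex.ofReal_log hl.le]

/-- In the right half-plane `-2 arg u` stays in `(-π, π)`, so the principal branch commutes with the
power. -/
theorem zpow_neg_two_cpow {u : ℂ} (hu : 0 < u.re) (β : ℂ) :
    (u ^ (-2 : ℤ)) ^ β = u ^ (-2 * β) := by
  have harg := abs_lt.1 (Complex.abs_arg_lt_pi_div_two_iff.2 (Or.inl hu))
  have := Complex.cpow_int_mul' (x := u) (n := -2) (by push_cast; linarith) (by push_cast; linarith)
    β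
  rw [← this]
  push_cast
  rfl

/-- With `z + nλ = σλu` the sign disappears from the even power and survives only in `(-σ)^k`. What
remains is one term of a Hurwitz series with exponent `2β + k`. -/
theorem branch_term_eq {l : ℝ} (hl : 0 < l) {u : ℂ} (hu : 0 < u.re) {σ : ℂ} (hσ : σ * σ = 1) (β : ℂ)
    (k : ℕ) : ((σ * (l * u)) ^ (-2 : ℤ)) ^ β * (-1 / (σ * (l * u))) ^ k =
      (-σ) ^ k * (l : ℂ) ^ (-2 * β - k) * u ^ (-(2 * β + k)) := by
  have hl0 : (l : ℂ) ≠ 0 := by exact_mod_cast hl.ne'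
  have hu0 : u ≠ 0 := ne_zero_of_re_pos hu
  have hσ0 : σ ≠ 0 := by
    rintro rfl
    simp at hσ
  have h1 : (σ * (l * u)) ^ (-2 : ℤ) = (l * u) ^ (-2 : ℤ) := by
    rw [mul_zpow, zpow_neg σ, zpow_ofNat, pow_two, hσ, inv_one, one_mul]
  have h2 : -1 / (σ * (l * u)) = -σ * ((l : ℂ)⁻¹ * u⁻¹) := by
    field_simp
    rw [pow_two, hσ]
  have h3 : 0 < ((l : ℂ) * u).re := by
    rw [Complex.re_ofReal_mul]
    exact mul_pos hl hu
  have h4 : -(2 * β + k) = -2 * β - k := by ring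
  rw [h1, h2, zpow_neg_two_cpow h3, mul_cpow_of_pos hl hu0, h4, Complex.cpow_sub _ _ hl0,
    Complex.cpow_sub _ _ hu0, Complex.cpow_natCast, Complex.cpow_natCast, mul_pow, mul_pow, inv_pow,
    inv_pow]
  field_simp

section Hurwitz

variable {q : ℕ} {c : ℂ} {r : ℝ} {σ : ℤ} {m : ℕ}

/-- The indices `σ n`, `n ≥ m`. -/
def ray (σ : ℤ) (m : ℕ) : Set ℤ := {n | ∃ k : ℕ, n = σ * ((m : ℤ) + k)}

/-- The natural parametrisation of `ray σ m`. -/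
def rayEquiv (hσ : σ * σ = 1) (m : ℕ) : ℕ ≃ ray σ m :=
  Equiv.ofBijective (fun k => ⟨σ * ((m : ℤ) + k), k, rfl⟩) <| by
    have hσ0 : σ ≠ 0 := by
      rintro rfl
      simp at hσ
    refine ⟨fun k k' h => ?_, fun ⟨n, k, hk⟩ => ⟨k, Subtype.ext hk.symm⟩⟩
    have := mul_left_cancel₀ hσ0 (Subtype.ext_iff.1 h)
    omega

theorem rayEquiv_apply (hσ : σ * σ = 1) (m k : ℕ) :
    ((rayEquiv hσ m k : ray σ m) : ℤ) = σ * ((m : ℤ) + k) := rfl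

theorem intCast_mul_self (hσ : σ * σ = 1) : (σ : ℂ) * σ = 1 := by exact_mod_cast hσ

theorem ray_shift (hq : 0 < lam q) (hσ : σ * σ = 1) (m k : ℕ) (z : ℂ) :
    z + ((rayEquiv hσ m k : ray σ m) : ℤ) * lam q =
      σ * (lam q * ((k : ℂ) + (σ * z / lam q + m))) := by
  have hl0 : (lam q : ℂ) ≠ 0 := by exact_mod_cast hq.ne'
  rw [rayEquiv_apply]
  push_cast
  field_simp
  linear_combination (-z) * intCast_mul_self hσ

theorem continuousOn_hurwitzEntire_affine (hq : 0 < lam q)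
    (hw : ∀ z ∈ closedBall c r, 0 < (σ * z / lam q + m : ℂ).re) (k : ℕ) :
    ContinuousOn (fun p : ℂ × ℂ => (-(σ : ℂ)) ^ k * (lam q : ℂ) ^ (-2 * p.1 - k) *
      hurwitzEntire (2 * p.1 + k) (σ * p.2 / lam q + m)) (univ ×ˢ closedBall c r) := by
  have hl0 : (lam q : ℂ) ≠ 0 := by exact_mod_cast hq.ne'
  refine ContinuousOn.mul (ContinuousOn.mul continuousOn_const ?_) ?_
  · exact ContinuousOn.const_cpow (by fun_prop) (Or.inl hl0)
  · exact continuousOn_hurwitzEntire.comp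
      (f := fun p : ℂ × ℂ => (2 * p.1 + k, σ * p.2 / lam q + m)) (by fun_prop)
      fun p hp => hw p.2 hp.2

/-- The function `(-σ)^k λ^{-2β-k} (s - 1) ζ(s, σ z / λ + m)` with `s = 2β + k`. -/
def hurwitzDisk (hq : 0 < lam q)
    (hw : ∀ z ∈ closedBall c r, 0 < (σ * z / lam q + m : ℂ).re) (k : ℕ) (β : ℂ) :
    DiskAlgebra c r :=
  ofFun (fun z => (-(σ : ℂ)) ^ k * (lam q : ℂ) ^ (-2 * β - k) *
      hurwitzEntire (2 * β + k) (σ * z / lam q + m))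
    ((continuousOn_hurwitzEntire_affine hq hw k).comp (f := fun z => (β, z)) (by fun_prop)
      fun _ hz => ⟨mem_univ _, hz⟩)
    (DifferentiableOn.const_mul ((differentiableOn_hurwitzEntire_snd _).comp (by fun_prop)
      fun z hz => hw z (ball_subset_closedBall hz)) _)

/-- Joint continuity in `(β, z)` bounds the norm for `β` in a compact disk; each value is entire in
`β`. -/
theorem analyticAt_hurwitzDisk (hq : 0 < lam q)
    (hw : ∀ z ∈ closedBall c r, 0 < (σ * z / lam q + m : ℂ).re) (k : ℕ) (β : ℂ) :
    AnalyticAt ℂ (hurwitzDisk hq hw k) β := by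
  obtain ⟨M, hM⟩ := ((isCompact_closedBall β 1).prod
    (isCompact_closedBall c r)).exists_bound_of_continuousOn
    ((continuousOn_hurwitzEntire_affine hq hw k).mono (prod_mono (subset_univ _) Subset.rfl))
  refine analyticAt_diskAlgebra (ρ := 1) (M := max M 0) one_pos (fun b hb => ?_) fun z hz => ?_
  · refine norm_le_of_forall_val _ (le_max_right _ _) fun z hz => ?_
    rw [hurwitzDisk, val_ofFun _ _ hz]
    exact (hM (b, z) ⟨ball_subset_closedBall hb, hz⟩).trans (le_max_left _ _)
  · have hl0 : (lam q : ℂ) ≠ 0 := by exact_mod_cast hq.ne'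
    have hd : Differentiable ℂ fun b : ℂ => (-(σ : ℂ)) ^ k * (lam q : ℂ) ^ (-2 * b - k) *
        hurwitzEntire (2 * b + k) (σ * z / lam q + m) := by
      refine Differentiable.mul (Differentiable.const_mul (fun b => ?_) _) ?_
      · exact DifferentiableAt.const_cpow (by fun_prop) (Or.inl hl0)
      · exact (differentiable_hurwitzEntire (hw z hz)).comp (by fun_prop)
    refine hd.differentiableOn.congr fun b _ => ?_
    rw [hurwitzDisk, val_ofFun _ _ hz]

theorem two_mul_add_sub_one (β : ℂ) (k : ℕ) : 2 * β + k - 1 = 2 * (β - betaPt k) := by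
  rw [betaPt]
  ring

/-- Sums of monomials over a ray of branches are given by the Hurwitz zeta function. -/
theorem exists_monomialSum_of_ray (hq : 0 < lam q) (hσ : σ * σ = 1)
    (hw : ∀ z ∈ closedBall c r, 0 < (σ * z / lam q + m : ℂ).re) :
    ∃ E : ℕ → ℂ → DiskAlgebra c r, (∀ k, ∀ β ∉ ({betaPt k} : Set ℂ), AnalyticAt ℂ (E k) β) ∧
      (∀ k β, SimplePoleAt (E k) β) ∧
      (∀ (k : ℕ) (β : ℂ), 1 < 2 * β.re + k → ∀ z ∈ closedBall c r,
        HasSum (fun n : ray σ m => piST q β n (fun w => w ^ k) z) (val (E k β) z)) ∧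
      ∀ (k : ℕ) (β : ℂ), β ≠ betaPt k → ∀ z ∈ closedBall c r,
        val (E k β) z = (-(σ : ℂ)) ^ k * (lam q : ℂ) ^ (-2 * β - k) *
          hurwitz (2 * β + k) (σ * z / lam q + m) := by
  have ha := fun k β => analyticAt_hurwitzDisk hq hw k β
  have hinv : ∀ (k : ℕ) (β : ℂ), β ≠ betaPt k →
      AnalyticAt ℂ (fun b : ℂ => (2 * b + k - 1)⁻¹) β := fun k β hβ => by
    refine AnalyticAt.fun_inv (by fun_prop) ?_
    rw [two_mul_add_sub_one]
    exact mul_ne_zero two_ne_zero (sub_ne_zero.2 hβ)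
  refine ⟨fun k β => (2 * β + k - 1)⁻¹ • hurwitzDisk hq hw k β, fun k β hβ => ?_, fun k β => ?_,
    fun k β hβ z hz => ?_, fun k β hβ z hz => ?_⟩
  · exact (hinv k β hβ).fun_smul (ha k β)
  -- At `β_k` the prefactor is `(2 (b - β_k))⁻¹` times an analytic family; at every other point it
  -- is analytic.
  · by_cases hβ : β = betaPt k
    · refine ⟨fun b => (2 : ℂ)⁻¹ • hurwitzDisk hq hw k b,
        analyticAt_const.fun_smul (ha k β), Eventually.of_forall fun b => ?_⟩
      simp only [two_mul_add_sub_one, smul_smul, hβ, mul_inv]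
      rw [mul_comm]
    · exact simplePoleAt_of_analyticAt ((hinv k β hβ).fun_smul (ha k β))
  · rw [← (rayEquiv hσ m).hasSum_iff]
    have hs : 1 < (2 * β + k : ℂ).re := by simpa using hβ
    rw [val_smul, hurwitzDisk, val_ofFun _ _ hz, mul_left_comm]
    refine ((hasSum_hurwitz hs (hw z hz)).mul_left _).congr_fun fun n => ?_
    simp only [Function.comp_apply, piST]
    rw [ray_shift hq hσ, branch_term_eq hq (natCast_add_re_pos (hw z hz) n) (intCast_mul_self hσ)]
  · have hs : (2 * β + k : ℂ) ≠ 1 := by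
      rw [← sub_ne_zero, two_mul_add_sub_one]
      exact mul_ne_zero two_ne_zero (sub_ne_zero.2 hβ)
    rw [val_smul, hurwitzDisk, val_ofFun _ _ hz, hurwitz_eq hs (hw z hz)]
    ring

/-- By compactness `Re (σz/λ + m)` has a positive minimum `a` on the closed disk, and the terms are
dominated by a multiple of `(k + a)^{-τ}`. -/
theorem summableExponent_ray (hq : 0 < lam q) (hσ : σ * σ = 1) (hr : 0 ≤ r)
    (hw : ∀ z ∈ closedBall c r, 0 < (σ * z / lam q + m : ℂ).re) {τ : ℝ} (hτ : 1 < τ) :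
    SummableExponent q (ray σ m) c r τ := by
  obtain ⟨z₀, hz₀, hmin⟩ := (isCompact_closedBall c r).exists_isMinOn
    ⟨c, mem_closedBall_self hr⟩
    (f := fun z : ℂ => (σ * z / lam q + m : ℂ).re) (by fun_prop)
  set a := (σ * z₀ / lam q + m : ℂ).re with ha
  have ha0 : 0 < a := hw z₀ hz₀
  set v : ℕ → ℝ := fun k => lam q ^ (-τ) * ((k : ℝ) + a) ^ (-τ)
  have hv : Summable v := (summable_nat_add_rpow_neg ha0 hτ).mul_left _
  have hb : ∀ k : ℕ, ∀ z ∈ closedBall c r,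
      ‖z + ((rayEquiv hσ m k : ray σ m) : ℤ) * lam q‖ ^ (-τ) ≤ v k := fun k z hz => by
    have h1 : ‖(σ : ℂ)‖ = 1 := by
      have := congrArg norm (intCast_mul_self hσ)
      rw [norm_mul, norm_one] at this
      nlinarith [norm_nonneg (σ : ℂ)]
    have hpos : 0 < (k : ℝ) + a := by positivity
    rw [ray_shift hq hσ, norm_mul, h1, one_mul, norm_mul, Complex.norm_real,
      Real.norm_of_nonneg hq.le, Real.mul_rpow hq.le (norm_nonneg _)]
    refine mul_le_mul_of_nonneg_left ?_ (Real.rpow_nonneg hq.le _)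
    refine Real.rpow_le_rpow_of_nonpos hpos ?_ (by linarith)
    refine le_trans ?_ (Complex.re_le_norm _)
    rw [Complex.add_re, Complex.natCast_re]
    exact add_le_add le_rfl (hmin hz)
  refine ⟨fun n => v ((rayEquiv hσ m).symm n), (rayEquiv hσ m).symm.summable_iff.2 hv,
    fun n z hz => ?_⟩
  have := hb ((rayEquiv hσ m).symm n) z hz
  rwa [Equiv.apply_symm_apply] at this

end Hurwitz

end HeckeTransfer

namespace HeckeTransfer

/-! ### The orbit of the left end point -/

section Orbit

variable {q : ℕ}

theorem one_le_lam (hq : 3 ≤ q) : 1 ≤ lam q := by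
  have hq' : (3 : ℝ) ≤ q := by exact_mod_cast hq
  have h1 : Real.pi / q ≤ Real.pi / 3 := by
    have := Real.pi_pos
    gcongr
  have h2 := Real.cos_le_cos_of_nonneg_of_le_pi (by positivity) (by linarith [Real.pi_pos]) h1
  rw [Real.cos_pi_div_three] at h2
  rw [lam]
  linarith

theorem lam_le_two (q : ℕ) : lam q ≤ 2 := by
  rw [lam]
  linarith [Real.cos_le_one (Real.pi / q)]

theorem F_eq (hl : 0 < lam q) {x : ℝ} (hx : x ≠ 0) {n : ℤ} (h1 : -(lam q) / 2 ≤ -1 / x - n * lam q)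
    (h2 : -1 / x - n * lam q < lam q / 2) : F q x = -1 / x - n * lam q := by
  have hn : nearestMult q (-1 / x) = n := by
    rw [nearestMult, Int.floor_eq_iff]
    constructor
    · rw [← sub_le_iff_le_add, le_div_iff₀ hl]
      linarith
    · rw [← lt_sub_iff_add_lt, div_lt_iff₀ hl]
      linarith
  rw [F, if_neg hx, hn]

theorem neg_half_lam_le_F (hl : 0 < lam q) (x : ℝ) : -(lam q) / 2 ≤ F q x := by
  rw [F]
  split_ifs with hx
  · linarith
  · have := Int.floor_le (-1 / x / lam q + 1 / 2)
    rw [← nearestMult, ← sub_le_iff_le_add, le_div_iff₀ hl] at this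
    linarith

/-- The points `-sin t / sin (t + π / q)`, which the map moves by `t ↦ t - π / q`. -/
def sinRatio (q : ℕ) (t : ℝ) : ℝ := -Real.sin t / Real.sin (t + Real.pi / q)

theorem pi_div_pos (hq : 3 ≤ q) : 0 < Real.pi / q := by
  have : (0 : ℝ) < q := by exact_mod_cast (by omega : 0 < q)
  have := Real.pi_pos
  positivity

/-- The addition formula `sin (t + θ) + sin (t - θ) = 2 cos θ sin t` says that `-1/x - λ` is the
point with parameter `t - θ`, where `θ = π/q`. The bounds on `t` place it in `[-λ/2, 0]`, so the
nearest multiple is `1`. -/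
theorem F_sinRatio (hq : 3 ≤ q) {t : ℝ} (h1 : Real.pi / q ≤ t)
    (h2 : t ≤ Real.pi / 2 - Real.pi / q) : F q (sinRatio q t) = sinRatio q (t - Real.pi / q) := by
  have hθ := pi_div_pos hq
  have hl := one_le_lam hq
  set θ := Real.pi / q with hθd
  have hpi := Real.pi_pos
  have hs : 0 < Real.sin t := Real.sin_pos_of_pos_of_lt_pi (by linarith) (by linarith)
  have hs' : 0 < Real.sin (t + θ) := Real.sin_pos_of_pos_of_lt_pi (by linarith) (by linarith)
  have hs0 : 0 ≤ Real.sin (t - θ) := Real.sin_nonneg_of_nonneg_of_le_pi (by linarith) (by linarith)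
  have hc : 0 ≤ Real.cos t := Real.cos_nonneg_of_mem_Icc ⟨by linarith, by linarith⟩
  have hsθ : 0 ≤ Real.sin θ := Real.sin_nonneg_of_nonneg_of_le_pi (by linarith) (by linarith)
  have hld : lam q = 2 * Real.cos θ := rfl
  have e1 : sinRatio q (t - θ) = -Real.sin (t - θ) / Real.sin t := by
    rw [sinRatio, ← hθd, sub_add_cancel]
  have e2 : -1 / sinRatio q t - ((1 : ℤ) : ℝ) * lam q = -Real.sin (t - θ) / Real.sin t := by
    rw [sinRatio, ← hθd, hld, Real.sin_sub, Int.cast_one]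
    field_simp
    rw [Real.sin_add]
    ring
  have hx : sinRatio q t ≠ 0 := div_ne_zero (neg_ne_zero.2 hs.ne') hs'.ne'
  rw [e1, ← e2]
  refine F_eq (by linarith) hx ?_ ?_
  · rw [e2, le_div_iff₀ hs, Real.sin_sub, hld]
    nlinarith [mul_nonneg hc hsθ]
  · rw [e2, div_lt_iff₀ hs]
    nlinarith

theorem iterate_F_sinRatio (hq : 3 ≤ q) {t : ℝ} (h2 : t ≤ Real.pi / 2 - Real.pi / q) (j : ℕ)
    (h1 : j * (Real.pi / q) ≤ t) :
    (F q)^[j] (sinRatio q t) = sinRatio q (t - j * (Real.pi / q)) := by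
  have hθ := pi_div_pos hq
  induction j with
  | zero => simp
  | succ j ih =>
    push_cast at h1
    have hj : 0 ≤ (j : ℝ) * (Real.pi / q) := by positivity
    rw [Function.iterate_succ_apply', ih (by linarith), F_sinRatio hq (by linarith) (by linarith)]
    congr 1
    push_cast
    ring

theorem sinRatio_neg {t : ℝ} (hq : 3 ≤ q) (h1 : 0 < t) (h2 : t ≤ Real.pi / 2 - Real.pi / q) :
    sinRatio q t < 0 := by
  have hθ := pi_div_pos hq
  have hpi := Real.pi_pos
  exact div_neg_of_neg_of_pos
    (neg_lt_zero.2 (Real.sin_pos_of_pos_of_lt_pi (by linarith) (by linarith)))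
    (Real.sin_pos_of_pos_of_lt_pi (by linarith) (by linarith))

theorem sinRatio_zero : sinRatio q 0 = 0 := by simp [sinRatio]

theorem sinRatio_start : sinRatio q (Real.pi / 2 - Real.pi / q) = -(lam q) / 2 := by
  rw [sinRatio, sub_add_cancel, Real.sin_pi_div_two, Real.sin_pi_div_two_sub, lam]
  ring

/-- The exceptional step for odd `q`: here `x = -1/(1 + λ)`, the nearest multiple is `2`, and the
image `1 - λ` is again of the form `-sin t / sin (t + θ)`. -/
theorem F_sinRatio_middle (hq : 3 ≤ q) :
    F q (sinRatio q (Real.pi / q / 2)) = sinRatio q (Real.pi / 2 - 3 * (Real.pi / q) / 2) := by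
  have hθ := pi_div_pos hq
  have hl := one_le_lam hq
  have hl2 := lam_le_two q
  have hld : lam q = 2 * Real.cos (Real.pi / q) := rfl
  have hle : Real.pi / q ≤ Real.pi / 3 := by
    have hq' : (3 : ℝ) ≤ q := by exact_mod_cast hq
    have := Real.pi_pos
    gcongr
  set θ := Real.pi / q with hθd
  have hpi := Real.pi_pos
  have hs : 0 < Real.sin (θ / 2) := Real.sin_pos_of_pos_of_lt_pi (by linarith) (by linarith)
  have hc : 0 < Real.cos (θ / 2) := Real.cos_pos_of_mem_Ioo ⟨by linarith, by linarith⟩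
  have hcos : Real.cos θ = 2 * Real.cos (θ / 2) ^ 2 - 1 := by
    rw [← Real.cos_two_mul]; congr 1; ring
  have hsc := Real.sin_sq_add_cos_sq (θ / 2)
  have h3 : Real.sin (3 * (θ / 2)) = Real.sin (θ / 2) * (1 + lam q) := by
    rw [Real.sin_three_mul, hld, hcos]
    linear_combination (-4 * Real.sin (θ / 2)) * hsc
  have e1 : sinRatio q (θ / 2) = -1 / (1 + lam q) := by
    rw [sinRatio, ← hθd, show θ / 2 + θ = 3 * (θ / 2) by ring, h3]
    field_simp
  have e2 : sinRatio q (Real.pi / 2 - 3 * θ / 2) = 1 - lam q := by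
    rw [sinRatio, ← hθd, show Real.pi / 2 - 3 * θ / 2 + θ = Real.pi / 2 - θ / 2 by ring,
      show 3 * θ / 2 = 3 * (θ / 2) by ring, Real.sin_pi_div_two_sub, Real.sin_pi_div_two_sub,
      Real.cos_three_mul, hld, hcos]
    field_simp
    ring
  have e3 : -1 / sinRatio q (θ / 2) - ((2 : ℤ) : ℝ) * lam q = 1 - lam q := by
    rw [e1]
    push_cast
    field_simp
    ring
  rw [e2, ← e3]
  refine F_eq (by linarith) ?_ ?_ ?_
  · rw [e1]
    exact div_ne_zero (by norm_num) (by linarith)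
  · rw [e3]; linarith
  · rw [e3]; linarith

/-- The orbit of `-λ / 2` is negative up to time `κ`, when it reaches `0`. -/
theorem iterate_F_start (hq : 3 ≤ q) : (∀ j < kappa q, (F q)^[j] (-(lam q) / 2) < 0) ∧
    (F q)^[kappa q] (-(lam q) / 2) = 0 := by
  have hθ := pi_div_pos hq
  have hq0 : (q : ℝ) ≠ 0 := by
    have : 0 < q := by omega
    positivity
  have hqθ : q * (Real.pi / q) = Real.pi := by field_simp
  rw [← sinRatio_start]
  set θ := Real.pi / q with hθd
  -- For `q = 2p` the initial parameter is `κθ`, and `κ` shifts lead to `0`. For `q = 2h + 3` it is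
  -- `hθ + θ/2`: `h` shifts reach `θ/2`, the exceptional step jumps to `hθ`, and `h` further shifts
  -- reach `0`, in all `2h + 1 = κ` steps.
  rcases Nat.even_or_odd q with he | ho
  · obtain ⟨p, hp⟩ := he
    have hk : kappa q = p - 1 := by
      rw [kappa, if_pos ⟨p, hp⟩]
      omega
    have hkr : ((kappa q : ℕ) : ℝ) = p - 1 := by
      rw [hk, Nat.cast_sub (by omega), Nat.cast_one]
    have ht : Real.pi / 2 - θ = (kappa q : ℝ) * θ := by
      rw [hkr, ← hqθ, hp]
      push_cast
      ring
    have hit : ∀ j ≤ kappa q, (F q)^[j] (sinRatio q (Real.pi / 2 - θ)) =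
        sinRatio q (((kappa q : ℝ) - j) * θ) := fun j hj => by
      have hj' : (j : ℝ) ≤ kappa q := by exact_mod_cast hj
      rw [iterate_F_sinRatio hq le_rfl j (by rw [← hθd, ht]; gcongr), ← hθd, ht, sub_mul]
    refine ⟨fun j hj => ?_, ?_⟩
    · rw [hit j hj.le]
      have hj' : (j : ℝ) < kappa q := by exact_mod_cast hj
      refine sinRatio_neg hq (mul_pos (by linarith) hθ) ?_
      rw [← hθd, ht]
      have : (0 : ℝ) ≤ j := j.cast_nonneg
      gcongr
      linarith
    · rw [hit _ le_rfl, sub_self, zero_mul, sinRatio_zero]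
  · have hne : ¬ Even q := Nat.not_even_iff_odd.2 ho
    obtain ⟨p, hp⟩ := ho
    obtain ⟨h, rfl⟩ : ∃ h, p = h + 1 := ⟨p - 1, by omega⟩
    have hk : kappa q = h + 1 + h := by
      rw [kappa, if_neg hne]
      omega
    have hpi : Real.pi = (2 * h + 3) * θ := by
      rw [← hqθ, hp]
      push_cast
      ring
    have h0 : (0 : ℝ) ≤ h := h.cast_nonneg
    have hit : ∀ j ≤ h, (F q)^[j] (sinRatio q (Real.pi / 2 - θ)) =
        sinRatio q ((h - j) * θ + θ / 2) := fun j hj => by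
      have hj' : (j : ℝ) ≤ h := by exact_mod_cast hj
      rw [iterate_F_sinRatio hq le_rfl j (by rw [← hθd, hpi]; nlinarith), ← hθd, hpi]
      congr 1
      ring
    have hmid : (F q)^[h + 1] (sinRatio q (Real.pi / 2 - θ)) = sinRatio q (h * θ) := by
      rw [Function.iterate_succ_apply', hit h le_rfl, sub_self, zero_mul, zero_add,
        F_sinRatio_middle hq, ← hθd, hpi]
      congr 1
      ring
    have hit' : ∀ j ≤ h, (F q)^[h + 1 + j] (sinRatio q (Real.pi / 2 - θ)) =
        sinRatio q ((h - j) * θ) := fun j hj => by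
      have hj' : (j : ℝ) ≤ h := by exact_mod_cast hj
      rw [add_comm (h + 1) j, Function.iterate_add_apply, hmid,
        iterate_F_sinRatio hq (by rw [← hθd, hpi]; nlinarith) j (by rw [← hθd]; gcongr), ← hθd,
        sub_mul]
    refine ⟨fun j hj => ?_, ?_⟩
    · rcases le_or_gt j h with hjh | hjh
      · rw [hit j hjh]
        have hj' : (j : ℝ) ≤ h := by exact_mod_cast hjh
        have hj0 : (0 : ℝ) ≤ j := j.cast_nonneg
        refine sinRatio_neg hq (by nlinarith) ?_
        rw [← hθd, hpi]
        nlinarith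
      · obtain ⟨i, rfl⟩ : ∃ i, j = h + 1 + i := ⟨j - (h + 1), by omega⟩
        have hih : i < h := by omega
        rw [hit' i hih.le]
        have hi' : (i : ℝ) < h := by exact_mod_cast hih
        have hi0 : (0 : ℝ) ≤ i := i.cast_nonneg
        refine sinRatio_neg hq (by nlinarith) ?_
        rw [← hθd, hpi]
        nlinarith
    · rw [hk, hit' h le_rfl, sub_self, zero_mul, sinRatio_zero]

/-! ### The orbit in increasing order -/

theorem card_orbit (hq : 3 ≤ q) : (orbit q).card = kappa q + 1 := by
  obtain ⟨hneg, hzero⟩ := iterate_F_start hq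
  -- A coincidence at times `a < b`, pushed forward by `κ - b` steps, would make the orbit vanish at
  -- the time `κ - b + a < κ`.
  have key : ∀ a b, a < b → b ≤ kappa q →
      (F q)^[a] (-(lam q) / 2) ≠ (F q)^[b] (-(lam q) / 2) := fun a b hab hb h => by
    have h1 := congrArg (F q)^[kappa q - b] h
    rw [← Function.iterate_add_apply, ← Function.iterate_add_apply, Nat.sub_add_cancel hb,
      hzero] at h1
    exact (hneg (kappa q - b + a) (by omega)).ne h1
  rw [orbit, Finset.card_image_of_injOn, Finset.card_range]
  intro a ha b hb h
  simp only [Finset.coe_range, mem_Iio] at ha hb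
  rcases lt_trichotomy a b with hlt | heq | hlt
  · exact absurd h (key a b hlt (by omega))
  · exact heq
  · exact absurd h.symm (key b a hlt (by omega))

theorem mem_orbit_le (hq : 3 ≤ q) {x : ℝ} (hx : x ∈ orbit q) : -(lam q) / 2 ≤ x ∧ x ≤ 0 := by
  obtain ⟨hneg, hzero⟩ := iterate_F_start hq
  have hl := one_le_lam hq
  rw [orbit, Finset.mem_image] at hx
  obtain ⟨j, hj, rfl⟩ := hx
  rw [Finset.mem_range] at hj
  constructor
  · cases j with
    | zero => simp
    | succ j =>
      rw [Function.iterate_succ_apply']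
      exact neg_half_lam_le_F (by linarith) _
  · rcases Nat.lt_succ_iff_lt_or_eq.1 hj with h | h
    · exact (hneg j h).le
    · rw [h, hzero]

theorem length_sort_orbit (hq : 3 ≤ q) : ((orbit q).sort (· ≤ ·)).length = kappa q + 1 := by
  rw [Finset.length_sort, card_orbit hq]

theorem markovPoint_eq (hq : 3 ≤ q) {j : ℕ} (hj : j ≤ kappa q) :
    markovPoint q j = ((orbit q).sort (· ≤ ·))[j]'(by rw [length_sort_orbit hq]; omega) := by
  rw [markovPoint, List.getD_eq_getElem]

theorem markovPoint_mem (hq : 3 ≤ q) {j : ℕ} (hj : j ≤ kappa q) : markovPoint q j ∈ orbit q := by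
  rw [markovPoint_eq hq hj, ← Finset.mem_sort (· ≤ ·)]
  exact List.getElem_mem _

theorem markovPoint_lt (hq : 3 ≤ q) {i j : ℕ} (hij : i < j) (hj : j ≤ kappa q) :
    markovPoint q i < markovPoint q j := by
  rw [markovPoint_eq hq hj, markovPoint_eq hq (hij.le.trans hj)]
  exact (Finset.sortedLT_sort (orbit q)).strictMono_get (by simpa using hij)

theorem markovPoint_kappa (hq : 3 ≤ q) : markovPoint q (kappa q) = 0 := by
  refine le_antisymm (mem_orbit_le hq (markovPoint_mem hq le_rfl)).2 ?_
  have h0 : (0 : ℝ) ∈ (orbit q).sort (· ≤ ·) := by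
    rw [Finset.mem_sort, orbit, Finset.mem_image]
    exact ⟨kappa q, by simp, (iterate_F_start hq).2⟩
  obtain ⟨i, hi, hi0⟩ := List.getElem_of_mem h0
  rw [length_sort_orbit hq] at hi
  have : markovPoint q i = 0 := by rw [markovPoint_eq hq (by omega), hi0]
  rw [← this]
  rcases Nat.lt_succ_iff_lt_or_eq.1 hi with h | h
  · exact (markovPoint_lt hq h le_rfl).le
  · rw [h]

end Orbit

end HeckeTransfer

namespace HeckeTransfer

open Filter Topology Metric

/-! ### The intervals of the Markov partition and the sets of branches -/

section Branches

variable {q : ℕ}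

theorem mem_J {i : ℤ} : i ∈ J q ↔ 1 ≤ i.natAbs ∧ i.natAbs ≤ kappa q := by
  rw [J, Finset.mem_erase, Finset.mem_Icc]
  omega

theorem sign_mul_self {i : ℤ} (hi : i ∈ J q) : i.sign * i.sign = 1 := by
  have := (mem_J.1 hi).1
  rcases lt_trichotomy i 0 with h | h | h
  · simp [Int.sign_eq_neg_one_of_neg h]
  · simp [h] at this
  · simp [Int.sign_eq_one_of_pos h]

theorem sign_mul_self_real {i : ℤ} (hi : i ∈ J q) : ((i.sign : ℤ) : ℝ) * (i.sign : ℤ) = 1 := by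
  exact_mod_cast sign_mul_self hi

theorem mem_markovInterval {i : ℤ} (hi : i ∈ J q) {x : ℝ} : x ∈ markovInterval q i ↔
    ((i.sign : ℤ) : ℝ) * x ∈ Ico (markovPoint q (i.natAbs - 1)) (markovPoint q i.natAbs) := by
  rw [markovInterval]
  split_ifs with h
  · rw [Int.sign_eq_one_of_pos h, Int.cast_one, one_mul]
  · have hi0 : i < 0 := by
      have := (mem_J.1 hi).1
      omega
    rw [Int.sign_eq_neg_one_of_neg hi0, Int.cast_neg, Int.cast_one, neg_one_mul]
    rfl

theorem markovInterval_nonempty (hq : 3 ≤ q) {i : ℤ} (hi : i ∈ J q) :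
    (markovInterval q i).Nonempty := by
  obtain ⟨h1, h2⟩ := mem_J.1 hi
  refine ⟨(i.sign : ℤ) * markovPoint q (i.natAbs - 1), (mem_markovInterval hi).2 ?_⟩
  rw [← mul_assoc, sign_mul_self_real hi, one_mul]
  exact ⟨le_rfl, markovPoint_lt hq (by omega) h2⟩

theorem abs_sign_mul {j : ℤ} (hj : j ∈ J q) (x : ℝ) : |((j.sign : ℤ) : ℝ) * x| = |x| := by
  have h1 : |((j.sign : ℤ) : ℝ)| = 1 := by
    rcases mul_self_eq_one_iff.1 (sign_mul_self_real hj) with h | h <;> simp [h]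
  rw [abs_mul, h1, one_mul]

theorem abs_le_of_mem_markovInterval (hq : 3 ≤ q) {i : ℤ} (hi : i ∈ J q) {x : ℝ}
    (hx : x ∈ markovInterval q i) : |x| ≤ lam q / 2 := by
  obtain ⟨h1, h2⟩ := mem_J.1 hi
  obtain ⟨h3, h4⟩ := (mem_markovInterval hi).1 hx
  have h5 := (mem_orbit_le hq (markovPoint_mem hq h2)).2
  have h6 := (mem_orbit_le hq (markovPoint_mem hq (j := i.natAbs - 1) (by omega))).1
  rw [← abs_sign_mul hi, abs_le]
  have := one_le_lam hq
  constructor <;> linarith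

/-- `I_j` keeps the positive distance `-φ_{|j|}` from `0`, so `-1/(y + nλ) ∈ I_j` for a single `y`
already bounds `n`. -/
theorem finite_branchSet (hq : 3 ≤ q) {i j : ℤ} (hi : i ∈ J q) (hj : j ∈ J q)
    (hjk : j.natAbs ≠ kappa q) : (branchSet q i j).Finite := by
  obtain ⟨h1, h2⟩ := mem_J.1 hj
  have hb : markovPoint q j.natAbs < 0 := by
    rw [← markovPoint_kappa hq]
    exact markovPoint_lt hq (by omega) le_rfl
  set b := markovPoint q j.natAbs
  have hl := one_le_lam hq
  obtain ⟨y, hy⟩ := markovInterval_nonempty hq hi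
  obtain ⟨B, hB⟩ := exists_nat_gt ((-b)⁻¹ + lam q / 2)
  refine (finite_Icc (-(B : ℤ)) B).subset fun n hn => ?_
  have h3 := ((mem_markovInterval hj).1 (hn y hy)).2
  have h4 : -b < |-1 / (y + n * lam q)| := by
    rw [← abs_sign_mul hj]
    exact (lt_neg_of_lt_neg (by linarith)).trans_le (neg_le_abs _)
  rw [abs_div, abs_neg, abs_one, one_div] at h4
  have h5 : |y + n * lam q| < (-b)⁻¹ := by
    rw [← inv_inv |y + n * lam q|]
    exact inv_strictAnti₀ (by linarith) h4
  have h6 := abs_le_of_mem_markovInterval hq hi hy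
  have h7 : |(n : ℝ)| * lam q < B := by
    rw [← abs_of_pos (by linarith : 0 < lam q), ← abs_mul]
    have : |(n * lam q : ℝ)| ≤ |y + n * lam q| + |y| := by
      have := abs_sub (y + n * lam q) y
      rwa [add_sub_cancel_left] at this
    linarith
  have h8 : |(n : ℝ)| ≤ B := by nlinarith [abs_nonneg (n : ℝ)]
  rw [mem_Icc, ← abs_le]
  exact_mod_cast h8

/-- After multiplication by the sign of `j` the target is `[φ_{κ-1}, 0)`, and `-1/v` lies there
exactly when `v ≥ (-φ_{κ-1})⁻¹`. The condition is monotone in `k`. -/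
theorem mem_branchSet_iff (hq : 3 ≤ q) {i j : ℤ} (hj : j ∈ J q) (hjk : j.natAbs = kappa q) (k : ℤ) :
    j.sign * k ∈ branchSet q i j ↔ ∀ y ∈ markovInterval q i,
      (-markovPoint q (kappa q - 1))⁻¹ ≤ (j.sign : ℤ) * y + k * lam q := by
  have hk1 := (mem_J.1 hj).1
  have ha : markovPoint q (kappa q - 1) < 0 := by
    rw [← markovPoint_kappa hq]
    exact markovPoint_lt hq (by omega) le_rfl
  set a := markovPoint q (kappa q - 1)
  refine forall₂_congr fun y _ => ?_
  have hs := sign_mul_self_real hj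
  have hs0 : ((j.sign : ℤ) : ℝ) ≠ 0 := fun h0 => by simp [h0] at hs
  rw [mem_markovInterval hj, hjk, markovPoint_kappa hq]
  set v := (j.sign : ℤ) * y + k * lam q with hv
  have hx : y + ((j.sign * k : ℤ) : ℝ) * lam q = (j.sign : ℤ) * v := by
    rw [hv]
    push_cast
    linear_combination (-y) * hs
  have e : ((j.sign : ℤ) : ℝ) * (-1 / (y + ((j.sign * k : ℤ) : ℝ) * lam q)) = -v⁻¹ := by
    rw [hx]
    rcases eq_or_ne v 0 with h0 | h0
    · simp [h0]
    · field_simp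
  rw [e, mem_Ico]
  constructor
  · rintro ⟨h1, h2⟩
    have hvpos : 0 < v⁻¹ := by linarith
    rw [← inv_inv v]
    exact inv_anti₀ hvpos (by linarith)
  · intro h
    have h0 : 0 < (-a)⁻¹ := inv_pos.2 (by linarith)
    have hvpos : 0 < v := by linarith
    have h1 : v⁻¹ ≤ -a := by
      rw [← inv_inv (-a)]
      exact inv_anti₀ h0 h
    have := inv_pos.2 hvpos
    constructor <;> linarith

/-- By `mem_branchSet_iff` the admissible `k` form an up-set. It is nonempty, so the infimum in
`firstIndex` is attained, and it contains no negative `k` because `|y| ≤ λ/2`. -/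
theorem branchSet_eq_ray (hq : 3 ≤ q) {i j : ℤ} (hi : i ∈ J q) (hj : j ∈ J q)
    (hjk : j.natAbs = kappa q) : branchSet q i j = ray j.sign (firstIndex q i j) ∧
      j.sign * (firstIndex q i j : ℤ) ∈ branchSet q i j := by
  have hl := one_le_lam hq
  have ha : markovPoint q (kappa q - 1) < 0 := by
    have := (mem_J.1 hj).1
    rw [← markovPoint_kappa hq]
    exact markovPoint_lt hq (by omega) le_rfl
  have hC : 0 < (-markovPoint q (kappa q - 1))⁻¹ := inv_pos.2 (by linarith)
  have hmem := mem_branchSet_iff (i := i) hq hj hjk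
  set C := (-markovPoint q (kappa q - 1))⁻¹
  have hy : ∀ y ∈ markovInterval q i, |((j.sign : ℤ) : ℝ) * y| ≤ lam q / 2 := fun y hy => by
    rw [abs_sign_mul hj]
    exact abs_le_of_mem_markovInterval hq hi hy
  have hne : {m : ℕ | j.sign * (m : ℤ) ∈ branchSet q i j}.Nonempty := by
    obtain ⟨m, hm⟩ := exists_nat_gt (C + lam q / 2)
    refine ⟨m, (hmem m).2 fun y hyi => ?_⟩
    have := (abs_le.1 (hy y hyi)).1
    push_cast
    have : (0 : ℝ) ≤ m := m.cast_nonneg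
    nlinarith
  have hfirst : j.sign * (firstIndex q i j : ℤ) ∈ branchSet q i j := Nat.sInf_mem hne
  refine ⟨Subset.antisymm (fun n hn => ?_) ?_, hfirst⟩
  · have hn' : n = j.sign * (j.sign * n) := by
      rw [← mul_assoc, sign_mul_self hj, one_mul]
    set k := j.sign * n
    rw [hn'] at hn ⊢
    have hk := (hmem k).1 hn
    have hk0 : 0 ≤ k := by
      obtain ⟨y, hyi⟩ := markovInterval_nonempty hq hi
      have h1 := hk y hyi
      have h2 := (abs_le.1 (hy y hyi)).2
      by_contra! hneg
      have : (k : ℝ) ≤ -1 := by exact_mod_cast (by omega : k ≤ -1)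
      nlinarith
    obtain ⟨m, hm⟩ := Int.eq_ofNat_of_zero_le hk0
    have hle : firstIndex q i j ≤ m := Nat.sInf_le (by
      rw [hm] at hn
      exact hn)
    refine ⟨m - firstIndex q i j, ?_⟩
    rw [hm]
    congr 1
    omega
  · rintro _ ⟨k, rfl⟩
    refine (hmem _).2 fun y hyi => ?_
    have h1 := (hmem _).1 hfirst y hyi
    push_cast at h1 ⊢
    have : (0 : ℝ) ≤ k := k.cast_nonneg
    nlinarith

variable {c r : J q → ℝ}

theorem re_mem_closedBall {c r : ℝ} {z : ℂ} (hz : z ∈ closedBall (c : ℂ) r) :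
    ((z.re : ℝ) : ℂ) ∈ closedBall (c : ℂ) r := by
  rw [mem_closedBall_iff_norm] at hz ⊢
  rw [← Complex.ofReal_sub, Complex.norm_real]
  exact (Complex.abs_re_le_norm (z - c)).trans hz

/-- As the centre is real, `Re z` lies in the closed disk along with `z`; an imaginary `z + nλ`
would make `Re z` a pole of `ST^n`. -/
theorem Admissible.branchFamily (hD : Admissible q c r) (i j : J q) :
    BranchFamily q (branchSet q i j) (c i) (r i) (c j) (r j) := by
  refine ⟨fun n hn z hz h0 => (hD.maps i j n hn _ (re_mem_closedBall hz)).1 ?_,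
    fun n hn z hz => (hD.maps i j n hn z hz).2⟩
  have : z.re + n * lam q = 0 := by simpa using h0
  exact_mod_cast this

theorem Admissible.radius_pos (hD : Admissible q c r) (i : J q) : 0 < r i :=
  pos_of_mem_ball (hD.zero_mem i)

/-- On `I_i` the expression `σy + mλ` is positive. Were it nonpositive at `Re z`, its zero `-σmλ`,
the pole of `ST^{σm}`, would lie between two real points of the closed disk. -/
theorem Admissible.hurwitz_argument_re_pos (hq : 3 ≤ q) (hD : Admissible q c r) (i j : J q)
    (hjk : (j : ℤ).natAbs = kappa q) : ∀ z ∈ closedBall (c i : ℂ) (r i),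
      0 < (((j : ℤ).sign : ℤ) * z / lam q + firstIndex q i j : ℂ).re := by
  intro z hz
  have hl := one_le_lam hq
  have hs := sign_mul_self_real j.2
  obtain ⟨-, hfirst⟩ := branchSet_eq_ray hq i.2 j.2 hjk
  obtain ⟨y, hy⟩ := markovInterval_nonempty hq i.2
  set σ : ℤ := (j : ℤ).sign
  set m := firstIndex q i j
  have hy1 : 0 < (σ : ℝ) * y + m * lam q := by
    have ha : markovPoint q (kappa q - 1) < 0 := by
      have := (mem_J.1 j.2).1
      rw [← markovPoint_kappa hq]
      exact markovPoint_lt hq (by omega) le_rfl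
    have h1 := (mem_branchSet_iff hq j.2 hjk _).1 hfirst y hy
    have : 0 < (-markovPoint q (kappa q - 1))⁻¹ := inv_pos.2 (by linarith)
    push_cast at h1
    linarith
  have hre : ((σ : ℂ) * z / lam q + m).re = (σ * z.re + m * lam q) / lam q := by
    have hl0 : lam q ≠ 0 := by linarith
    rw [Complex.add_re, Complex.div_ofReal_re, Complex.natCast_re, ← Complex.ofReal_intCast,
      Complex.re_ofReal_mul]
    field_simp
  rw [hre]
  refine div_pos ?_ (by linarith)
  by_contra! hneg
  set t : ℝ := -(σ * (m * lam q)) with ht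
  have hσt : σ * t = -(m * lam q) := by
    rw [ht]
    linear_combination (-(m * lam q)) * hs
  have hyc := hD.interval_subset i y (subset_closure hy)
  have htc : (t : ℂ) ∈ closedBall (c i : ℂ) (r i) := by
    have h1 := re_mem_closedBall hz
    have h2 := ball_subset_closedBall hyc
    rw [mem_closedBall_iff_norm, ← Complex.ofReal_sub, Complex.norm_real, Real.norm_eq_abs,
      ← abs_sign_mul j.2] at h1 h2 ⊢
    change |(σ : ℝ) * _| ≤ _ at h1 h2 ⊢
    rw [mul_sub, abs_le] at h1 h2 ⊢
    constructor <;> linarith [h1.1, h2.2]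
  refine (hD.maps i j _ hfirst t htc).1 ?_
  have : t + ((σ * (m : ℤ) : ℤ) : ℝ) * lam q = 0 := by
    rw [ht]
    push_cast
    ring
  exact_mod_cast this

end Branches

end HeckeTransfer

namespace HeckeTransfer

open Filter Topology Metric

/-! ### The components of the transfer operator -/

section Components

variable {q : ℕ} {c r : J q → ℝ}

theorem mem_polesUpTo {N k : ℕ} (hk : k ≤ N) : betaPt k ∈ polesUpTo N := ⟨k, hk, rfl⟩

/-- The continuation of a component of the transfer operator and its splittings. -/
theorem exists_component (hq : 3 ≤ q) (hD : Admissible q c r) (i j : J q) :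
    ∃ (L : ℂ → Comp q c r j →L[ℂ] Comp q c r i) (A R : ℕ → ℂ → Comp q c r j →L[ℂ] Comp q c r i),
      (∀ β : ℂ, 1 / 2 < β.re → IsTransferComponent i j β (L β)) ∧
      (∀ b ∉ range betaPt, AnalyticAt ℂ L b) ∧ (∀ b, SimplePoleAt L b) ∧
      ∀ N : ℕ, (∀ b ∉ componentPoles q N j, AnalyticAt ℂ (A N) b) ∧
        (∀ b, SimplePoleAt (A N) b) ∧
        (∀ β ∉ componentPoles q N j, IsPrincipalComponent N i j β (A N β)) ∧
        (∀ β, FiniteRank (A N β)) ∧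
        ∀ β ∈ componentDomain q N j, AnalyticAt ℂ (R N) β ∧ IsRemainderComponent N i j β (R N β) ∧
          NuclearOfOrderZero (R N β) ∧ L β = A N β + R N β := by
  have hl : 0 < lam q := by linarith [one_le_lam hq]
  have hr := (hD.radius_pos i).le
  have hB := hD.branchFamily i j
  have h0 := hD.zero_mem j
  by_cases hjk : (j : ℤ).natAbs = kappa q
  · have hw := hD.hurwitz_argument_re_pos hq i j hjk
    have hσ := sign_mul_self j.2
    obtain ⟨hray, -⟩ := branchSet_eq_ray hq i.2 j.2 hjk
    obtain ⟨E, hEa, hEs, hE, hEz⟩ := exists_monomialSum_of_ray hl hσ hw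
    have hτ : ∀ τ ∈ Ioi (1 : ℝ), SummableExponent q (branchSet q i j) (c i) (r i) τ :=
      fun τ hτ => by
        rw [hray]
        exact summableExponent_ray hl hσ hr hw hτ
    rw [← hray] at hE
    obtain ⟨L, R, hL1, hL2, hL3, hR⟩ := exists_splitting hB hl hr h0 isOpen_Ioi (isUpperSet_Ioi 1)
      nonempty_Ioi hτ hE hEa hEs
    have hpole : ∀ {N : ℕ} {b : ℂ}, b ∉ componentPoles q N j → ∀ k ≤ N, b ≠ betaPt k := by
      rintro N b hb k hk rfl
      rw [componentPoles, if_pos hjk] at hb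
      exact hb (mem_polesUpTo hk)
    refine ⟨L, principalOp h0 E, R, fun β hβ => hL1 β ?_, fun b hb => hL2 b ?_, hL3, fun N =>
      ⟨fun b hb => ?_, fun b => ?_, fun β hβ f z hz => ?_, finiteRank_principalOp h0 E N,
        fun β hβ => hR N β ?_⟩⟩
    · rw [mem_Ioi]
      linarith
    · rintro k rfl
      exact hb ⟨k, rfl⟩
    · exact analyticAt_principalOp h0 fun k hk => hEa k b (hpole hb k hk)
    · exact simplePoleAt_principalOp h0 fun k _ => hEs k b
    · rw [if_pos hjk, val_principalOp]
      refine Finset.sum_congr rfl fun k hk => ?_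
      rw [hEz k β (hpole hβ k (by simp at hk; omega)) z hz]
      ring
    -- Convergence requires only `2 Re β + N + 1 > 1`; the stated half-plane leaves a unit to spare.
    · rw [componentDomain, if_pos hjk] at hβ
      change (1 - (N : ℝ)) / 2 < β.re at hβ
      rw [mem_Ioi]
      push_cast
      linarith
  · obtain ⟨E, hEa, hE⟩ := exists_monomialSum_of_finite hB hr (finite_branchSet hq i.2 j.2 hjk)
    obtain ⟨L, R, hL1, hL2, hL3, hR⟩ := exists_splitting (P := fun _ => ∅) hB hl hr h0 isOpen_univ
      isUpperSet_univ univ_nonempty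
      (fun τ _ => summableExponent_of_finite hB (finite_branchSet hq i.2 j.2 hjk) τ)
      (fun k β _ => hE k β) (fun k b _ => hEa k b) fun k b => simplePoleAt_of_analyticAt (hEa k b)
    refine ⟨L, principalOp h0 E, R, fun β _ => hL1 β (mem_univ _), fun b _ => hL2 b (by simp), hL3,
      fun N => ⟨fun b _ => analyticAt_principalOp h0 fun k _ => hEa k b,
        fun b => simplePoleAt_principalOp h0 fun k _ => simplePoleAt_of_analyticAt (hEa k b),
        fun β _ f z hz => ?_, finiteRank_principalOp h0 E N, fun β _ => hR N β (mem_univ _)⟩⟩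
    rw [if_neg hjk, val_principalOp]
    exact (hasSum_sum fun k _ => (hE k β z hz).mul_left (coeff f k)).tsum_eq.symm

/-! ### Operators on the direct sum -/

/-- The operator on the direct sum with a single component. -/
def componentCLM (c r : J q → ℝ) (i j : J q) :
    (Comp q c r j →L[ℂ] Comp q c r i) →L[ℂ] (Total q c r →L[ℂ] Total q c r) :=
  (ContinuousLinearMap.compL ℂ (Total q c r) (Comp q c r i) (Total q c r)
    (ContinuousLinearMap.single ℂ (Comp q c r) i)).comp
    ((ContinuousLinearMap.compL ℂ (Total q c r) (Comp q c r j) (Comp q c r i)).flip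
      (ContinuousLinearMap.proj j))

theorem componentCLM_apply (i j : J q) (T : Comp q c r j →L[ℂ] Comp q c r i) :
    componentCLM c r i j T = (ContinuousLinearMap.single ℂ (Comp q c r) i).comp
      (T.comp (ContinuousLinearMap.proj j)) := rfl

/-- The assembled operator is a finite sum of continuous linear images of its entries, so
analyticity, simple poles, finite rank and nuclearity pass from the entries to the whole. -/
theorem assemble_eq_sum (T : ∀ i j, Comp q c r j →L[ℂ] Comp q c r i) :
    assemble T = ∑ i, ∑ j, componentCLM c r i j (T i j) := by
  ext f i
  simp only [assemble, componentCLM_apply, ContinuousLinearMap.pi_apply, sum_apply,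
    ContinuousLinearMap.comp_apply, ContinuousLinearMap.proj_apply, Finset.sum_apply,
    ContinuousLinearMap.single_apply]
  rw [Finset.sum_comm]
  refine Finset.sum_congr rfl fun j _ => ?_
  rw [Finset.sum_eq_single i]
  · simp
  · intro k _ hk
    exact Pi.single_eq_of_ne hk.symm _
  · simp

theorem analyticAt_assemble {T : ∀ i j, ℂ → Comp q c r j →L[ℂ] Comp q c r i} {b : ℂ}
    (h : ∀ i j, AnalyticAt ℂ (T i j) b) :
    AnalyticAt ℂ (fun β => assemble fun i j => T i j β) b := by
  simp only [assemble_eq_sum]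
  exact Finset.analyticAt_fun_sum _ fun i _ => Finset.analyticAt_fun_sum _ fun j _ =>
    ((componentCLM c r i j).analyticAt _).comp (h i j)

theorem simplePoleAt_assemble {T : ∀ i j, ℂ → Comp q c r j →L[ℂ] Comp q c r i} {b : ℂ}
    (h : ∀ i j, SimplePoleAt (T i j) b) :
    SimplePoleAt (fun β => assemble fun i j => T i j β) b := by
  simp only [assemble_eq_sum]
  exact SimplePoleAt.sum _ fun i _ => SimplePoleAt.sum _ fun j _ =>
    (h i j).clm (componentCLM c r i j)

theorem finiteRank_assemble {T : ∀ i j, Comp q c r j →L[ℂ] Comp q c r i}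
    (h : ∀ i j, FiniteRank (T i j)) : FiniteRank (assemble T) := by
  rw [assemble_eq_sum]
  exact FiniteRank.sum _ fun i _ => FiniteRank.sum _ fun j _ => ((h i j).comp_clm _).clm_comp _

theorem nuclear_assemble {T : ∀ i j, Comp q c r j →L[ℂ] Comp q c r i}
    (h : ∀ i j, NuclearOfOrderZero (T i j)) : NuclearOfOrderZero (assemble T) := by
  rw [assemble_eq_sum]
  exact NuclearOfOrderZero.sum _ fun i _ => NuclearOfOrderZero.sum _ fun j _ =>
    ((h i j).comp_clm _).clm_comp _

theorem assemble_add (T T' : ∀ i j, Comp q c r j →L[ℂ] Comp q c r i) :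
    (assemble fun i j => T i j + T' i j) = assemble T + assemble T' := by
  simp only [assemble_eq_sum, map_add, Finset.sum_add_distrib]

theorem componentPoles_subset (q N : ℕ) (j : ℤ) : componentPoles q N j ⊆ polesUpTo N := by
  rw [componentPoles]
  split_ifs
  · exact Subset.rfl
  · exact empty_subset _

theorem halfPlane_subset (q N : ℕ) (j : ℤ) : halfPlane N ⊆ componentDomain q N j := by
  rw [componentDomain]
  split_ifs
  · exact Subset.rfl
  · exact subset_univ _

end Components

end HeckeTransfer

end

/-! ### The main theorem, assembled from its components -/

theorem mainTheorem2 (q : ℕ) (hq : 3 ≤ q) (c r : HeckeTransfer.J q → ℝ)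
    (hD : HeckeTransfer.Admissible q c r) :
    ∃ L : ∀ i j : HeckeTransfer.J q,
        ℂ → (HeckeTransfer.Comp q c r j →L[ℂ] HeckeTransfer.Comp q c r i),
      -- `L i j` continues the component `L_{β,ij}`, given by its series for `Re β > 1/2`
      (∀ i j : HeckeTransfer.J q, ∀ β : ℂ, 1 / 2 < β.re → HeckeTransfer.IsTransferComponent i j β (L i j β)) ∧
      (∀ i j : HeckeTransfer.J q, HeckeTransfer.MeromorphicSimplePoles (Set.range HeckeTransfer.betaPt) (L i j)) ∧
      -- the full operator
      HeckeTransfer.MeromorphicSimplePoles (Set.range HeckeTransfer.betaPt)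
        (fun β => HeckeTransfer.assemble fun i j => L i j β) ∧
      -- the splitting at level `N`
      ∀ N : ℕ, 1 ≤ N →
        ∃ A R : ∀ i j : HeckeTransfer.J q,
            ℂ → (HeckeTransfer.Comp q c r j →L[ℂ] HeckeTransfer.Comp q c r i),
          (∀ i j : HeckeTransfer.J q,
            HeckeTransfer.MeromorphicSimplePoles (HeckeTransfer.componentPoles q N j) (A i j) ∧
            (∀ β ∉ HeckeTransfer.componentPoles q N j,
              HeckeTransfer.IsPrincipalComponent N i j β (A i j β) ∧
              HeckeTransfer.FiniteRank (A i j β)) ∧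
            (∀ β ∈ HeckeTransfer.componentDomain q N j,
              AnalyticAt ℂ (R i j) β ∧
              HeckeTransfer.IsRemainderComponent N i j β (R i j β) ∧
              HeckeTransfer.NuclearOfOrderZero (R i j β)) ∧
            (∀ β ∈ HeckeTransfer.componentDomain q N j,
              β ∉ HeckeTransfer.componentPoles q N j → L i j β = A i j β + R i j β)) ∧
          HeckeTransfer.MeromorphicSimplePoles (HeckeTransfer.polesUpTo N)
            (fun β => HeckeTransfer.assemble fun i j => A i j β) ∧
          (∀ β ∉ HeckeTransfer.polesUpTo N,
            HeckeTransfer.FiniteRank (HeckeTransfer.assemble fun i j => A i j β)) ∧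
          (∀ β ∈ HeckeTransfer.halfPlane N,
            AnalyticAt ℂ (fun b => HeckeTransfer.assemble fun i j => R i j b) β ∧
            HeckeTransfer.NuclearOfOrderZero (HeckeTransfer.assemble fun i j => R i j β)) ∧
          (∀ β ∈ HeckeTransfer.halfPlane N, β ∉ HeckeTransfer.polesUpTo N →
            (HeckeTransfer.assemble fun i j => L i j β) =
              (HeckeTransfer.assemble fun i j => A i j β) +
                HeckeTransfer.assemble fun i j => R i j β) := by
  obtain hcomp := HeckeTransfer.exists_component hq hD
  choose L A R hL1 hL2 hL3 hN using hcomp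
  refine ⟨L, hL1, fun i j => .of_forall (hL2 i j) fun b _ => hL3 i j b,
    .of_forall (fun b hb => HeckeTransfer.analyticAt_assemble fun i j => hL2 i j b hb)
      fun b _ => HeckeTransfer.simplePoleAt_assemble fun i j => hL3 i j b, fun N _ =>
    ⟨fun i j => A i j N, fun i j => R i j N, fun i j => ?_, ?_, fun β _ => ?_, fun β hβ => ?_,
      fun β hβ _ => ?_⟩⟩
  · obtain ⟨h1, h2, h3, h4, h5⟩ := hN i j N
    exact ⟨.of_forall h1 fun b _ => h2 b, fun β hβ => ⟨h3 β hβ, h4 β⟩,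
      fun β hβ => ⟨(h5 β hβ).1, (h5 β hβ).2.1, (h5 β hβ).2.2.1⟩, fun β hβ _ => (h5 β hβ).2.2.2⟩
  · exact .of_forall (fun b hb => HeckeTransfer.analyticAt_assemble fun i j =>
      (hN i j N).1 b fun h => hb (HeckeTransfer.componentPoles_subset q N j h))
      fun b _ => HeckeTransfer.simplePoleAt_assemble fun i j => (hN i j N).2.1 b
  · exact HeckeTransfer.finiteRank_assemble fun i j => (hN i j N).2.2.2.1 β
  · have h5 := fun i j => (hN i j N).2.2.2.2 β (HeckeTransfer.halfPlane_subset q N j hβ)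
    exact ⟨HeckeTransfer.analyticAt_assemble fun i j => (h5 i j).1,
      HeckeTransfer.nuclear_assemble fun i j => (h5 i j).2.2.1⟩
  · rw [← HeckeTransfer.assemble_add]
    congr 1
    ext1 i
    ext1 j
    exact ((hN i j N).2.2.2.2 β (HeckeTransfer.halfPlane_subset q N j hβ)).2.2.2
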